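/- **Setting.** Let $\mathcal E$ be a finite-dimensional real inner product space with norm $\|\cdot\|$, let $m\ge 1$, $\alpha\in(0,1)$, and let $T_1,\dots,T_m:\mathcal E\to\mathcal E$ be $\alpha$-averaged, i.e. $T_i=(1-\alpha)I+\alpha R_i$ with $R_i$ nonexpansive. Assume $F:=\bigcap_{i=1}^m\mathrm{Fix}\,T_i\ne\emptyset$. An *o-minimal structure* on $(\mathbb R,+,\cdot)$ is a sequence of Boolean algebras $\mathcal O_n$ of subsets of $\mathbb R^n$ such that: $A\in\mathcal O_n$ implies $A\times\mathbb R,\ \mathbb R\times A\in\mathcal O_{n+1}$; the projection of $A\in\mathcal O_{n+1}$ on the first $n$ coordinates is in $\mathcal O_n$; $\mathcal O_n$ contains all sets $\{p=0\}$ with $p$ a polynomial; the members of $\mathcal O_1$ are exactly the finite unions of intervals and points. A map $\mathbb R^n\to\mathbb R^p$ is definable if its graph is in $\mathcal O_{n+p}$; an operator on $\mathcal E$ is definable if it is so in linear coordinates given by a basis. For $\rho\in\mathbb R$, a function $f$ that is positive and Lebesgue measurable on some $(0,c]$, $c>0$ (resp. some $[c,\infty)$, $c>0$) is in $\mathrm{RV}^0_\rho$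 (resp. $\mathrm{RV}_\rho$) if $f(\lambda t)/f(t)\to\lambda^\rho$ as $t\to0_+$ (resp. $t\to\infty$) for all $\lambda>0$. It is in $\mathrm{RV}^0_\infty$ (resp. $\mathrm{RV}_\infty$) if this limit is $0$ for $\lambda\in(0,1)$ and $+\infty$ for $\lambda>1$; $f$ is in $\mathrm{RV}^0_{-\infty}$ (resp. $\mathrm{RV}_{-\infty}$) if $1/f$ is in $\mathrm{RV}^0_{\infty}$ (resp. $\mathrm{RV}_\infty$). For bounded $B\subseteq\mathcal E$, a function $\psi:\mathbb R_+\to\mathbb R_+$ is a *regularity function of index $\rho\in[0,1]$ for the $T_i$ over $B$* if it is nondecreasing, $\lim_{t\to0_+}\psi(t)=\psi(0)=0$, $\psi\in\mathrm{RV}^0_\rho$, and $\mathrm{dist}(x,F)\le\psi(\max_i\|x-T_i(x)\|)$ for all $x\in B$. The $T_i$ are *jointly Karamata regular over $B$* (*Karamata regular* if $m=1$) if such a $\psi$ exists for some $\rho\in[0,1]$. **Statement.** Suppose $T_1,\dots,T_m$ are definable in some o-minimal structure. Then: **(A)** $T_1,\dots,T_m$ are jointly Karamata regular (resp. Karamata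 regular if $m=1$) over every bounded set $B\subseteq\mathcal E$. **(B)** Hence the following rates hold for quasi-cyclic algorithms. Let $x^{k+1}=\sum_{i=1}^m w_i^kT_i(x^k)$, $k\ge0$, where $w_i^k\ge0$, $\sum_iw_i^k=1$ and $\nu:=\inf_k\min\{w_i^k: w_i^k>0\}>0$. Then $\{x^k\}$ is bounded. Suppose moreover that $s\ge1$ is an integer such that for all $k$ and $i$ there is $j\in\{k,\dots,k+s-1\}$ with $w_i^j>0$. Then $x^k$ converges to some $x^*\in F$. Let $B$ be any bounded set containing $\{x^k\}$, let $\psi$ be any regularity function for the $T_i$ over $B$ (one exists by (A)), of index $\rho$, let $a>\mathrm{dist}^2(x^0,F)$, $\delta>0$, and define $$\phi(u)=\psi^2\Big(\sqrt{\tfrac{2\alpha(1+4\nu s)}{\nu(1-\alpha)}\,u}\Big)\ (0<u\le a),\qquad \phi^-(y)=\sup\{u\in(0,a]:\phi(u)<y\},$$ $$\Phi(u)=\int_u^\delta\frac{dt}{\phi^-(t)}\ (u>0),\qquad g(y)=\frac1{y\,\phi^-(1/y)}\ (y\ge 1/\delta).$$ For $h:[1/\delta,\infty)\to\mathbb R$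 write $h^{\leftarrow}(y)=\inf\{z\ge1/\delta:h(z)>y\}$. Then $\Phi$ is continuous and strictly decreasing on $(0,\infty)$ (so $\Phi^{-1}$ exists on its range), and: 1. either $x^k=x^*$ for all large $k$, or for every $k\ge0$ the number $\Phi(\mathrm{dist}^2(x^0,F))+\lfloor k/s\rfloor$ is in the range of $\Phi$ and $$\mathrm{dist}(x^k,F)\le\sqrt{\Phi^{-1}\big(\Phi(\mathrm{dist}^2(x^0,F))+\lfloor k/s\rfloor\big)} .$$ 2. If $\rho=0$, then $\Phi(u)\to\infty$ as $u\to0_+$, $\Phi\in\mathrm{RV}^0_{-\infty}$, $\Phi^{-1}\in\mathrm{RV}_0$, and $y^{-r}=o(\Phi^{-1}(y))$ as $y\to\infty$ for every $r>0$. If moreover $\ln g\in\mathrm{RV}_q$ for some $q>0$, then for every $\beta\in\mathbb R$, with $\widehat g(y)=y^\beta g(y)$, $\Phi^{-1}(y)\sim1/\widehat g^{\leftarrow}(y)$ as $y\to\infty$. 3. If $\rho\in(0,1)$, then $\Phi(u)\to\infty$ as $u\to0_+$, $\Phi\in\mathrm{RV}^0_{1-1/\rho}$, $\Phi^{-1}\in\mathrm{RV}_{\rho/(\rho-1)}$,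 $\Phi^{-1}(y)=o(y^{-r})$ as $y\to\infty$ whenever $0<r<-\rho/(\rho-1)$, and $\Phi^{-1}(y)\sim1/g^{\leftarrow}((1/\rho-1)y)$ as $y\to\infty$. 4. If $\rho=1$, and either $\{x^k\}$ does not reach $x^*$ in finitely many steps and $B$ is closed and connected, or there is $c>0$ with $\phi(t)\ge ct$ for all small $t>0$, then $\Phi(u)\to\infty$ as $u\to0_+$, $\Phi\in\mathrm{RV}^0_0$, $\Phi^{-1}\in\mathrm{RV}_{-\infty}$, and $\Phi^{-1}(y)=o(y^{-r})$ as $y\to\infty$ for every $r>0$. 5. If $\rho=1$ and $\phi(t)-\mu t=o(t)$ as $t\to0_+$ for some $\mu>0$, then there are $\tau_1,\tau_2>0$ and $0<c_1<c_2<1$ with $\tau_1c_1^y\le\Phi^{-1}(y)\le\tau_2c_2^y$ for all large $y$. If $\rho=1$ and $t=o(\phi(t))$ as $t\to0_+$, then $\Phi(u)\to\infty$ as $u\to0_+$ and $1/(\Phi^{-1}(y)\,g^{\leftarrow}(y))\to0$ as $y\to\infty$. -/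

import Mathlib

open Set Filter Topology Asymptotics MeasureTheory

noncomputable section

/-! ### o-minimal structures on the real field -/

/-- An o-minimal structure on `(ℝ, +, ·)`: for each `n` a Boolean algebra `sets n` of subsets of
`ℝⁿ`, subject to the usual axioms. The subsets of `ℝ` satisfying `Set.OrdConnected` are exactly the
intervals of all kinds (bounded or not, open, closed or half-open), the single points and `∅`. -/
structure OMinimalStructure where
  sets : (n : ℕ) → Set (Set (Fin n → ℝ))
  empty_mem : ∀ n, (∅ : Set (Fin n → ℝ)) ∈ sets n
  compl_mem : ∀ n, ∀ A ∈ sets n, Aᶜ ∈ sets n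
  union_mem : ∀ n, ∀ A ∈ sets n, ∀ A' ∈ sets n, A ∪ A' ∈ sets n
  /-- `A × ℝ` is in the structure. -/
  prod_line_mem : ∀ n, ∀ A ∈ sets n,
    {x : Fin (n + 1) → ℝ | (fun i : Fin n => x i.castSucc) ∈ A} ∈ sets (n + 1)
  /-- `ℝ × A` is in the structure. -/
  line_prod_mem : ∀ n, ∀ A ∈ sets n,
    {x : Fin (n + 1) → ℝ | (fun i : Fin n => x i.succ) ∈ A} ∈ sets (n + 1)
  /-- The projection forgetting the last coordinate. -/
  proj_mem : ∀ n, ∀ A ∈ sets (n + 1),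
    (fun (x : Fin (n + 1) → ℝ) (i : Fin n) => x i.castSucc) '' A ∈ sets n
  algebraic_mem : ∀ n (p : MvPolynomial (Fin n) ℝ), {x | MvPolynomial.eval x p = 0} ∈ sets n
  mem_one_iff : ∀ A : Set (Fin 1 → ℝ), A ∈ sets 1 ↔
    ∃ S : Set (Set ℝ), S.Finite ∧ (∀ I ∈ S, I.OrdConnected) ∧ A = {x | x 0 ∈ ⋃₀ S}

/-- A map `ℝⁿ → ℝᵖ` is definable if its graph, a subset of `ℝⁿ⁺ᵖ`, is definable. -/
def OMinimalStructure.DefinableMap (O : OMinimalStructure) {n p : ℕ}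
    (f : (Fin n → ℝ) → (Fin p → ℝ)) : Prop :=
  {z : Fin (n + p) → ℝ |
    (fun j : Fin p => z (Fin.natAdd n j)) = f (fun i : Fin n => z (Fin.castAdd p i))} ∈
    O.sets (n + p)

/-- An operator on a finite-dimensional space is definable if it is a definable map `ℝᵈ → ℝᵈ` in
the linear coordinates given by a basis. -/
def OMinimalStructure.DefinableOperator (O : OMinimalStructure) {E : Type*} [AddCommGroup E]
    [Module ℝ E] {d : ℕ} (b : Module.Basis (Fin d) ℝ E) (T : E → E) : Prop :=
  O.DefinableMap (fun y : Fin d → ℝ => b.equivFun (T (b.equivFun.symm y)))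

/-! ### Regular and rapid variation

`AEMeasurable f (volume.restrict S)` says that `f` is Lebesgue measurable on `S`. -/

/-- `f ∈ RV⁰_ρ`: regular variation at `0` with (finite) index `ρ`. -/
def RegVaryZero (ρ : ℝ) (f : ℝ → ℝ) : Prop :=
  (∃ a > 0, AEMeasurable f (volume.restrict (Ioc 0 a)) ∧ ∀ t ∈ Ioc 0 a, 0 < f t) ∧
    ∀ c > 0, Tendsto (fun t => f (c * t) / f t) (𝓝[>] 0) (𝓝 (c ^ ρ))

/-- `f ∈ RV_ρ`: regular variation at infinity with (finite) index `ρ`. -/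
def RegVaryTop (ρ : ℝ) (f : ℝ → ℝ) : Prop :=
  (∃ a > 0, AEMeasurable f (volume.restrict (Ici a)) ∧ ∀ t ∈ Ici a, 0 < f t) ∧
    ∀ c > 0, Tendsto (fun t => f (c * t) / f t) atTop (𝓝 (c ^ ρ))

/-- `f ∈ RV⁰_∞`: rapid variation at `0` of index `∞`. -/
def RapidVaryZero (f : ℝ → ℝ) : Prop :=
  (∃ a > 0, AEMeasurable f (volume.restrict (Ioc 0 a)) ∧ ∀ t ∈ Ioc 0 a, 0 < f t) ∧
    (∀ c ∈ Ioo (0 : ℝ) 1, Tendsto (fun t => f (c * t) / f t) (𝓝[>] 0) (𝓝 0)) ∧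
    (∀ c > 1, Tendsto (fun t => f (c * t) / f t) (𝓝[>] 0) atTop)

/-- `f ∈ RV_∞`: rapid variation at infinity of index `∞`. -/
def RapidVaryTop (f : ℝ → ℝ) : Prop :=
  (∃ a > 0, AEMeasurable f (volume.restrict (Ici a)) ∧ ∀ t ∈ Ici a, 0 < f t) ∧
    (∀ c ∈ Ioo (0 : ℝ) 1, Tendsto (fun t => f (c * t) / f t) atTop (𝓝 0)) ∧
    (∀ c > 1, Tendsto (fun t => f (c * t) / f t) atTop atTop)

/-- `f ∈ RV⁰_{-∞}`. -/
def RapidVaryZeroNeg (f : ℝ → ℝ) : Prop := RapidVaryZero (fun t => 1 / f t)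

/-- `f ∈ RV_{-∞}`. -/
def RapidVaryTopNeg (f : ℝ → ℝ) : Prop := RapidVaryTop (fun t => 1 / f t)

/-! ### Operators and Karamata regularity -/

section Operators

variable {E : Type*} [NormedAddCommGroup E] [InnerProductSpace ℝ E] {m : ℕ}

/-- `T = (1 - α) I + α R` for some nonexpansive `R`. -/
def IsAveraged (α : ℝ) (T : E → E) : Prop :=
  ∃ R : E → E, LipschitzWith 1 R ∧ ∀ x, T x = (1 - α) • x + α • R x

/-- The set of common fixed points. -/
def commonFix (T : Fin m → E → E) : Set E := ⋂ i, Function.fixedPoints (T i)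

/-- `ψ` is a regularity function, of index `ρ`, for the operators `L` over `B`. Only the values of
`ψ` on `[0, ∞)` matter. -/
structure IsRegularityFunction (L : Fin m → E → E) (B : Set E) (ρ : ℝ) (ψ : ℝ → ℝ) : Prop where
  nonneg : ∀ t ≥ 0, 0 ≤ ψ t
  error_bound : ∀ x ∈ B, Metric.infDist x (commonFix L) ≤ ψ (⨆ i, ‖x - L i x‖)
  mono : MonotoneOn ψ (Ici 0)
  map_zero : ψ 0 = 0
  tendsto_zero : Tendsto ψ (𝓝[>] 0) (𝓝 0)
  index_mem : ρ ∈ Icc (0 : ℝ) 1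
  regVary : RegVaryZero ρ ψ

/-- Joint Karamata regularity over `B` (Karamata regularity if there is just one operator). -/
def JointlyKaramataRegular (L : Fin m → E → E) (B : Set E) : Prop :=
  (commonFix L).Nonempty ∧ Bornology.IsBounded B ∧
    ∃ (ρ : ℝ) (ψ : ℝ → ℝ), IsRegularityFunction L B ρ ψ

/-! ### Quasi-cyclic algorithms -/

/-- `ν = inf_k min {w_i^k : w_i^k > 0}`. -/
def minWeight (w : ℕ → Fin m → ℝ) : ℝ := sInf {r | ∃ k i, 0 < w k i ∧ w k i = r}

/-- `x` is generated by the quasi-cyclic algorithm with operators `T` and weights `w`. -/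
structure IsQuasiCyclic (T : Fin m → E → E) (w : ℕ → Fin m → ℝ) (x : ℕ → E) : Prop where
  weight_nonneg : ∀ k i, 0 ≤ w k i
  weight_sum : ∀ k, ∑ i, w k i = 1
  minWeight_pos : 0 < minWeight w
  step : ∀ k, x (k + 1) = ∑ i, w k i • T i (x k)

end Operators

/-! ### Rate functions -/

/-- Minus inverse `f⁻(y) = sup {x ∈ (0, a] : f x < y}` of `f : (0, a] → ℝ`. -/
def minusInv (f : ℝ → ℝ) (a y : ℝ) : ℝ := sSup {x | x ∈ Ioc 0 a ∧ f x < y}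

/-- Arrow inverse `f^←(y) = inf {x ∈ [a, ∞) : f x > y}` of `f : [a, ∞) → ℝ`. -/
def arrowInv (f : ℝ → ℝ) (a y : ℝ) : ℝ := sInf {x | x ∈ Ici a ∧ y < f x}

/-- `Φ_f(u) = ∫_u^δ dt / f⁻(t)` for `f : (0, a] → ℝ`, considered for `u > 0`. -/
def ratePhi (f : ℝ → ℝ) (a δ u : ℝ) : ℝ := ∫ t in u..δ, 1 / minusInv f a t

/-- The inverse of `Φ_f : (0, ∞) → ℝ`, meaningful on the range of `Φ_f`. -/
def ratePhiInv (f : ℝ → ℝ) (a δ : ℝ) : ℝ → ℝ := Function.invFunOn (ratePhi f a δ) (Ioi 0)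

/-- `u ↦ ψ(√(2α(1 + 4νs) / (ν(1 - α)) · u))²`. -/
def phiHat (α ν s : ℝ) (ψ : ℝ → ℝ) (u : ℝ) : ℝ :=
  ψ (√(2 * α * (1 + 4 * ν * s) / (ν * (1 - α)) * u)) ^ 2

end

/-! For (A), the candidate is the optimal modulus ω(t) = sup {dist(x, F) : ‖x‖ ≤ R, ‖x - T_i x‖ ≤ t
for all i} (`residualModulus`). It is nondecreasing, and it tends to 0 at 0 by compactness. Unless F
is the whole space, ω(t) ≥ t/2 for small t, because residuals are at most 2 dist(x, F) and the
distance takes all intermediate values on the ball. The inequality ω(ct) < r ω(t) is a first-order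
condition on t, so by o-minimality it is eventually true or eventually false as t → 0+
(`residualModulus_dichotomy`). The bounded ratios ω(ct)/ω(t), 0 < c < 1, therefore cannot oscillate,
and they converge. The limit is multiplicative and monotone in c, hence a power c^ρ, and the linear
lower bound forces ρ ≤ 1 (`exists_regVaryZero`).

For (B), averagedness and Jensen give Fejér monotonicity with a gain proportional to the weighted
squared residuals. Within s steps every operator is active, so each squared residual at x^k is at
most a constant times d_k - d_{k+s}, where d_k = dist²(x^k, F). Joint regularity turns this into d_k
≤ φ(d_k - d_{k+s}), so φ⁻(d_k) ≤ d_k - d_{k+s}. As 1/φ⁻ is nonincreasing, its integral over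
[d_{k+s}, d_k] is at least 1, that is, Φ(d_{k+s}) ≥ Φ(d_k) + 1 (`IsGauge.le_ratePhiInv`).

The asymptotics follow the index ρ of φ through three operations. The inverse φ⁻ has index 1/ρ
(rapid variation if ρ = 0), the integral Φ has index 1 - 1/ρ, and Φ⁻¹ has the reciprocal index. Each
transfer is carried out with inequalities valid near 0 and slightly perturbed constants. Power
bounds come from dyadic iteration. The sharp equivalents use Karamata's relation u/φ⁻(u) ~ (1/ρ - 1)
Φ(u), proved by comparing Φ(cu) - Φ(u) with (1 - c)u/φ⁻(u) for c near 1. For ρ = 0, the assumption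
on ln g makes every power of z negligible against a dilation of z. -/

/-! ### Polynomial functions -/

section Polynomial

variable {n k : ℕ}

/-- Polynomial functions on `ℝⁿ`. -/
def IsPolyFun (f : (Fin n → ℝ) → ℝ) : Prop :=
  ∃ p : MvPolynomial (Fin n) ℝ, ∀ x, f x = MvPolynomial.eval x p

theorem isPolyFun_const (c : ℝ) : IsPolyFun (fun _ : Fin n → ℝ => c) :=
  ⟨MvPolynomial.C c, fun x => by simp⟩

theorem isPolyFun_coord (i : Fin n) : IsPolyFun (fun x : Fin n → ℝ => x i) :=
  ⟨MvPolynomial.X i, fun x => by simp⟩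

theorem IsPolyFun.add {f g : (Fin n → ℝ) → ℝ} (hf : IsPolyFun f) (hg : IsPolyFun g) :
    IsPolyFun (fun x => f x + g x) := by
  obtain ⟨p, hp⟩ := hf
  obtain ⟨q, hq⟩ := hg
  exact ⟨p + q, fun x => by simp [hp, hq]⟩

theorem IsPolyFun.mul {f g : (Fin n → ℝ) → ℝ} (hf : IsPolyFun f) (hg : IsPolyFun g) :
    IsPolyFun (fun x => f x * g x) := by
  obtain ⟨p, hp⟩ := hf
  obtain ⟨q, hq⟩ := hg
  exact ⟨p * q, fun x => by simp [hp, hq]⟩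

theorem IsPolyFun.sub {f g : (Fin n → ℝ) → ℝ} (hf : IsPolyFun f) (hg : IsPolyFun g) :
    IsPolyFun (fun x => f x - g x) := by
  obtain ⟨p, hp⟩ := hf
  obtain ⟨q, hq⟩ := hg
  exact ⟨p - q, fun x => by simp [hp, hq]⟩

theorem IsPolyFun.pow {f : (Fin n → ℝ) → ℝ} (hf : IsPolyFun f) (r : ℕ) : IsPolyFun (fun x => f x ^ r) := by
  obtain ⟨p, hp⟩ := hf
  exact ⟨p ^ r, fun x => by simp [hp]⟩

theorem IsPolyFun.sum {ι : Type*} (s : Finset ι) {f : ι → (Fin n → ℝ) → ℝ}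
    (hf : ∀ i, IsPolyFun (f i)) : IsPolyFun (fun x => ∑ i ∈ s, f i x) := by
  choose p hp using hf
  exact ⟨∑ i ∈ s, p i, fun x => by simp [hp]⟩

theorem IsPolyFun.comp {f : (Fin n → ℝ) → ℝ} (hf : IsPolyFun f) {g : (Fin k → ℝ) → Fin n → ℝ}
    (hg : ∀ i, IsPolyFun (fun x => g x i)) : IsPolyFun (fun x => f (g x)) := by
  obtain ⟨p, hp⟩ := hf
  choose q hq using hg
  refine ⟨MvPolynomial.bind₁ q p, fun x => ?_⟩
  have hgx : g x = fun i => MvPolynomial.eval x (q i) := funext fun i => hq i x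
  change f (g x) = _
  rw [hp, hgx]
  exact (MvPolynomial.eval₂Hom_bind₁ (RingHom.id ℝ) x q p).symm

/-- In coordinates the squared norm is the quadratic form of the Gram matrix of `b`; the norm enters
definable conditions only through it. -/
theorem isPolyFun_norm_sq {E : Type*} [NormedAddCommGroup E] [InnerProductSpace ℝ E] {d : ℕ}
    (b : Module.Basis (Fin d) ℝ E) {p : (Fin n → ℝ) → Fin d → ℝ}
    (hp : ∀ i, IsPolyFun (fun x => p x i)) : IsPolyFun (fun x => ‖b.equivFun.symm (p x)‖ ^ 2) := by
  have h : (fun x => ‖b.equivFun.symm (p x)‖ ^ 2) =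
      fun x => ∑ i, ∑ j, p x i * (p x j * inner ℝ (b i) (b j)) := by
    funext x
    rw [← real_inner_self_eq_norm_sq, Module.Basis.equivFun_symm_apply, sum_inner]
    refine Finset.sum_congr rfl fun i _ => ?_
    rw [inner_sum]
    refine Finset.sum_congr rfl fun j _ => ?_
    rw [real_inner_smul_left, real_inner_smul_right]
  rw [h]
  exact IsPolyFun.sum _ fun i => IsPolyFun.sum _ fun j => (hp i).mul ((hp j).mul (isPolyFun_const _))

end Polynomial

/-! ### First-order definability -/

namespace OMinimalStructure

variable {O : OMinimalStructure} {n k : ℕ}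

/-- A property of points of `ℝⁿ` is definable if it defines a set of the structure. -/
def Def (O : OMinimalStructure) (P : (Fin n → ℝ) → Prop) : Prop := {x | P x} ∈ O.sets n

theorem Def.not {P : (Fin n → ℝ) → Prop} (h : O.Def P) : O.Def (fun x => ¬ P x) :=
  O.compl_mem n _ h

theorem Def.or {P Q : (Fin n → ℝ) → Prop} (hP : O.Def P) (hQ : O.Def Q) :
    O.Def (fun x => P x ∨ Q x) :=
  O.union_mem n _ hP _ hQ

theorem Def.congr {P Q : (Fin n → ℝ) → Prop} (hP : O.Def P) (h : ∀ x, Q x ↔ P x) : O.Def Q := by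
  have : Q = P := funext fun x => propext (h x)
  rwa [this]

theorem Def.and {P Q : (Fin n → ℝ) → Prop} (hP : O.Def P) (hQ : O.Def Q) :
    O.Def (fun x => P x ∧ Q x) :=
  (hP.not.or hQ.not).not.congr fun x => by tauto

theorem Def.imp {P Q : (Fin n → ℝ) → Prop} (hP : O.Def P) (hQ : O.Def Q) :
    O.Def (fun x => P x → Q x) :=
  (hP.not.or hQ).congr fun x => by tauto

theorem def_true : O.Def (fun _ : Fin n → ℝ => True) :=
  Def.congr (P := fun x => ¬ x ∈ (∅ : Set (Fin n → ℝ))) (O.compl_mem n _ (O.empty_mem n))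
    fun x => by simp

theorem Def.forall_finset {ι : Type*} (s : Finset ι) {P : ι → (Fin n → ℝ) → Prop}
    (h : ∀ i, O.Def (P i)) : O.Def (fun x => ∀ i ∈ s, P i x) := by
  classical
  induction s using Finset.induction_on with
  | empty => exact def_true.congr fun x => by simp
  | insert i s _ ih => exact ((h i).and ih).congr fun x => by simp

theorem Def.forall_fintype {ι : Type*} [Fintype ι] {P : ι → (Fin n → ℝ) → Prop}
    (h : ∀ i, O.Def (P i)) : O.Def (fun x => ∀ i, P i x) :=
  (Def.forall_finset Finset.univ h).congr fun x => by simp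

theorem def_poly_eq {f g : (Fin n → ℝ) → ℝ} (hf : IsPolyFun f) (hg : IsPolyFun g) :
    O.Def (fun x => f x = g x) := by
  obtain ⟨p, hp⟩ := hf.sub hg
  refine Def.congr (O.algebraic_mem n p) fun x => ?_
  rw [← hp, sub_eq_zero]

theorem image_castAdd_mem {A : Set (Fin (n + k) → ℝ)} (hA : A ∈ O.sets (n + k)) :
    (fun (x : Fin (n + k) → ℝ) (i : Fin n) => x (Fin.castAdd k i)) '' A ∈ O.sets n := by
  induction k with
  | zero =>
    have h : (fun (x : Fin (n + 0) → ℝ) (i : Fin n) => x (Fin.castAdd 0 i)) '' A = A :=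
      image_id' A
    rw [h]
    exact hA
  | succ k ih =>
    have h := ih (O.proj_mem (n + k) A hA)
    rw [image_image] at h
    exact h

theorem Def.exists {R : (Fin n → ℝ) → (Fin k → ℝ) → Prop}
    (h : O.Def (fun z : Fin (n + k) → ℝ =>
      R (fun i => z (Fin.castAdd k i)) (fun j => z (Fin.natAdd n j)))) :
    O.Def (fun x => ∃ y, R x y) := by
  refine Def.congr (image_castAdd_mem h) fun x => ?_
  constructor
  · rintro ⟨y, hy⟩
    exact ⟨Fin.append x y, by simpa using hy, by simp⟩
  · rintro ⟨z, hz, rfl⟩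
    exact ⟨_, hz⟩

theorem Def.forall {R : (Fin n → ℝ) → (Fin k → ℝ) → Prop}
    (h : O.Def (fun z : Fin (n + k) → ℝ =>
      R (fun i => z (Fin.castAdd k i)) (fun j => z (Fin.natAdd n j)))) :
    O.Def (fun x => ∀ y, R x y) :=
  (Def.exists (R := fun x y => ¬ R x y) h.not).not.congr fun x => by push Not; rfl

/-- Iterates `line_prod_mem`. The dimension `N` is kept free because `k + 1 + n` is not
definitionally a successor. -/
theorem preimage_shift_mem {A : Set (Fin n → ℝ)} (hA : A ∈ O.sets n) (k N : ℕ) (hN : k + n = N) :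
    {x : Fin N → ℝ | (fun i : Fin n => x ⟨k + i, by omega⟩) ∈ A} ∈ O.sets N := by
  induction k generalizing N with
  | zero =>
    obtain rfl : n = N := by omega
    convert hA using 1
    ext x
    simp
  | succ k ih =>
    obtain ⟨N, rfl⟩ : ∃ N', N = N' + 1 := ⟨N - 1, by omega⟩
    have h := O.line_prod_mem N _ (ih N (by omega))
    convert h using 4
    simp only [mem_ofPred_eq, Fin.succ_mk]
    refine Eq.to_iff (congrArg (fun y => y ∈ A) (funext fun i => ?_))
    congr 2
    omega

/-- `P (f x)` means that some `y` equal to `f x` satisfies `P`, so cylinders, polynomial equations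
and a projection suffice. -/
theorem Def.subst {P : (Fin n → ℝ) → Prop} (hP : O.Def P) {f : (Fin k → ℝ) → Fin n → ℝ}
    (hf : ∀ i, IsPolyFun (fun x => f x i)) : O.Def (fun x => P (f x)) := by
  have h1 : O.Def (fun z : Fin (k + n) → ℝ => P (fun j => z (Fin.natAdd k j))) :=
    preimage_shift_mem hP k (k + n) rfl
  have h2 : O.Def (fun z : Fin (k + n) → ℝ =>
      ∀ j, z (Fin.natAdd k j) = f (fun i => z (Fin.castAdd n i)) j) :=
    Def.forall_fintype fun j => def_poly_eq (isPolyFun_coord _) ((hf j).comp fun i => isPolyFun_coord _)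
  refine (Def.exists (R := fun x y => P y ∧ ∀ j, y j = f x j) (h1.and h2)).congr fun x => ?_
  constructor
  · exact fun h => ⟨f x, h, fun _ => rfl⟩
  · rintro ⟨y, hy, hyx⟩
    rwa [← funext hyx]

/-- The order is recovered from the algebraic axiom: a real number is nonnegative iff it is a
square. -/
theorem def_poly_le {f g : (Fin n → ℝ) → ℝ} (hf : IsPolyFun f) (hg : IsPolyFun g) :
    O.Def (fun x => f x ≤ g x) := by
  have h : O.Def (fun z : Fin (n + 1) → ℝ => g (fun i => z (Fin.castAdd 1 i)) =
      f (fun i => z (Fin.castAdd 1 i)) + z (Fin.natAdd n 0) ^ 2) :=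
    def_poly_eq (hg.comp fun i => isPolyFun_coord _)
      ((hf.comp fun i => isPolyFun_coord _).add ((isPolyFun_coord _).pow 2))
  refine (Def.exists (R := fun x y => g x = f x + y 0 ^ 2) h).congr fun x => ?_
  constructor
  · intro hle
    exact ⟨fun _ => √(g x - f x), by rw [Real.sq_sqrt (by linarith)]; ring⟩
  · rintro ⟨y, hy⟩
    nlinarith [sq_nonneg (y 0)]

/-- A definable property of a real variable is eventually true or eventually false at `0+`. -/
theorem Def.eventually_or {P : (Fin 1 → ℝ) → Prop} (hP : O.Def P) :
    (∀ᶠ t in 𝓝[>] (0 : ℝ), P (fun _ => t)) ∨ ∀ᶠ t in 𝓝[>] (0 : ℝ), ¬ P (fun _ => t) := by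
  obtain ⟨S, hS, hI, hA⟩ := (O.mem_one_iff _).1 hP
  have hP' : ∀ t : ℝ, P (fun _ => t) ↔ ∃ I ∈ S, t ∈ I := fun t => by
    have := Set.ext_iff.1 hA (fun _ => t)
    simpa using this
  -- An order-connected set with points arbitrarily close to 0 on the right contains everything
  -- between 0 and any of its positive points.
  have key : ∀ I ∈ S, (∀ᶠ t in 𝓝[>] (0 : ℝ), t ∈ I) ∨ ∀ᶠ t in 𝓝[>] (0 : ℝ), t ∉ I := by
    intro I hIS
    by_contra! hc
    obtain ⟨h1, h2⟩ := hc
    obtain ⟨t₀, ht₀, ht₀pos⟩ := (h2.and_eventually self_mem_nhdsWithin).exists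
    refine (not_eventually.2 h1) ?_
    filter_upwards [Ioo_mem_nhdsGT (show (0 : ℝ) < t₀ from ht₀pos)] with t ht
    obtain ⟨t₁, ht₁, ht₁'⟩ := (h2.and_eventually (Ioo_mem_nhdsGT ht.1)).exists
    exact ((hI I hIS).out ht₁ ht₀ ⟨ht₁'.2.le, ht.2.le⟩)
  by_cases hex : ∃ I ∈ S, ∀ᶠ t in 𝓝[>] (0 : ℝ), t ∈ I
  · obtain ⟨I, hIS, h⟩ := hex
    exact Or.inl (h.mono fun t ht => (hP' t).2 ⟨I, hIS, ht⟩)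
  · push Not at hex
    right
    have h : ∀ᶠ t in 𝓝[>] (0 : ℝ), ∀ I ∈ S, t ∉ I := by
      rw [hS.eventually_all]
      exact fun I hIS => (key I hIS).resolve_left (not_eventually.2 (hex I hIS))
    filter_upwards [h] with t ht
    rw [hP']
    push Not
    exact ht

/-! ### Definable operators -/

section Operators

variable {E : Type*} [NormedAddCommGroup E] [InnerProductSpace ℝ E] {d m : ℕ}
  {b : Module.Basis (Fin d) ℝ E} {T : Fin m → E → E}

theorem def_norm_le {p : (Fin n → ℝ) → Fin d → ℝ} {s : (Fin n → ℝ) → ℝ}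
    (hp : ∀ i, IsPolyFun (fun x => p x i)) (hs : IsPolyFun s) :
    O.Def (fun x => ‖b.equivFun.symm (p x)‖ ≤ s x) := by
  refine ((def_poly_le (isPolyFun_const 0) hs).and
    (def_poly_le (isPolyFun_norm_sq b hp) (hs.pow 2))).congr fun x => ?_
  constructor
  · exact fun h => ⟨(norm_nonneg _).trans h, by gcongr⟩
  · exact fun h => (pow_le_pow_iff_left₀ (norm_nonneg _) h.1 two_ne_zero).1 h.2

theorem DefinableOperator.def_eq {L : E → E} (hL : O.DefinableOperator b L)
    {p q : (Fin n → ℝ) → Fin d → ℝ} (hp : ∀ i, IsPolyFun (fun x => p x i))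
    (hq : ∀ i, IsPolyFun (fun x => q x i)) :
    O.Def (fun x => q x = b.equivFun (L (b.equivFun.symm (p x)))) := by
  have h := Def.subst (O := O) (P := fun z : Fin (d + d) → ℝ =>
    (fun j : Fin d => z (Fin.natAdd d j)) =
      b.equivFun (L (b.equivFun.symm (fun i : Fin d => z (Fin.castAdd d i))))) hL
    (f := fun x => Fin.append (p x) (q x)) (fun i => by
      refine Fin.addCases (fun i => ?_) (fun i => ?_) i
      · simpa only [Fin.append_left] using hp i
      · simpa only [Fin.append_right] using hq i)
  simpa only [Fin.append_left, Fin.append_right] using h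

theorem def_mem_commonFix (hdef : ∀ i, O.DefinableOperator b (T i))
    {p : (Fin n → ℝ) → Fin d → ℝ} (hp : ∀ i, IsPolyFun (fun x => p x i)) :
    O.Def (fun x => b.equivFun.symm (p x) ∈ commonFix T) := by
  refine (Def.forall_fintype fun i => (hdef i).def_eq hp hp).congr fun x => ?_
  simp only [commonFix, mem_iInter, Function.mem_fixedPoints, Function.IsFixedPt]
  refine forall_congr' fun i => ?_
  rw [eq_comm, LinearEquiv.symm_apply_eq]

theorem def_residual_le (hdef : ∀ i, O.DefinableOperator b (T i))
    {p : (Fin n → ℝ) → Fin d → ℝ} {s : (Fin n → ℝ) → ℝ}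
    (hp : ∀ i, IsPolyFun (fun x => p x i)) (hs : IsPolyFun s) :
    O.Def (fun x => ∀ i, ‖b.equivFun.symm (p x) - T i (b.equivFun.symm (p x))‖ ≤ s x) := by
  refine Def.forall_fintype fun i => ?_
  have hp' : ∀ i, IsPolyFun (fun z : Fin (n + d) → ℝ => p (fun i => z (Fin.castAdd d i)) i) :=
    fun i => (hp i).comp fun _ => isPolyFun_coord _
  have h1 := (hdef i).def_eq hp' (q := fun z j => z (Fin.natAdd n j)) fun j => isPolyFun_coord _
  have h2 := def_norm_le (O := O) (b := b)
    (p := fun z : Fin (n + d) → ℝ => p (fun i => z (Fin.castAdd d i)) - fun j => z (Fin.natAdd n j))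
    (fun j => (hp' j).sub (isPolyFun_coord _))
    (hs.comp (g := fun z : Fin (n + d) → ℝ => fun i => z (Fin.castAdd d i)) fun _ => isPolyFun_coord _)
  -- The value of T_i is not polynomial in `x`; it is named by a quantified variable so that only
  -- its graph is used.
  refine (Def.exists (R := fun x y => y = b.equivFun (T i (b.equivFun.symm (p x))) ∧
    ‖b.equivFun.symm (p x - y)‖ ≤ s x) (h1.and h2)).congr fun x => ?_
  simp only [map_sub, exists_eq_left, LinearEquiv.symm_apply_apply]

/-- First-order form of ω(t) ≤ s. With polynomial `t` and `s`, it serves both for ω(ct) ≤ s and for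
ω(t) ≤ s/r. -/
theorem def_forall_exists_commonFix (hdef : ∀ i, O.DefinableOperator b (T i)) (R : ℝ)
    {t s : (Fin n → ℝ) → ℝ} (ht : IsPolyFun t) (hs : IsPolyFun s) :
    O.Def (fun v => ∀ x : E, ‖x‖ ≤ R → (∀ i, ‖x - T i x‖ ≤ t v) →
      ∃ z ∈ commonFix T, ‖x - z‖ ≤ s v) := by
  have hx : ∀ i, IsPolyFun (fun v : Fin (n + d) → ℝ => v (Fin.natAdd n i)) := fun i => isPolyFun_coord _
  have h1 := def_norm_le (O := O) (b := b) hx (isPolyFun_const R)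
  have h2 := def_residual_le hdef hx
    (ht.comp (g := fun z : Fin (n + d) → ℝ => fun i => z (Fin.castAdd d i)) fun _ => isPolyFun_coord _)
  have h3 : O.Def (fun v : Fin (n + d) → ℝ => ∃ y : Fin d → ℝ, b.equivFun.symm y ∈ commonFix T ∧
      ‖b.equivFun.symm ((fun i => v (Fin.natAdd n i)) - y)‖ ≤ s (fun i => v (Fin.castAdd d i))) := by
    refine Def.exists (Def.and ?_ ?_)
    · exact def_mem_commonFix hdef fun i => isPolyFun_coord _
    · exact def_norm_le (fun i => (isPolyFun_coord _).sub (isPolyFun_coord _))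
        (hs.comp fun _ => isPolyFun_coord _)
  refine (Def.forall (R := fun v y => ‖b.equivFun.symm y‖ ≤ R →
    (∀ i, ‖b.equivFun.symm y - T i (b.equivFun.symm y)‖ ≤ t v) →
    ∃ z : Fin d → ℝ, b.equivFun.symm z ∈ commonFix T ∧ ‖b.equivFun.symm (y - z)‖ ≤ s v)
    (h1.imp (h2.imp h3))).congr fun v => ?_
  constructor
  · intro h y hy hr
    obtain ⟨z, hz, hyz⟩ := h _ hy hr
    refine ⟨b.equivFun z, ?_, ?_⟩
    · rwa [LinearEquiv.symm_apply_apply]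
    · rwa [map_sub, LinearEquiv.symm_apply_apply]
  · intro h x hx hr
    obtain ⟨z, hz, hxz⟩ := h (b.equivFun x) (by rwa [LinearEquiv.symm_apply_apply])
      (by rwa [LinearEquiv.symm_apply_apply])
    exact ⟨b.equivFun.symm z, hz, by rwa [map_sub, LinearEquiv.symm_apply_apply] at hxz⟩

end Operators

end OMinimalStructure

/-! ### Regular variation from a tame ratio -/

theorem eventually_nhdsGT_zero_comp_mul {P : ℝ → Prop} (h : ∀ᶠ t in 𝓝[>] (0 : ℝ), P t) {c : ℝ}
    (hc : 0 < c) : ∀ᶠ t in 𝓝[>] (0 : ℝ), P (c * t) := by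
  refine Tendsto.eventually ?_ h
  refine tendsto_nhdsWithin_iff.2 ⟨?_, ?_⟩
  · have : Tendsto (fun t : ℝ => c * t) (𝓝 0) (𝓝 (c * 0)) := tendsto_id.const_mul c
    rw [mul_zero] at this
    exact this.mono_left nhdsWithin_le_nhds
  · filter_upwards [self_mem_nhdsWithin] with t ht
    exact mul_pos hc ht

theorem tendsto_const_mul_nhdsGT_zero {c : ℝ} (hc : 0 < c) :
    Tendsto (fun t : ℝ => c * t) (𝓝[>] 0) (𝓝[>] 0) :=
  fun _ hs => eventually_nhdsGT_zero_comp_mul hs hc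

theorem exists_pos_forall_of_eventually {P : ℝ → Prop} (h : ∀ᶠ t in 𝓝[>] (0 : ℝ), P t) :
    ∃ t₀ > 0, ∀ t, 0 < t → t ≤ t₀ → P t := by
  obtain ⟨u, hu, hP⟩ := mem_nhdsGT_iff_exists_Ioc_subset.1 h
  exact ⟨u, hu, fun t h0 h1 => hP ⟨h0, h1⟩⟩

/-- A multiplicative, nondecreasing function on `(0, ∞)` is a power function. -/
theorem exists_rpow_of_mul_of_mono {L : ℝ → ℝ} (hpos : ∀ c > 0, 0 < L c)
    (hmul : ∀ c > 0, ∀ c' > 0, L (c * c') = L c * L c')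
    (hmono : ∀ c > 0, ∀ c', c ≤ c' → L c ≤ L c') : ∃ ρ : ℝ, 0 ≤ ρ ∧ ∀ c > 0, L c = c ^ ρ := by
  -- In logarithmic coordinates `L` is additive. Being monotone it is measurable, hence continuous,
  -- hence linear.
  let A : ℝ →+ ℝ := AddMonoidHom.mk' (fun x => Real.log (L (Real.exp x))) fun x y => by
    rw [Real.exp_add, hmul _ (Real.exp_pos _) _ (Real.exp_pos _),
      Real.log_mul (hpos _ (Real.exp_pos _)).ne' (hpos _ (Real.exp_pos _)).ne']
  have hA : ∀ x, A x = Real.log (L (Real.exp x)) := fun _ => rfl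
  have hmonoA : Monotone A := fun x y hxy => by
    rw [hA, hA]
    exact Real.log_le_log (hpos _ (Real.exp_pos _))
      (hmono _ (Real.exp_pos _) _ (Real.exp_le_exp.2 hxy))
  have hcont : Continuous A := MeasureTheory.Measure.AddMonoidHom.continuous_of_measurable A hmonoA.measurable
  have hlin : ∀ x, A x = x * A 1 := fun x => by
    have := map_real_smul A hcont x 1
    simpa using this
  refine ⟨A 1, ?_, fun c hc => ?_⟩
  · simpa using hmonoA zero_le_one
  · have h1 := hlin (Real.log c)
    rw [hA, Real.exp_log hc] at h1
    rw [Real.rpow_def_of_pos hc, ← h1, Real.exp_log (hpos c hc)]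

theorem pow_le_of_iterate {f : ℝ → ℝ} {c q t₀ : ℝ} (hc : c ∈ Ioo (0 : ℝ) 1) (hq : 0 ≤ q)
    (ht₀ : 0 < t₀) (h : ∀ t, 0 < t → t ≤ t₀ → f (c * t) ≤ q * f t) (n : ℕ) :
    f (c ^ n * t₀) ≤ q ^ n * f t₀ := by
  induction n with
  | zero => simp
  | succ n ih =>
    have h1 := h (c ^ n * t₀) (mul_pos (pow_pos hc.1 n) ht₀)
      (mul_le_of_le_one_left ht₀.le (pow_le_one₀ hc.1.le hc.2.le))
    calc f (c ^ (n + 1) * t₀) = f (c * (c ^ n * t₀)) := by ring_nf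
      _ ≤ q * f (c ^ n * t₀) := h1
      _ ≤ q * (q ^ n * f t₀) := by gcongr
      _ = q ^ (n + 1) * f t₀ := by ring

/-- A nondecreasing function bounded below by a linear function, whose ratios `f (c t) / f t`
do not oscillate at `0+`, varies regularly with an index in `[0, 1]`. -/
theorem exists_regVaryZero {f : ℝ → ℝ} (hmono : MonotoneOn f (Ioi 0)) {κ : ℝ} (hκ : 0 < κ)
    (hlow : ∀ᶠ t in 𝓝[>] 0, κ * t ≤ f t)
    (hdich : ∀ c ∈ Ioo (0 : ℝ) 1, ∀ r > 0, (∀ᶠ t in 𝓝[>] 0, f (c * t) < r * f t) ∨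
      ∀ᶠ t in 𝓝[>] 0, ¬ f (c * t) < r * f t) :
    ∃ ρ ∈ Icc (0 : ℝ) 1, RegVaryZero ρ f := by
  obtain ⟨a, ha, hlow'⟩ := exists_pos_forall_of_eventually hlow
  have hfpos : ∀ t > 0, 0 < f t := fun t ht => by
    have hm : 0 < min t a := lt_min ht ha
    calc 0 < κ * min t a := mul_pos hκ hm
      _ ≤ f (min t a) := hlow' _ hm (min_le_right _ _)
      _ ≤ f t := hmono hm ht (min_le_left _ _)
  have hlim1 : ∀ c ∈ Ioo (0 : ℝ) 1, ∃ l ≥ c, Tendsto (fun t => f (c * t) / f t) (𝓝[>] 0) (𝓝 l) := by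
    intro c hc
    have hpos : ∀ᶠ t in 𝓝[>] (0 : ℝ), 0 < f (c * t) / f t := by
      filter_upwards [self_mem_nhdsWithin] with t ht
      exact div_pos (hfpos _ (mul_pos hc.1 ht)) (hfpos t ht)
    have hle : ∀ᶠ t in 𝓝[>] (0 : ℝ), f (c * t) / f t ≤ 1 := by
      filter_upwards [self_mem_nhdsWithin] with t ht
      have ht : 0 < t := ht
      exact (div_le_one (hfpos t ht)).2 (hmono (mul_pos hc.1 ht) ht (by nlinarith [hc.2]))
    obtain ⟨l, hl⟩ : ∃ l, Tendsto (fun t => f (c * t) / f t) (𝓝[>] 0) (𝓝 l) := by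
      -- A ratio bounded in [0, 1] converges if it cannot be frequently below `r` and frequently
      -- above `r'` for some `r < r'`; `hdich` at level `r` excludes this.
      refine tendsto_of_no_upcrossings dense_univ ?_ ⟨1, by simpa using hle⟩
        ⟨0, by simpa using hpos.mono fun t ht => ht.le⟩
      rintro r - r' - hrr' ⟨h1, h2⟩
      have hr : 0 < r := by
        obtain ⟨t, ht1, ht2⟩ := (h1.and_eventually hpos).exists
        exact ht2.trans ht1
      rcases hdich c hc r hr with h | h
      · obtain ⟨t, ht1, ht2, ht3⟩ := (h2.and_eventually (h.and self_mem_nhdsWithin)).exists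
        rw [← div_lt_iff₀ (hfpos t ht3)] at ht2
        linarith
      · obtain ⟨t, ht1, ht2, ht3⟩ := (h1.and_eventually (h.and self_mem_nhdsWithin)).exists
        exact ht2 ((div_lt_iff₀ (hfpos t ht3)).1 ht1)
    refine ⟨l, ?_, hl⟩
    -- If the limit were below q < c, iteration would give f(cⁿ t₀) ≤ qⁿ f(t₀), against the lower
    -- bound κ cⁿ t₀, since (q/c)ⁿ → 0.
    by_contra! hlc
    have hl0 : 0 ≤ l := ge_of_tendsto hl (hpos.mono fun t ht => ht.le)
    obtain ⟨q, hlq, hqc⟩ := exists_between hlc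
    have hq : 0 < q := hl0.trans_lt hlq
    have hev : ∀ᶠ t in 𝓝[>] (0 : ℝ), f (c * t) ≤ q * f t := by
      filter_upwards [hl.eventually (gt_mem_nhds hlq), self_mem_nhdsWithin] with t h1 h2
      exact ((div_lt_iff₀ (hfpos t h2)).1 h1).le
    obtain ⟨t₀, ht₀, h₀⟩ := exists_pos_forall_of_eventually (hev.and hlow)
    have hb : ∀ n : ℕ, κ * t₀ / f t₀ ≤ (q / c) ^ n := fun n => by
      have h1 := pow_le_of_iterate hc hq.le ht₀ (fun t h1 h2 => (h₀ t h1 h2).1) n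
      have h2 := (h₀ (c ^ n * t₀) (mul_pos (pow_pos hc.1 n) ht₀)
        (mul_le_of_le_one_left ht₀.le (pow_le_one₀ hc.1.le hc.2.le))).2
      rw [div_pow, div_le_div_iff₀ (hfpos t₀ ht₀) (pow_pos hc.1 n)]
      calc κ * t₀ * c ^ n = κ * (c ^ n * t₀) := by ring
        _ ≤ _ := h2.trans h1
    have h3 := ge_of_tendsto' (tendsto_pow_atTop_nhds_zero_of_lt_one (div_pos hq hc.1).le
      ((div_lt_one hc.1).2 hqc)) hb
    have h4 : 0 < κ * t₀ / f t₀ := div_pos (mul_pos hκ ht₀) (hfpos t₀ ht₀)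
    linarith
  have hlim : ∀ c : ℝ, ∃ l, 0 < c → 0 < l ∧ Tendsto (fun t => f (c * t) / f t) (𝓝[>] 0) (𝓝 l) := by
    intro c
    by_cases hc : 0 < c
    swap
    · exact ⟨0, fun h => absurd h hc⟩
    rcases lt_trichotomy c 1 with h | rfl | h
    · obtain ⟨l, hl, hl'⟩ := hlim1 c ⟨hc, h⟩
      exact ⟨l, fun _ => ⟨hc.trans_le hl, hl'⟩⟩
    · refine ⟨1, fun _ => ⟨one_pos, tendsto_const_nhds.congr' ?_⟩⟩
      filter_upwards [self_mem_nhdsWithin] with t ht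
      rw [one_mul, div_self (hfpos t ht).ne']
    -- For c > 1, replacing t by ct turns the ratio for c⁻¹ into the reciprocal of the ratio for c.
    · have hci : c⁻¹ ∈ Ioo (0 : ℝ) 1 := ⟨inv_pos.2 hc, inv_lt_one_of_one_lt₀ h⟩
      obtain ⟨l, hl, hl'⟩ := hlim1 c⁻¹ hci
      have hl0 : 0 < l := hci.1.trans_le hl
      refine ⟨l⁻¹, fun _ => ⟨inv_pos.2 hl0, ?_⟩⟩
      refine ((hl'.comp (tendsto_const_mul_nhdsGT_zero hc)).inv₀ hl0.ne').congr fun t => ?_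
      simp [inv_mul_cancel_left₀ hc.ne']
  choose L hL using hlim
  obtain ⟨ρ, hρ, hLρ⟩ := exists_rpow_of_mul_of_mono (L := L) (fun c hc => (hL c hc).1)
    (fun c hc c' hc' => by
      have h1 := ((hL c hc).2.comp (tendsto_const_mul_nhdsGT_zero hc')).mul (hL c' hc').2
      refine tendsto_nhds_unique (hL (c * c') (mul_pos hc hc')).2 (h1.congr' ?_)
      filter_upwards [self_mem_nhdsWithin] with t ht
      have := (hfpos _ (mul_pos hc' ht)).ne'
      simp only [Function.comp, mul_assoc]
      field_simp)
    (fun c hc c' hcc' => by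
      refine le_of_tendsto_of_tendsto (hL c hc).2 (hL c' (hc.trans_le hcc')).2 ?_
      filter_upwards [self_mem_nhdsWithin] with t ht
      have ht : 0 < t := ht
      have := hfpos t ht
      have := hmono (mul_pos hc ht) (mul_pos (hc.trans_le hcc') ht) (by gcongr)
      gcongr)
  refine ⟨ρ, ⟨hρ, ?_⟩, ⟨1, one_pos, ?_, fun t ht => hfpos t ht.1⟩, fun c hc => ?_⟩
  -- The bound l ≥ c at c = 1/2 reads (1/2)^ρ ≥ 1/2, which is ρ ≤ 1.
  · obtain ⟨l, hl, hl'⟩ := hlim1 (1 / 2) (by norm_num)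
    have h1 : l = (1 / 2) ^ ρ := by
      rw [← hLρ _ (by norm_num)]
      exact tendsto_nhds_unique hl' (hL (1 / 2) (by norm_num)).2
    rw [h1] at hl
    by_contra! hρ1
    have := Real.rpow_lt_rpow_of_exponent_gt (show (0 : ℝ) < 1 / 2 by norm_num) (by norm_num) hρ1
    rw [Real.rpow_one] at this
    linarith
  · exact aemeasurable_restrict_of_monotoneOn measurableSet_Ioc
      (hmono.mono fun t ht => ht.1)
  · rw [← hLρ c hc]
    exact (hL c hc).2

/-! ### Joint Karamata regularity of definable operators -/

section Modulus

variable {E : Type*} [NormedAddCommGroup E] {m : ℕ} {T : Fin m → E → E} {R : ℝ}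

theorem isClosed_commonFix (hT : ∀ i, LipschitzWith 1 (T i)) : IsClosed (commonFix T) :=
  isClosed_iInter fun i => isClosed_fixedPoints (hT i).continuous

/-- Both x and T_i x lie within ‖x - z‖ of any z ∈ F. This converse of an error bound is what keeps
moduli at least linear. -/
theorem norm_sub_le_two_mul_infDist (hT : ∀ i, LipschitzWith 1 (T i))
    (hF : (commonFix T).Nonempty) (x : E) (i : Fin m) :
    ‖x - T i x‖ ≤ 2 * Metric.infDist x (commonFix T) := by
  have : ‖x - T i x‖ / 2 ≤ Metric.infDist x (commonFix T) := by
    refine (Metric.le_infDist hF).2 fun {z} hz => ?_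
    have hz' : T i z = z := mem_iInter.1 hz i
    have h := (hT i).dist_le_mul z x
    rw [hz', NNReal.coe_one, one_mul] at h
    have h2 := dist_triangle x z (T i x)
    rw [dist_comm z x] at h
    rw [← dist_eq_norm]
    linarith
  linarith

/-- The modulus `sup {dist (x, F) : ‖x‖ ≤ R, max_i ‖x - T_i x‖ ≤ t}`. -/
noncomputable def residualModulus (T : Fin m → E → E) (R t : ℝ) : ℝ :=
  sSup ((fun x => Metric.infDist x (commonFix T)) '' {x | ‖x‖ ≤ R ∧ ∀ i, ‖x - T i x‖ ≤ t})

theorem infDist_commonFix_le {z : E} (hz : z ∈ commonFix T) (hzR : ‖z‖ ≤ R) {x : E}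
    (hx : ‖x‖ ≤ R) : Metric.infDist x (commonFix T) ≤ 2 * R :=
  (Metric.infDist_le_dist_of_mem hz).trans (by
    rw [dist_eq_norm]; exact (norm_sub_le _ _).trans (by linarith))

theorem le_residualModulus {z : E} (hz : z ∈ commonFix T) (hzR : ‖z‖ ≤ R) {x : E} {t : ℝ}
    (hx : ‖x‖ ≤ R) (hxt : ∀ i, ‖x - T i x‖ ≤ t) :
    Metric.infDist x (commonFix T) ≤ residualModulus T R t :=
  le_csSup ⟨2 * R, by rintro _ ⟨y, hy, rfl⟩; exact infDist_commonFix_le hz hzR hy.1⟩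
    ⟨x, ⟨hx, hxt⟩, rfl⟩

theorem residualModulus_le {z : E} (hz : z ∈ commonFix T) (hzR : ‖z‖ ≤ R) {t s : ℝ} (ht : 0 ≤ t)
    (h : ∀ x, ‖x‖ ≤ R → (∀ i, ‖x - T i x‖ ≤ t) → Metric.infDist x (commonFix T) ≤ s) :
    residualModulus T R t ≤ s := by
  refine csSup_le ?_ ?_
  · refine ⟨_, z, ⟨hzR, fun i => ?_⟩, rfl⟩
    have hz' : T i z = z := mem_iInter.1 hz i
    simpa [hz'] using ht
  · rintro _ ⟨x, hx, rfl⟩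
    exact h x hx.1 hx.2

theorem residualModulus_mono {z : E} (hz : z ∈ commonFix T) (hzR : ‖z‖ ≤ R) :
    MonotoneOn (residualModulus T R) (Ici 0) := fun _ hs _ _ hst =>
  residualModulus_le hz hzR hs fun _ hx hxs =>
    le_residualModulus hz hzR hx fun i => (hxs i).trans hst

theorem residualModulus_nonneg (t : ℝ) : 0 ≤ residualModulus T R t :=
  Real.sSup_nonneg (by rintro _ ⟨x, -, rfl⟩; exact Metric.infDist_nonneg)

theorem residualModulus_zero {z : E} (hz : z ∈ commonFix T) (hzR : ‖z‖ ≤ R) :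
    residualModulus T R 0 = 0 := by
  refine le_antisymm (residualModulus_le hz hzR le_rfl fun x _ hx => ?_) (residualModulus_nonneg _)
  refine (Metric.infDist_zero_of_mem (mem_iInter.2 fun i => ?_)).le
  have := norm_le_zero_iff.1 (hx i)
  exact (sub_eq_zero.1 this).symm

/-- On the compact part of the ball at distance at least a/2 from F, the sum of the residuals has a
positive minimum, so points with small residuals lie outside that part. -/
theorem tendsto_residualModulus [ProperSpace E] (hT : ∀ i, LipschitzWith 1 (T i)) {z : E}
    (hz : z ∈ commonFix T) (hzR : ‖z‖ ≤ R) :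
    Tendsto (residualModulus T R) (𝓝[>] 0) (𝓝 0) := by
  rw [tendsto_order]
  refine ⟨fun a ha => Eventually.of_forall fun t => ha.trans_le (residualModulus_nonneg t),
    fun a ha => ?_⟩
  have hKc : IsCompact {x : E | ‖x‖ ≤ R ∧ a / 2 ≤ Metric.infDist x (commonFix T)} := by
    have h1 : IsCompact (Metric.closedBall (0 : E) R) := isCompact_closedBall _ _
    convert h1.inter_right (isClosed_le (continuous_const (y := a / 2))
      (Metric.continuous_infDist_pt (commonFix T))) using 1
    ext x
    simp
  have hres : Continuous fun x => ∑ i, ‖x - T i x‖ :=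
    continuous_finsetSum _ fun i _ => (continuous_id.sub (hT i).continuous).norm
  have hmain : ∃ t₀ > 0, ∀ x : E, ‖x‖ ≤ R → a / 2 ≤ Metric.infDist x (commonFix T) →
      t₀ ≤ ∑ i, ‖x - T i x‖ := by
    rcases eq_empty_or_nonempty {x : E | ‖x‖ ≤ R ∧ a / 2 ≤ Metric.infDist x (commonFix T)} with
      he | hne
    · exact ⟨1, one_pos, fun x h1 h2 => absurd (show x ∈ (∅ : Set E) from he ▸ ⟨h1, h2⟩) id⟩
    · obtain ⟨y, hy, hmin⟩ := hKc.exists_isMinOn hne hres.continuousOn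
      refine ⟨∑ i, ‖y - T i y‖, ?_, fun x h1 h2 => hmin ⟨h1, h2⟩⟩
      refine (Finset.sum_nonneg fun i _ => norm_nonneg _).lt_of_ne' fun h0 => ?_
      rw [Finset.sum_eq_zero_iff_of_nonneg fun i _ => norm_nonneg _] at h0
      have hyF : y ∈ commonFix T := mem_iInter.2 fun i =>
        (sub_eq_zero.1 (norm_eq_zero.1 (h0 i (Finset.mem_univ i)))).symm
      have := hy.2
      rw [Metric.infDist_zero_of_mem hyF] at this
      linarith
  obtain ⟨t₀, ht₀, hmin⟩ := hmain
  -- The divisor `m + 1` makes m residuals below this threshold sum to less than `t₀`, and it is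
  -- nonzero even if `m = 0`.
  have hm : 0 < t₀ / (m + 1) := by positivity
  filter_upwards [Ioo_mem_nhdsGT hm] with t ht
  refine lt_of_le_of_lt (residualModulus_le hz hzR ht.1.le fun x hx hxt => ?_) (half_lt_self ha)
  by_contra! hlt
  have h1 := hmin x hx hlt.le
  have h2 : ∑ i, ‖x - T i x‖ ≤ m * t := by
    simpa using Finset.sum_le_card_nsmul Finset.univ _ t fun i _ => hxt i
  have h3 := (lt_div_iff₀ (by positivity)).1 ht.2
  nlinarith [ht.1]

end Modulus

/-! ### Definability of the modulus and regularity over bounded sets -/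

section Definable

variable {E : Type*} [NormedAddCommGroup E] [InnerProductSpace ℝ E] {m : ℕ} {T : Fin m → E → E}
  {R : ℝ}

theorem IsAveraged.lipschitzWith {α : ℝ} (hα : α ∈ Ioo (0 : ℝ) 1) {L : E → E} (hL : IsAveraged α L) :
    LipschitzWith 1 L := by
  obtain ⟨R, hR, hLR⟩ := hL
  refine LipschitzWith.of_dist_le_mul fun x y => ?_
  have h := hR.dist_le_mul x y
  rw [dist_eq_norm, dist_eq_norm] at *
  simp only [NNReal.coe_one, one_mul] at *
  calc ‖L x - L y‖ = ‖(1 - α) • (x - y) + α • (R x - R y)‖ := by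
        rw [hLR, hLR]; congr 1; module
    _ ≤ ‖(1 - α) • (x - y)‖ + ‖α • (R x - R y)‖ := norm_add_le _ _
    _ = (1 - α) * ‖x - y‖ + α * ‖R x - R y‖ := by
        rw [norm_smul, norm_smul, Real.norm_of_nonneg (by linarith [hα.2]),
          Real.norm_of_nonneg hα.1.le]
    _ ≤ (1 - α) * ‖x - y‖ + α * ‖x - y‖ := by have := hα.1; gcongr
    _ = ‖x - y‖ := by ring

/-- By the intermediate value theorem the ball contains a point at distance exactly t/2 from F, and
its residuals are at most t. -/
theorem half_mul_le_residualModulus (hT : ∀ i, LipschitzWith 1 (T i)) {z : E}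
    (hz : z ∈ commonFix T) (hzR : ‖z‖ ≤ R) {y : E} (hy : Metric.infDist y (commonFix T) ≠ 0)
    (hyR : ‖y‖ ≤ R) : ∀ᶠ t in 𝓝[>] 0, 1 / 2 * t ≤ residualModulus T R t := by
  have hD : 0 < Metric.infDist y (commonFix T) := Metric.infDist_nonneg.lt_of_ne' hy
  filter_upwards [Ioo_mem_nhdsGT hD] with t ht
  have hconn : IsPreconnected (Metric.closedBall (0 : E) R) :=
    (convex_closedBall 0 R).isPreconnected
  have := hconn.intermediate_value (a := z) (b := y) (by simpa) (by simpa)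
    (Metric.continuous_infDist_pt (commonFix T)).continuousOn
  obtain ⟨x, hx, hxt⟩ := this
    (show t / 2 ∈ Icc (Metric.infDist z (commonFix T)) (Metric.infDist y (commonFix T)) from
      ⟨by rw [Metric.infDist_zero_of_mem hz]; linarith [ht.1], by linarith [ht.1, ht.2]⟩)
  have hle := le_residualModulus (t := t) hz hzR (x := x) (by simpa using hx) fun i => by
    have := norm_sub_le_two_mul_infDist hT ⟨z, hz⟩ x i
    simp only at hxt
    linarith
  simp only at hxt
  linarith

theorem residualModulus_dichotomy [ProperSpace E] {d : ℕ} {b : Module.Basis (Fin d) ℝ E}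
    {O : OMinimalStructure} (hdef : ∀ i, O.DefinableOperator b (T i))
    (hT : ∀ i, LipschitzWith 1 (T i)) {z : E} (hz : z ∈ commonFix T) (hzR : ‖z‖ ≤ R)
    {c r : ℝ} (hc : 0 < c) (hr : 0 < r) :
    (∀ᶠ t in 𝓝[>] 0, residualModulus T R (c * t) < r * residualModulus T R t) ∨
      ∀ᶠ t in 𝓝[>] 0, ¬ residualModulus T R (c * t) < r * residualModulus T R t := by
  have hle : ∀ t ≥ 0, ∀ s, residualModulus T R t ≤ s ↔
      ∀ x : E, ‖x‖ ≤ R → (∀ i, ‖x - T i x‖ ≤ t) → ∃ y ∈ commonFix T, ‖x - y‖ ≤ s := by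
    intro t ht s
    constructor
    -- F is closed in a proper space, so the distance is attained and a bound on it becomes an
    -- existential statement.
    · intro h x hx hxt
      obtain ⟨y, hy, hxy⟩ := (isClosed_commonFix hT).exists_infDist_eq_dist ⟨z, hz⟩ x
      refine ⟨y, hy, ?_⟩
      rw [← dist_eq_norm, ← hxy]
      exact (le_residualModulus hz hzR hx hxt).trans h
    · intro h
      refine residualModulus_le hz hzR ht fun x hx hxt => ?_
      obtain ⟨y, hy, hxy⟩ := h x hx hxt
      refine (Metric.infDist_le_dist_of_mem hy).trans ?_
      rwa [dist_eq_norm]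
  have h1 := OMinimalStructure.def_forall_exists_commonFix (n := 2) hdef R
    ((isPolyFun_const c).mul (isPolyFun_coord 0)) (isPolyFun_coord 1)
  have h2 := OMinimalStructure.def_forall_exists_commonFix (n := 2) hdef R
    (isPolyFun_coord 0) ((isPolyFun_const r⁻¹).mul (isPolyFun_coord 1))
  -- ω(ct) < r ω(t) is expressed as: some s satisfies ω(ct) ≤ s but not ω(t) ≤ s/r.
  have h3 := OMinimalStructure.Def.exists (n := 1) (k := 1) (R := fun t s =>
    (∀ x : E, ‖x‖ ≤ R → (∀ i, ‖x - T i x‖ ≤ c * t 0) → ∃ y ∈ commonFix T, ‖x - y‖ ≤ s 0) ∧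
    ¬ ∀ x : E, ‖x‖ ≤ R → (∀ i, ‖x - T i x‖ ≤ t 0) → ∃ y ∈ commonFix T, ‖x - y‖ ≤ r⁻¹ * s 0)
    (h1.and h2.not)
  have hiff : ∀ t : ℝ, 0 < t → ((∃ s : Fin 1 → ℝ,
      (∀ x : E, ‖x‖ ≤ R → (∀ i, ‖x - T i x‖ ≤ c * t) → ∃ y ∈ commonFix T, ‖x - y‖ ≤ s 0) ∧
      ¬ ∀ x : E, ‖x‖ ≤ R → (∀ i, ‖x - T i x‖ ≤ t) → ∃ y ∈ commonFix T, ‖x - y‖ ≤ r⁻¹ * s 0) ↔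
      residualModulus T R (c * t) < r * residualModulus T R t) := by
    intro t ht
    simp only [← hle t ht.le, ← hle (c * t) (mul_pos hc ht).le, not_le, inv_mul_lt_iff₀ hr]
    exact ⟨fun ⟨s, hs1, hs2⟩ => hs1.trans_lt hs2, fun h => ⟨fun _ => _, le_rfl, h⟩⟩
  refine h3.eventually_or.imp (fun h => ?_) fun h => ?_
  · filter_upwards [h, self_mem_nhdsWithin] with t ht ht0
    exact (hiff t ht0).1 ht
  · filter_upwards [h, self_mem_nhdsWithin] with t ht ht0
    exact fun hlt => ht ((hiff t ht0).2 hlt)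

theorem regVaryZero_id : RegVaryZero 1 (fun t => t) := by
  refine ⟨⟨1, one_pos, measurable_id.aemeasurable, fun t ht => ht.1⟩, fun c _ => ?_⟩
  rw [Real.rpow_one]
  refine tendsto_const_nhds.congr' ?_
  filter_upwards [self_mem_nhdsWithin] with t ht
  have ht : 0 < t := ht
  field_simp

theorem jointlyKaramataRegular_of_definable {d : ℕ} (b : Module.Basis (Fin d) ℝ E)
    {O : OMinimalStructure} (hdef : ∀ i, O.DefinableOperator b (T i))
    (hT : ∀ i, LipschitzWith 1 (T i)) (hF : (commonFix T).Nonempty) {B : Set E}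
    (hB : Bornology.IsBounded B) : JointlyKaramataRegular T B := by
  have : FiniteDimensional ℝ E := Module.Basis.finiteDimensional_of_finite b
  have : ProperSpace E := FiniteDimensional.proper_real E
  refine ⟨hF, hB, ?_⟩
  obtain ⟨z, hz⟩ := hF
  -- When F is the whole space, ω vanishes identically and cannot vary regularly; the identity
  -- function is then a regularity function of index 1.
  by_cases hall : ∀ y, Metric.infDist y (commonFix T) = 0
  · refine ⟨1, fun t => t, ⟨fun t ht => ht, fun x _ => ?_, fun _ _ _ _ h => h, rfl,
      tendsto_id.mono_left nhdsWithin_le_nhds, by simp, regVaryZero_id⟩⟩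
    rw [hall]
    exact Real.iSup_nonneg fun i => norm_nonneg _
  · push Not at hall
    obtain ⟨y, hy⟩ := hall
    -- The ball is enlarged to contain a point of F and a point outside F.
    obtain ⟨R₀, hR₀⟩ := (hB.union (Set.toFinite {z, y}).isBounded).exists_norm_le
    have hzR : ‖z‖ ≤ R₀ := hR₀ z (by simp)
    have hyR : ‖y‖ ≤ R₀ := hR₀ y (by simp)
    have hmono := residualModulus_mono hz hzR
    obtain ⟨ρ, hρ, hreg⟩ := exists_regVaryZero (hmono.mono Ioi_subset_Ici_self) (by norm_num)
      (half_mul_le_residualModulus hT hz hzR hy hyR) fun c hc r hr =>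
        residualModulus_dichotomy hdef hT hz hzR hc.1 hr
    refine ⟨ρ, residualModulus T R₀, ⟨fun t _ => residualModulus_nonneg t, fun x hx => ?_, hmono,
      residualModulus_zero hz hzR, tendsto_residualModulus hT hz hzR, hρ, hreg⟩⟩
    exact le_residualModulus hz hzR (hR₀ x (Or.inl hx)) fun i =>
      le_ciSup (f := fun i => ‖x - T i x‖) (Set.finite_range _).bddAbove i

end Definable

/-! ### Quasi-cyclic algorithms -/

section Jensen

variable {E : Type*} [NormedAddCommGroup E] [InnerProductSpace ℝ E] {m : ℕ}

theorem norm_sum_smul_sq_le {w : Fin m → ℝ} (hw : ∀ i, 0 ≤ w i) (hw1 : ∑ i, w i = 1)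
    (v : Fin m → E) : ‖∑ i, w i • v i‖ ^ 2 ≤ ∑ i, w i * ‖v i‖ ^ 2 := by
  have hconv : ConvexOn ℝ univ fun x : E => ‖x‖ ^ 2 :=
    (convexOn_norm convex_univ).pow (fun _ _ => norm_nonneg _) 2
  simpa using hconv.map_sum_le (t := Finset.univ) (w := w) (p := v) (fun i _ => hw i) hw1
    fun _ _ => mem_univ _

/-- Since R fixes z, put u = x - z and v = Rx - z. Then ‖(1-α)u + αv‖² = (1-α)‖u‖² + α‖v‖² -
α(1-α)‖u-v‖², with ‖v‖ ≤ ‖u‖ and x - Lx = α(u - v). -/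
theorem IsAveraged.norm_sub_sq_le {α : ℝ} (hα : α ∈ Ioo (0 : ℝ) 1) {L : E → E}
    (hL : IsAveraged α L) {z : E} (hz : L z = z) (x : E) :
    ‖L x - z‖ ^ 2 ≤ ‖x - z‖ ^ 2 - (1 - α) / α * ‖x - L x‖ ^ 2 := by
  obtain ⟨R, hR, hLR⟩ := hL
  have hRz : R z = z := by
    have h1 := hLR z
    rw [hz] at h1
    have h2 : α • (R z - z) = 0 := by
      have : α • (R z - z) = ((1 - α) • z + α • R z) - z := by module
      rw [this, ← h1, sub_self]
    exact sub_eq_zero.1 ((smul_eq_zero.1 h2).resolve_left hα.1.ne')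
  have h := hR.dist_le_mul x z
  rw [hRz, dist_eq_norm, dist_eq_norm, NNReal.coe_one, one_mul] at h
  have h' : ‖R x - z‖ ^ 2 ≤ ‖x - z‖ ^ 2 := by gcongr
  have e1 : L x - z = (1 - α) • (x - z) + α • (R x - z) := by rw [hLR]; module
  have e2 : x - L x = α • ((x - z) - (R x - z)) := by rw [hLR]; module
  rw [e1, e2, norm_smul, mul_pow, norm_add_sq_real, norm_sub_sq_real (x - z) (R x - z), norm_smul, norm_smul,
    real_inner_smul_left, real_inner_smul_right, mul_pow, mul_pow]
  simp only [Real.norm_eq_abs, sq_abs]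
  have e3 : ∀ q : ℝ, (1 - α) / α * (α ^ 2 * q) = (1 - α) * α * q := fun q => by
    have := hα.1.ne'
    field_simp
  rw [e3]
  nlinarith [hα.1]

end Jensen

/-- Taking the infimum over z on the right passes the Fejér inequality to distances without using a
nearest point. -/
theorem infDist_sq_le_of_forall {E : Type*} [NormedAddCommGroup E] {F : Set E} (hF : F.Nonempty)
    {x y : E} {A : ℝ} (h : ∀ z ∈ F, ‖y - z‖ ^ 2 ≤ ‖x - z‖ ^ 2 - A) :
    Metric.infDist y F ^ 2 ≤ Metric.infDist x F ^ 2 - A := by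
  have h1 : ∀ z ∈ F, √(Metric.infDist y F ^ 2 + A) ≤ ‖x - z‖ := fun z hz => by
    rw [Real.sqrt_le_left (norm_nonneg _)]
    have h2 := Metric.infDist_le_dist_of_mem hz (x := y)
    rw [dist_eq_norm] at h2
    have h3 := h z hz
    have h4 : Metric.infDist y F ^ 2 ≤ ‖y - z‖ ^ 2 := by
      have := Metric.infDist_nonneg (x := y) (s := F)
      gcongr
    linarith
  have h2 : √(Metric.infDist y F ^ 2 + A) ≤ Metric.infDist x F := by
    refine (Metric.le_infDist hF).2 fun {z} hz => ?_
    rw [dist_eq_norm]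
    exact h1 z hz
  rw [Real.sqrt_le_left Metric.infDist_nonneg] at h2
  linarith

/-! ### Fejér monotonicity, convergence and the one-sweep inequality -/

namespace IsQuasiCyclic

variable {E : Type*} [NormedAddCommGroup E] [InnerProductSpace ℝ E] {m : ℕ} {T : Fin m → E → E}
  {w : ℕ → Fin m → ℝ} {x : ℕ → E} {α : ℝ}

theorem minWeight_le (h : IsQuasiCyclic T w x) {k : ℕ} {i : Fin m} (hk : 0 < w k i) :
    minWeight w ≤ w k i := by
  refine csInf_le ⟨0, ?_⟩ ⟨k, i, hk, rfl⟩
  rintro r ⟨k, i, -, rfl⟩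
  exact h.weight_nonneg k i

/-- The weighted squared residual at step `k`. -/
noncomputable def weightedResidual (T : Fin m → E → E) (w : ℕ → Fin m → ℝ) (x : ℕ → E) (k : ℕ) :
    ℝ := ∑ i, w k i * ‖x k - T i (x k)‖ ^ 2

theorem weightedResidual_nonneg (h : IsQuasiCyclic T w x) (k : ℕ) :
    0 ≤ weightedResidual T w x k :=
  Finset.sum_nonneg fun i _ => mul_nonneg (h.weight_nonneg k i) (sq_nonneg _)

theorem norm_step_sq_le (h : IsQuasiCyclic T w x) (k : ℕ) :
    ‖x (k + 1) - x k‖ ^ 2 ≤ weightedResidual T w x k := by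
  have e : x (k + 1) - x k = ∑ i, w k i • (T i (x k) - x k) := by
    simp only [smul_sub, Finset.sum_sub_distrib, ← Finset.sum_smul, h.weight_sum, one_smul, h.step]
  rw [e]
  refine (norm_sum_smul_sq_le (h.weight_nonneg k) (h.weight_sum k) _).trans_eq ?_
  exact Finset.sum_congr rfl fun i _ => by rw [norm_sub_rev]

theorem norm_succ_sub_sq_le (h : IsQuasiCyclic T w x) (hα : α ∈ Ioo (0 : ℝ) 1)
    (hT : ∀ i, IsAveraged α (T i)) {z : E} (hz : z ∈ commonFix T) (k : ℕ) :
    ‖x (k + 1) - z‖ ^ 2 ≤ ‖x k - z‖ ^ 2 - (1 - α) / α * weightedResidual T w x k := by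
  have e : x (k + 1) - z = ∑ i, w k i • (T i (x k) - z) := by
    simp only [smul_sub, Finset.sum_sub_distrib, ← Finset.sum_smul, h.weight_sum, one_smul, h.step]
  rw [e]
  refine (norm_sum_smul_sq_le (h.weight_nonneg k) (h.weight_sum k) _).trans ?_
  calc ∑ i, w k i * ‖T i (x k) - z‖ ^ 2
      ≤ ∑ i, w k i * (‖x k - z‖ ^ 2 - (1 - α) / α * ‖x k - T i (x k)‖ ^ 2) := by
        refine Finset.sum_le_sum fun i _ => mul_le_mul_of_nonneg_left ?_ (h.weight_nonneg k i)
        exact (hT i).norm_sub_sq_le hα (mem_iInter.1 hz i) _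
    _ = (∑ i, w k i) * ‖x k - z‖ ^ 2 - (1 - α) / α * weightedResidual T w x k := by
        rw [weightedResidual, Finset.mul_sum, Finset.sum_mul, ← Finset.sum_sub_distrib]
        exact Finset.sum_congr rfl fun i _ => by ring
    _ = _ := by rw [h.weight_sum, one_mul]

theorem norm_add_sub_sq_le (h : IsQuasiCyclic T w x) (hα : α ∈ Ioo (0 : ℝ) 1)
    (hT : ∀ i, IsAveraged α (T i)) {z : E} (hz : z ∈ commonFix T) (k n : ℕ) :
    ‖x (k + n) - z‖ ^ 2 ≤
      ‖x k - z‖ ^ 2 - (1 - α) / α * ∑ l ∈ Finset.range n, weightedResidual T w x (k + l) := by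
  induction n with
  | zero => simp
  | succ n ih =>
    have := h.norm_succ_sub_sq_le hα hT hz (k + n)
    rw [Finset.sum_range_succ, ← add_assoc]
    linarith

theorem antitone_norm_sub (h : IsQuasiCyclic T w x) (hα : α ∈ Ioo (0 : ℝ) 1)
    (hT : ∀ i, IsAveraged α (T i)) {z : E} (hz : z ∈ commonFix T) :
    Antitone fun k => ‖x k - z‖ := by
  refine antitone_nat_of_succ_le fun k => ?_
  have h1 := h.norm_succ_sub_sq_le hα hT hz k
  have h2 : 0 ≤ (1 - α) / α * weightedResidual T w x k :=
    mul_nonneg (div_nonneg (by linarith [hα.2]) hα.1.le) (h.weightedResidual_nonneg k)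
  exact (pow_le_pow_iff_left₀ (norm_nonneg _) (norm_nonneg _) two_ne_zero).1 (by linarith)

theorem isBounded_range (h : IsQuasiCyclic T w x) (hα : α ∈ Ioo (0 : ℝ) 1)
    (hT : ∀ i, IsAveraged α (T i)) {z : E} (hz : z ∈ commonFix T) :
    Bornology.IsBounded (range x) := by
  refine (Metric.isBounded_closedBall (x := z) (r := ‖x 0 - z‖)).subset ?_
  rintro _ ⟨k, rfl⟩
  rw [Metric.mem_closedBall, dist_eq_norm]
  exact h.antitone_norm_sub hα hT hz (Nat.zero_le k)

theorem norm_add_sub_self_sq_le (h : IsQuasiCyclic T w x) (k n : ℕ) :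
    ‖x (k + n) - x k‖ ^ 2 ≤ n * ∑ l ∈ Finset.range n, weightedResidual T w x (k + l) := by
  have e : x (k + n) - x k = ∑ l ∈ Finset.range n, (x (k + l + 1) - x (k + l)) :=
    (Finset.sum_range_sub (fun l => x (k + l)) n).symm
  calc ‖x (k + n) - x k‖ ^ 2 ≤ (∑ l ∈ Finset.range n, ‖x (k + l + 1) - x (k + l)‖) ^ 2 := by
        rw [e]; gcongr; exact norm_sum_le _ _
    _ ≤ n * ∑ l ∈ Finset.range n, ‖x (k + l + 1) - x (k + l)‖ ^ 2 := by
        simpa using sq_sum_le_card_mul_sum_sq (s := Finset.range n)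
          (f := fun l => ‖x (k + l + 1) - x (k + l)‖)
    _ ≤ _ := by
        gcongr with l _
        exact h.norm_step_sq_le _

theorem residual_sq_le (h : IsQuasiCyclic T w x) (hL : ∀ i, LipschitzWith 1 (T i)) {s : ℕ}
    (hcyc : ∀ k i, ∃ j < s, 0 < w (k + j) i) (k : ℕ) (i : Fin m) :
    ‖x k - T i (x k)‖ ^ 2 ≤ 2 * (1 + 4 * minWeight w * s) / minWeight w *
      ∑ l ∈ Finset.range s, weightedResidual T w x (k + l) := by
  obtain ⟨j, hjs, hj⟩ := hcyc k i
  have hν := h.minWeight_pos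
  set S := ∑ l ∈ Finset.range s, weightedResidual T w x (k + l) with hS
  have hsum : weightedResidual T w x (k + j) ≤ S :=
    Finset.single_le_sum (f := fun l => weightedResidual T w x (k + l))
      (fun l _ => h.weightedResidual_nonneg _) (Finset.mem_range.2 hjs)
  have hS0 : 0 ≤ S := (h.weightedResidual_nonneg _).trans hsum
  have hsub : ∑ l ∈ Finset.range j, weightedResidual T w x (k + l) ≤ S :=
    Finset.sum_le_sum_of_subset_of_nonneg (Finset.range_subset_range.2 hjs.le)
      fun l _ _ => h.weightedResidual_nonneg _
  have h1 : ‖x (k + j) - x k‖ ^ 2 ≤ s * S := by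
    refine (h.norm_add_sub_self_sq_le k j).trans ?_
    have : (j : ℝ) ≤ s := by exact_mod_cast hjs.le
    have := Finset.sum_nonneg fun l (_ : l ∈ Finset.range j) => h.weightedResidual_nonneg (k + l)
    gcongr
  have h2 : ‖x (k + j) - T i (x (k + j))‖ ^ 2 ≤ S / minWeight w := by
    rw [le_div_iff₀ hν]
    calc ‖x (k + j) - T i (x (k + j))‖ ^ 2 * minWeight w
        ≤ w (k + j) i * ‖x (k + j) - T i (x (k + j))‖ ^ 2 := by
          rw [mul_comm]; gcongr; exact h.minWeight_le hj
      _ ≤ weightedResidual T w x (k + j) :=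
          Finset.single_le_sum (f := fun i => w (k + j) i * ‖x (k + j) - T i (x (k + j))‖ ^ 2)
            (fun i _ => mul_nonneg (h.weight_nonneg _ i) (sq_nonneg _)) (Finset.mem_univ i)
      _ ≤ S := hsum
  -- T_i is active at step k + j; moving back to x^k costs the displacement twice, once for the
  -- point and once for its image. With (2p + q)² ≤ 8p² + 2q², p² ≤ sS and q² ≤ S/ν, the constant is
  -- 8s + 2/ν = 2(1 + 4νs)/ν.
  have h3 : ‖x k - T i (x k)‖ ≤ 2 * ‖x (k + j) - x k‖ + ‖x (k + j) - T i (x (k + j))‖ := by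
    have hl := (hL i).dist_le_mul (x (k + j)) (x k)
    rw [NNReal.coe_one, one_mul, dist_eq_norm, dist_eq_norm] at hl
    have e : x k - T i (x k) = -(x (k + j) - x k) + (x (k + j) - T i (x (k + j))) +
      (T i (x (k + j)) - T i (x k)) := by abel
    rw [e]
    refine norm_add₃_le.trans ?_
    rw [norm_neg]
    linarith
  have h4 : ‖x k - T i (x k)‖ ^ 2 ≤
      8 * ‖x (k + j) - x k‖ ^ 2 + 2 * ‖x (k + j) - T i (x (k + j))‖ ^ 2 := by
    have := norm_nonneg (x k - T i (x k))
    have := pow_le_pow_left₀ this h3 2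
    nlinarith [sq_nonneg (2 * ‖x (k + j) - x k‖ - ‖x (k + j) - T i (x (k + j))‖)]
  have e : 2 * (1 + 4 * minWeight w * s) / minWeight w * S =
      8 * (s * S) + 2 * (S / minWeight w) := by
    field_simp
    ring
  rw [e]
  linarith

theorem residual_sq_le_infDist (h : IsQuasiCyclic T w x) (hα : α ∈ Ioo (0 : ℝ) 1)
    (hT : ∀ i, IsAveraged α (T i)) (hF : (commonFix T).Nonempty) {s : ℕ}
    (hcyc : ∀ k i, ∃ j < s, 0 < w (k + j) i) (k : ℕ) (i : Fin m) :
    ‖x k - T i (x k)‖ ^ 2 ≤ 2 * α * (1 + 4 * minWeight w * s) / (minWeight w * (1 - α)) *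
      (Metric.infDist (x k) (commonFix T) ^ 2 - Metric.infDist (x (k + s)) (commonFix T) ^ 2) := by
  have h1 := h.residual_sq_le (fun i => (hT i).lipschitzWith hα) hcyc k i
  have h2 := infDist_sq_le_of_forall hF fun z hz => h.norm_add_sub_sq_le hα hT hz k s
  have hν := h.minWeight_pos
  have hα0 := hα.1
  have hα1 : 0 < 1 - α := by linarith [hα.2]
  refine h1.trans ?_
  set S := ∑ l ∈ Finset.range s, weightedResidual T w x (k + l) with hS
  have h3 : S ≤ α / (1 - α) * (Metric.infDist (x k) (commonFix T) ^ 2 -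
      Metric.infDist (x (k + s)) (commonFix T) ^ 2) := by
    have : (1 - α) / α * S ≤ Metric.infDist (x k) (commonFix T) ^ 2 -
      Metric.infDist (x (k + s)) (commonFix T) ^ 2 := by linarith
    calc S = α / (1 - α) * ((1 - α) / α * S) := by field_simp
      _ ≤ _ := by gcongr
  calc _ ≤ 2 * (1 + 4 * minWeight w * s) / minWeight w * (α / (1 - α) *
        (Metric.infDist (x k) (commonFix T) ^ 2 -
          Metric.infDist (x (k + s)) (commonFix T) ^ 2)) := by gcongr
    _ = _ := by field_simp

theorem infDist_antitone (h : IsQuasiCyclic T w x) (hα : α ∈ Ioo (0 : ℝ) 1)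
    (hT : ∀ i, IsAveraged α (T i)) (hF : (commonFix T).Nonempty) :
    Antitone fun k => Metric.infDist (x k) (commonFix T) := fun j k hjk =>
  (Metric.le_infDist hF).2 fun {z} hz => (Metric.infDist_le_dist_of_mem hz).trans (by
    rw [dist_eq_norm, dist_eq_norm]
    exact h.antitone_norm_sub hα hT hz hjk)

theorem tendsto_residual (h : IsQuasiCyclic T w x) (hα : α ∈ Ioo (0 : ℝ) 1)
    (hT : ∀ i, IsAveraged α (T i)) (hF : (commonFix T).Nonempty) {s : ℕ}
    (hcyc : ∀ k i, ∃ j < s, 0 < w (k + j) i) (i : Fin m) :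
    Tendsto (fun k => ‖x k - T i (x k)‖) atTop (𝓝 0) := by
  have hanti : Antitone fun k => Metric.infDist (x k) (commonFix T) ^ 2 := fun j k hjk =>
    pow_le_pow_left₀ Metric.infDist_nonneg (h.infDist_antitone hα hT hF hjk) 2
  have hlim := tendsto_atTop_ciInf hanti ⟨0, by rintro _ ⟨k, rfl⟩; positivity⟩
  have h1 := (hlim.sub (hlim.comp (tendsto_add_atTop_nat s))).const_mul
    (2 * α * (1 + 4 * minWeight w * s) / (minWeight w * (1 - α)))
  rw [sub_self, mul_zero] at h1
  have h2 : Tendsto (fun k => ‖x k - T i (x k)‖ ^ 2) atTop (𝓝 0) :=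
    squeeze_zero (fun _ => sq_nonneg _) (fun k => h.residual_sq_le_infDist hα hT hF hcyc k i) h1
  have h3 := h2.sqrt
  simpa [Real.sqrt_sq (norm_nonneg _)] using h3

/-- A cluster point exists by boundedness and lies in F because the residuals vanish; the distance
to it is monotone, so the whole sequence converges to it. -/
theorem exists_tendsto [ProperSpace E] (h : IsQuasiCyclic T w x) (hα : α ∈ Ioo (0 : ℝ) 1)
    (hT : ∀ i, IsAveraged α (T i)) (hF : (commonFix T).Nonempty) {s : ℕ}
    (hcyc : ∀ k i, ∃ j < s, 0 < w (k + j) i) :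
    ∃ xlim ∈ commonFix T, Tendsto x atTop (𝓝 xlim) := by
  obtain ⟨z, hz⟩ := hF
  obtain ⟨y, -, f, hf, hfy⟩ := tendsto_subseq_of_bounded (h.isBounded_range hα hT hz)
    (fun k => mem_range_self k)
  have hy : y ∈ commonFix T := mem_iInter.2 fun i => by
    have h1 := (h.tendsto_residual hα hT ⟨z, hz⟩ hcyc i).comp hf.tendsto_atTop
    have h2 : Tendsto (fun k => ‖x (f k) - T i (x (f k))‖) atTop (𝓝 ‖y - T i y‖) :=
      (hfy.sub ((((hT i).lipschitzWith hα).continuous.tendsto y).comp hfy)).norm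
    exact (sub_eq_zero.1 (norm_eq_zero.1 (tendsto_nhds_unique h2 h1))).symm
  refine ⟨y, hy, ?_⟩
  rw [tendsto_iff_norm_sub_tendsto_zero] at hfy ⊢
  have hanti := h.antitone_norm_sub hα hT hy
  have hlim := tendsto_atTop_ciInf hanti ⟨0, by rintro _ ⟨k, rfl⟩; positivity⟩
  rwa [tendsto_nhds_unique (hlim.comp hf.tendsto_atTop) hfy] at hlim

theorem eq_of_mem (h : IsQuasiCyclic T w x) (hα : α ∈ Ioo (0 : ℝ) 1)
    (hT : ∀ i, IsAveraged α (T i)) {K : ℕ} (hK : x K ∈ commonFix T) {k : ℕ} (hk : K ≤ k) :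
    x k = x K := by
  have h1 := h.antitone_norm_sub hα hT hK hk
  simp only [sub_self, norm_zero] at h1
  exact sub_eq_zero.1 (norm_le_zero_iff.1 h1)

/-- An iterate in F is never left again, so it would be the limit, reached in finitely many steps.
-/
theorem infDist_pos_of_not_eventually_eq (h : IsQuasiCyclic T w x) (hα : α ∈ Ioo (0 : ℝ) 1)
    (hT : ∀ i, IsAveraged α (T i)) {xlim : E} (hx : xlim ∈ commonFix T)
    (hlim : Tendsto x atTop (𝓝 xlim)) (hne : ¬ ∃ K, ∀ k ≥ K, x k = xlim) (k : ℕ) :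
    0 < Metric.infDist (x k) (commonFix T) := by
  refine Metric.infDist_nonneg.lt_of_ne' fun h0 => hne ⟨k, fun j hj => ?_⟩
  have hk : x k ∈ commonFix T :=
    ((isClosed_commonFix fun i => (hT i).lipschitzWith hα).mem_iff_infDist_zero ⟨xlim, hx⟩).2 h0
  have hxk : x k = xlim := tendsto_nhds_unique (tendsto_const_nhds.congr' (by
    filter_upwards [eventually_ge_atTop k] with l hl
    exact (h.eq_of_mem hα hT hk hl).symm)) hlim
  rw [h.eq_of_mem hα hT hk hj, hxk]

/-- One sweep of the algorithm, in terms of the rate function. -/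
theorem infDist_sq_le_phiHat (h : IsQuasiCyclic T w x) (hα : α ∈ Ioo (0 : ℝ) 1)
    (hT : ∀ i, IsAveraged α (T i)) (hF : (commonFix T).Nonempty) {s : ℕ}
    (hcyc : ∀ k i, ∃ j < s, 0 < w (k + j) i) {B : Set E} (hB : range x ⊆ B) {ρ : ℝ} {ψ : ℝ → ℝ}
    (hψ : IsRegularityFunction T B ρ ψ) (k : ℕ) :
    Metric.infDist (x k) (commonFix T) ^ 2 ≤ phiHat α (minWeight w) s ψ
      (Metric.infDist (x k) (commonFix T) ^ 2 - Metric.infDist (x (k + s)) (commonFix T) ^ 2) := by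
  have h1 := hψ.error_bound (x k) (hB (mem_range_self k))
  rw [phiHat]
  refine pow_le_pow_left₀ Metric.infDist_nonneg (h1.trans (hψ.mono ?_ (Real.sqrt_nonneg _) ?_)) 2
  · exact Real.iSup_nonneg fun i => norm_nonneg _
  · exact Real.iSup_le (fun i => Real.le_sqrt_of_sq_le
      (h.residual_sq_le_infDist hα hT hF hcyc k i)) (Real.sqrt_nonneg _)

end IsQuasiCyclic

/-! ### Comparison of ratios -/

section Ratio

variable {ι : Type*} {l : Filter ι} {u v : ι → ℝ} {L : ℝ}

theorem tendsto_div_of_eventually (hv : ∀ᶠ t in l, 0 < v t)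
    (hlow : ∀ K < L, ∀ᶠ t in l, K * v t ≤ u t) (hup : ∀ K > L, ∀ᶠ t in l, u t ≤ K * v t) :
    Tendsto (fun t => u t / v t) l (𝓝 L) := by
  rw [tendsto_order]
  refine ⟨fun K hK => ?_, fun K hK => ?_⟩
  · obtain ⟨K', h1, h2⟩ := exists_between hK
    filter_upwards [hv, hlow K' h2] with t ht h
    exact h1.trans_le ((le_div_iff₀ ht).2 h)
  · obtain ⟨K', h1, h2⟩ := exists_between hK
    filter_upwards [hv, hup K' h1] with t ht h
    exact ((div_le_iff₀ ht).2 h).trans_lt h2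

theorem eventually_lt_mul_of_tendsto_div (hv : ∀ᶠ t in l, 0 < v t)
    (h : Tendsto (fun t => u t / v t) l (𝓝 L)) {K : ℝ} (hK : L < K) :
    ∀ᶠ t in l, u t < K * v t := by
  filter_upwards [hv, h.eventually (gt_mem_nhds hK)] with t ht h
  exact (div_lt_iff₀ ht).1 h

theorem eventually_mul_lt_of_tendsto_div (hv : ∀ᶠ t in l, 0 < v t)
    (h : Tendsto (fun t => u t / v t) l (𝓝 L)) {K : ℝ} (hK : K < L) :
    ∀ᶠ t in l, K * v t < u t := by
  filter_upwards [hv, h.eventually (lt_mem_nhds hK)] with t ht h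
  exact (lt_div_iff₀ ht).1 h

end Ratio

/-- Dyadic growth control implies a power bound. -/
theorem exists_le_mul_rpow_of_dyadic {F : ℝ → ℝ} {y₀ M s : ℝ} (hy₀ : 0 < y₀) (hM : 0 ≤ M)
    (hF : ∀ y ≥ y₀, F (2 * y) ≤ 2 ^ s * F y) (hb : ∀ y ∈ Icc y₀ (2 * y₀), F y ≤ M) :
    ∃ C, ∀ y ≥ y₀, F y ≤ C * y ^ s := by
  have hpow : ∀ n : ℕ, ∀ z ≥ y₀, F (2 ^ n * z) ≤ ((2 : ℝ) ^ n) ^ s * F z := by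
    intro n z hz
    induction n with
    | zero => simp
    | succ n ih =>
      have h1 : (1 : ℝ) ≤ 2 ^ n := one_le_pow₀ (by norm_num)
      have h2 := hF (2 ^ n * z) (by nlinarith)
      have h3 : (0 : ℝ) < 2 ^ s := by positivity
      calc F (2 ^ (n + 1) * z) = F (2 * (2 ^ n * z)) := by ring_nf
        _ ≤ 2 ^ s * (((2 : ℝ) ^ n) ^ s * F z) := h2.trans (by gcongr)
        _ = ((2 : ℝ) ^ (n + 1)) ^ s * F z := by
          rw [pow_succ, Real.mul_rpow (by positivity) (by norm_num)]; ring
  refine ⟨M * (y₀ ^ (-s) + (2 * y₀) ^ (-s)), fun y hy => ?_⟩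
  obtain ⟨n, hn1, hn2⟩ := exists_nat_pow_near ((one_le_div hy₀).2 hy) (one_lt_two (α := ℝ))
  have h2n : (0 : ℝ) < 2 ^ n := by positivity
  rw [le_div_iff₀ hy₀] at hn1
  rw [div_lt_iff₀ hy₀, pow_succ] at hn2
  set z := y / 2 ^ n with hz
  have hyz : y = 2 ^ n * z := by rw [hz]; field_simp
  have hz1 : y₀ ≤ z := by rw [hz, le_div_iff₀ h2n]; linarith
  have hz2 : z ≤ 2 * y₀ := by rw [hz, div_le_iff₀ h2n]; linarith
  have hz0 : 0 < z := hy₀.trans_le hz1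
  -- The sign of `s` is unknown, so the values at both endpoints of the dyadic block are added.
  have hzs : z ^ (-s) ≤ y₀ ^ (-s) + (2 * y₀) ^ (-s) := by
    have p1 : 0 < y₀ ^ (-s) := by positivity
    have p2 : 0 < (2 * y₀) ^ (-s) := by positivity
    rcases le_total 0 (-s) with h | h
    · linarith [Real.rpow_le_rpow hz0.le hz2 h]
    · linarith [Real.rpow_le_rpow_of_nonpos hy₀ hz1 h]
  calc F y ≤ ((2 : ℝ) ^ n) ^ s * F z := by rw [hyz]; exact hpow n z hz1
    _ ≤ ((2 : ℝ) ^ n) ^ s * M := by gcongr; exact hb z ⟨hz1, hz2⟩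
    _ = M * z ^ (-s) * y ^ s := by
      rw [hyz, Real.mul_rpow h2n.le hz0.le, Real.rpow_neg hz0.le]
      have : z ^ s ≠ 0 := by positivity
      field_simp
    _ ≤ _ := by
      have : 0 < y ^ s := Real.rpow_pos_of_pos (hy₀.trans_le hy) s
      gcongr

/-! ### The minus inverse -/

/-- Positive nondecreasing functions on `(0, ∞)` vanishing at `0+`. -/
structure IsGauge (φ : ℝ → ℝ) (a : ℝ) : Prop where
  bound_pos : 0 < a
  mono : MonotoneOn φ (Ioi 0)
  pos : ∀ t > 0, 0 < φ t
  lim : Tendsto φ (𝓝[>] 0) (𝓝 0)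

namespace IsGauge

variable {φ : ℝ → ℝ} {a δ : ℝ}

/-- φ may jump or be constant on intervals, so φ(φ⁻(y)) = y is unavailable. This implication,
`minusInv_le` and their contrapositives take its place. -/
theorem le_minusInv {u y : ℝ} (hu : u ∈ Ioc 0 a) (h : φ u < y) : u ≤ minusInv φ a y :=
  le_csSup ⟨a, fun _ hx => hx.1.2⟩ ⟨hu, h⟩

theorem minusInv_le (hφ : IsGauge φ a) {u y : ℝ} (hu : 0 < u) (h : y ≤ φ u) :
    minusInv φ a y ≤ u := by
  refine Real.sSup_le (fun x hx => ?_) hu.le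
  by_contra! hlt
  exact absurd (hφ.mono hu hx.1.1 hlt.le) (by linarith [hx.2])

theorem minusInv_le_bound (hφ : IsGauge φ a) (y : ℝ) : minusInv φ a y ≤ a :=
  Real.sSup_le (fun _ hx => hx.1.2) hφ.bound_pos.le

theorem minusInv_pos (hφ : IsGauge φ a) {y : ℝ} (hy : 0 < y) : 0 < minusInv φ a y := by
  obtain ⟨u, hu1, hu2⟩ := ((hφ.lim.eventually (gt_mem_nhds hy)).and
    (Ioc_mem_nhdsGT hφ.bound_pos)).exists
  exact hu2.1.trans_le (le_minusInv hu2 hu1)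

theorem minusInv_mono (hφ : IsGauge φ a) : MonotoneOn (minusInv φ a) (Ioi 0) := by
  intro y hy y' _ hyy'
  obtain ⟨u, hu1, hu2⟩ := ((hφ.lim.eventually (gt_mem_nhds hy)).and
    (Ioc_mem_nhdsGT hφ.bound_pos)).exists
  exact csSup_le_csSup ⟨a, fun _ hx => hx.1.2⟩ ⟨u, hu2, hu1⟩
    fun x hx => ⟨hx.1, hx.2.trans_le hyy'⟩

theorem lt_of_lt_minusInv (hφ : IsGauge φ a) {u y : ℝ} (hu : 0 < u) (h : u < minusInv φ a y) :
    φ u < y := by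
  by_contra! hle
  exact absurd (hφ.minusInv_le hu hle) (not_le.2 h)

theorem le_of_minusInv_lt {u y : ℝ} (hu : u ∈ Ioc 0 a) (h : minusInv φ a y < u) :
    y ≤ φ u := by
  by_contra! hlt
  exact absurd (le_minusInv hu hlt) (not_le.2 h)

theorem tendsto_minusInv (hφ : IsGauge φ a) : Tendsto (minusInv φ a) (𝓝[>] 0) (𝓝[>] 0) := by
  refine tendsto_nhdsWithin_iff.2 ⟨?_, ?_⟩
  · rw [tendsto_order]
    refine ⟨fun b hb => ?_, fun b hb => ?_⟩
    · filter_upwards [self_mem_nhdsWithin] with t ht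
      exact hb.trans (hφ.minusInv_pos ht)
    · filter_upwards [Ioo_mem_nhdsGT (hφ.pos (b / 2) (half_pos hb))] with t ht
      exact (hφ.minusInv_le (half_pos hb) ht.2.le).trans_lt (half_lt_self hb)
  · filter_upwards [self_mem_nhdsWithin] with t ht
    exact hφ.minusInv_pos ht

/-- The hypothesis is applied at s = (K₁/K₂) φ⁻(t), strictly below φ⁻(t), where φ < t is certain.
The gap between K₁ and K₂ pays for the missing continuity of φ. -/
theorem eventually_mul_minusInv_le (hφ : IsGauge φ a) {c K₁ K₂ : ℝ} (hK₁ : 0 < K₁)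
    (hK : K₁ < K₂) (hc : 0 < c) (h : ∀ᶠ s in 𝓝[>] 0, φ (K₂ * s) < c * φ s) :
    ∀ᶠ t in 𝓝[>] 0, K₁ * minusInv φ a t ≤ minusInv φ a (c * t) := by
  have hK₂ : 0 < K₂ := hK₁.trans hK
  have h1 := hφ.tendsto_minusInv.eventually
    (eventually_nhdsGT_zero_comp_mul h (div_pos hK₁ hK₂))
  have h2 := hφ.tendsto_minusInv.eventually
    (eventually_nhdsGT_zero_comp_mul (Ioc_mem_nhdsGT hφ.bound_pos) hK₁)
  filter_upwards [h1, h2, self_mem_nhdsWithin] with t ht1 ht2 ht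
  have hN := hφ.minusInv_pos ht
  refine le_minusInv ht2 ?_
  have e : K₂ * (K₁ / K₂ * minusInv φ a t) = K₁ * minusInv φ a t := by field_simp
  rw [e] at ht1
  have h3 : φ (K₁ / K₂ * minusInv φ a t) < t :=
    hφ.lt_of_lt_minusInv (mul_pos (div_pos hK₁ hK₂) hN)
      (mul_lt_of_lt_one_left hN ((div_lt_one hK₂).2 hK))
  exact ht1.trans (by gcongr)

theorem eventually_minusInv_le_mul (hφ : IsGauge φ a) {c K₁ K₂ : ℝ} (hK₂ : 0 < K₂)
    (hK : K₂ < K₁) (hc : 0 < c) (h : ∀ᶠ s in 𝓝[>] 0, c * φ s < φ (K₂ * s)) :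
    ∀ᶠ t in 𝓝[>] 0, minusInv φ a (c * t) ≤ K₁ * minusInv φ a t := by
  have hK₁ : 0 < K₁ := hK₂.trans hK
  have h1 := hφ.tendsto_minusInv.eventually
    (eventually_nhdsGT_zero_comp_mul h (div_pos hK₁ hK₂))
  have h2 := hφ.tendsto_minusInv.eventually
    (eventually_nhdsGT_zero_comp_mul (Ioc_mem_nhdsGT hφ.bound_pos) (div_pos hK₁ hK₂))
  filter_upwards [h1, h2, self_mem_nhdsWithin] with t ht1 ht2 ht
  have hN := hφ.minusInv_pos ht
  refine hφ.minusInv_le (mul_pos hK₁ hN) ?_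
  have e : K₂ * (K₁ / K₂ * minusInv φ a t) = K₁ * minusInv φ a t := by field_simp
  rw [e] at ht1
  have h3 : t ≤ φ (K₁ / K₂ * minusInv φ a t) :=
    le_of_minusInv_lt ht2 (lt_mul_of_one_lt_left hN ((one_lt_div hK₂).2 hK))
  refine le_trans ?_ ht1.le
  gcongr

/-- The minus inverse of a function of positive index. -/
theorem tendsto_minusInv_div (hφ : IsGauge φ a) {ρ : ℝ} (hρ : 0 < ρ)
    (h : ∀ c > 0, Tendsto (fun t => φ (c * t) / φ t) (𝓝[>] 0) (𝓝 (c ^ ρ))) {c : ℝ} (hc : 0 < c) :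
    Tendsto (fun t => minusInv φ a (c * t) / minusInv φ a t) (𝓝[>] 0) (𝓝 (c ^ (1 / ρ))) := by
  have hpos : ∀ᶠ t in 𝓝[>] (0 : ℝ), 0 < φ t := by
    filter_upwards [self_mem_nhdsWithin] with t ht using hφ.pos t ht
  have hNpos : ∀ᶠ t in 𝓝[>] (0 : ℝ), 0 < minusInv φ a t := by
    filter_upwards [self_mem_nhdsWithin] with t ht using hφ.minusInv_pos ht
  have hcc : (c ^ (1 / ρ)) ^ ρ = c := by
    rw [← Real.rpow_mul hc.le, one_div_mul_cancel hρ.ne', Real.rpow_one]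
  have hcpos : 0 < c ^ (1 / ρ) := by positivity
  refine tendsto_div_of_eventually hNpos (fun K hK => ?_) fun K hK => ?_
  · obtain ⟨K₁, h1, h2⟩ := exists_between (max_lt hK hcpos)
    obtain ⟨K₂, h3, h4⟩ := exists_between h2
    have hK₁ : 0 < K₁ := (le_max_right _ _).trans_lt h1
    have hlt : K₂ ^ ρ < c := by
      conv_rhs => rw [← hcc]
      exact Real.rpow_lt_rpow (hK₁.trans h3).le h4 hρ
    filter_upwards [hφ.eventually_mul_minusInv_le hK₁ h3 hc
      (eventually_lt_mul_of_tendsto_div hpos (h K₂ (hK₁.trans h3)) hlt), hNpos] with t ht hN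
    exact le_trans (by gcongr; exact (le_max_left _ _).trans h1.le) ht
  · obtain ⟨K₂, h1, h2⟩ := exists_between hK
    have hlt : c < K₂ ^ ρ := by
      conv_lhs => rw [← hcc]
      exact Real.rpow_lt_rpow hcpos.le h1 hρ
    exact hφ.eventually_minusInv_le_mul (hcpos.trans h1) h2 hc
      (eventually_mul_lt_of_tendsto_div hpos (h K₂ (hcpos.trans h1)) hlt)

/-- The minus inverse of a slowly varying function varies rapidly. -/
theorem eventually_minusInv_le_of_slow (hφ : IsGauge φ a)
    (h : ∀ c > 0, Tendsto (fun t => φ (c * t) / φ t) (𝓝[>] 0) (𝓝 1)) {c K : ℝ}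
    (hc : c ∈ Ioo (0 : ℝ) 1) (hK : 0 < K) :
    ∀ᶠ t in 𝓝[>] 0, minusInv φ a (c * t) ≤ K * minusInv φ a t := by
  have hpos : ∀ᶠ t in 𝓝[>] (0 : ℝ), 0 < φ t := by
    filter_upwards [self_mem_nhdsWithin] with t ht using hφ.pos t ht
  exact hφ.eventually_minusInv_le_mul (half_pos hK) (half_lt_self hK) hc.1
    (eventually_mul_lt_of_tendsto_div hpos (h _ (half_pos hK)) hc.2)

/-- If `φ⁻ (t / 2) ≤ φ⁻ t / 2` for small `t`, then `φ⁻` is bounded by a linear function. -/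
theorem exists_minusInv_le_mul_of_half (hφ : IsGauge φ a)
    (h : ∀ᶠ t in 𝓝[>] 0, minusInv φ a (1 / 2 * t) ≤ 1 / 2 * minusInv φ a t) :
    ∃ C > 0, ∀ᶠ t in 𝓝[>] 0, minusInv φ a t ≤ C * t := by
  obtain ⟨t₀, ht₀, h₀⟩ := exists_pos_forall_of_eventually h
  obtain ⟨C, hC⟩ := exists_le_mul_rpow_of_dyadic (F := fun y => minusInv φ a (1 / y)) (y₀ := 1 / t₀)
    (s := -1) (one_div_pos.2 ht₀) hφ.bound_pos.le (fun y hy => by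
      have hy0 : 0 < y := (one_div_pos.2 ht₀).trans_le hy
      have := h₀ (1 / y) (one_div_pos.2 hy0) ((one_div_le hy0 ht₀).2 hy)
      rw [Real.rpow_neg_one]
      convert this using 2
      · field_simp
      · norm_num) (fun y _ => hφ.minusInv_le_bound _)
  refine ⟨|C| + 1, by positivity, ?_⟩
  filter_upwards [Ioc_mem_nhdsGT ht₀] with t ht
  have h1 := hC (1 / t) (one_div_le_one_div_of_le ht.1 ht.2)
  rw [Real.rpow_neg_one] at h1
  simp only [one_div, inv_inv] at h1
  refine h1.trans ?_
  have := ht.1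
  gcongr
  linarith [le_abs_self C]

theorem eventually_minusInv_le_inv_mul (hφ : IsGauge φ a) {c : ℝ} (hc : 0 < c)
    (h : ∀ᶠ t in 𝓝[>] 0, c * t ≤ φ t) : ∀ᶠ t in 𝓝[>] 0, minusInv φ a t ≤ c⁻¹ * t := by
  filter_upwards [eventually_nhdsGT_zero_comp_mul h (inv_pos.2 hc), self_mem_nhdsWithin]
    with t ht ht0
  exact hφ.minusInv_le (mul_pos (inv_pos.2 hc) ht0) (by rwa [mul_inv_cancel_left₀ hc.ne'] at ht)

theorem eventually_mul_le_minusInv (hφ : IsGauge φ a) {c : ℝ} (hc : 0 < c)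
    (h : ∀ᶠ t in 𝓝[>] 0, φ t < c * t) : ∀ᶠ t in 𝓝[>] 0, c⁻¹ * t ≤ minusInv φ a t := by
  filter_upwards [eventually_nhdsGT_zero_comp_mul h (inv_pos.2 hc),
    eventually_nhdsGT_zero_comp_mul (Ioc_mem_nhdsGT hφ.bound_pos) (inv_pos.2 hc)] with t ht ht0
  exact le_minusInv ht0 (by rwa [mul_inv_cancel_left₀ hc.ne'] at ht)

/-! ### The rate function and its inverse -/

theorem antitoneOn_inv_minusInv (hφ : IsGauge φ a) :
    AntitoneOn (fun t => 1 / minusInv φ a t) (Ioi 0) := fun _ hs _ ht hst =>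
  one_div_le_one_div_of_le (hφ.minusInv_pos hs) (hφ.minusInv_mono hs ht hst)

theorem uIcc_subset_Ioi {u v : ℝ} (hu : 0 < u) (hv : 0 < v) : uIcc u v ⊆ Ioi 0 :=
  fun _ ht => (lt_min hu hv).trans_le ht.1

theorem intervalIntegrable (hφ : IsGauge φ a) {u v : ℝ} (hu : 0 < u) (hv : 0 < v) :
    IntervalIntegrable (fun t => 1 / minusInv φ a t) volume u v :=
  (hφ.antitoneOn_inv_minusInv.mono (uIcc_subset_Ioi hu hv)).intervalIntegrable

theorem ratePhi_sub (hφ : IsGauge φ a) (hδ : 0 < δ) {u v : ℝ} (hu : 0 < u) (hv : 0 < v) :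
    ratePhi φ a δ u - ratePhi φ a δ v = ∫ t in u..v, 1 / minusInv φ a t := by
  rw [ratePhi, ratePhi, intervalIntegral.integral_interval_sub_interval_comm'
    (hφ.intervalIntegrable hu hδ) (hφ.intervalIntegrable hv hδ) (hφ.intervalIntegrable hu hv),
    intervalIntegral.integral_same, zero_sub, ← intervalIntegral.integral_symm]

/-- The integrand is nonincreasing. This bound and its companion with the value at `u` give strict
monotonicity, local Lipschitz continuity, the gain per sweep and Karamata's relation. -/
theorem mul_le_ratePhi_sub (hφ : IsGauge φ a) (hδ : 0 < δ) {u v : ℝ} (hu : 0 < u) (huv : u ≤ v) :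
    (v - u) * (1 / minusInv φ a v) ≤ ratePhi φ a δ u - ratePhi φ a δ v := by
  have hv := hu.trans_le huv
  rw [hφ.ratePhi_sub hδ hu hv]
  calc (v - u) * (1 / minusInv φ a v) = ∫ _ in u..v, 1 / minusInv φ a v := by simp
    _ ≤ _ := intervalIntegral.integral_mono_on huv intervalIntegrable_const
      (hφ.intervalIntegrable hu hv)
      fun t ht => hφ.antitoneOn_inv_minusInv (hu.trans_le ht.1) hv ht.2

theorem ratePhi_sub_le_mul (hφ : IsGauge φ a) (hδ : 0 < δ) {u v : ℝ} (hu : 0 < u) (huv : u ≤ v) :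
    ratePhi φ a δ u - ratePhi φ a δ v ≤ (v - u) * (1 / minusInv φ a u) := by
  have hv := hu.trans_le huv
  rw [hφ.ratePhi_sub hδ hu hv]
  calc _ ≤ ∫ _ in u..v, 1 / minusInv φ a u :=
      intervalIntegral.integral_mono_on huv (hφ.intervalIntegrable hu hv)
        intervalIntegrable_const fun t ht => hφ.antitoneOn_inv_minusInv hu (hu.trans_le ht.1) ht.1
    _ = _ := by simp

theorem strictAntiOn_ratePhi (hφ : IsGauge φ a) (hδ : 0 < δ) :
    StrictAntiOn (ratePhi φ a δ) (Ioi 0) := by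
  intro u hu v hv huv
  have h1 := hφ.mul_le_ratePhi_sub hδ hu huv.le
  have h2 : 0 < (v - u) * (1 / minusInv φ a v) :=
    mul_pos (sub_pos.2 huv) (one_div_pos.2 (hφ.minusInv_pos hv))
  linarith

theorem continuousOn_ratePhi (hφ : IsGauge φ a) (hδ : 0 < δ) :
    ContinuousOn (ratePhi φ a δ) (Ioi 0) := by
  intro u hu
  have hu : 0 < u := hu
  refine ContinuousAt.continuousWithinAt ?_
  have hK : 0 ≤ 1 / minusInv φ a (u / 2) := (one_div_pos.2 (hφ.minusInv_pos (half_pos hu))).le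
  have hbd : ∀ v w, u / 2 < v → v ≤ w →
      |ratePhi φ a δ v - ratePhi φ a δ w| ≤ 1 / minusInv φ a (u / 2) * |v - w| := by
    intro v w hv hvw
    have hv0 : 0 < v := (half_pos hu).trans hv
    rw [abs_of_nonneg (sub_nonneg.2
      ((hφ.strictAntiOn_ratePhi hδ).antitoneOn hv0 (hv0.trans_le hvw) hvw)), abs_sub_comm,
      abs_of_nonneg (sub_nonneg.2 hvw), mul_comm]
    refine (hφ.ratePhi_sub_le_mul hδ hv0 hvw).trans ?_
    exact mul_le_mul_of_nonneg_left (hφ.antitoneOn_inv_minusInv (half_pos hu) hv0 hv.le)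
      (sub_nonneg.2 hvw)
  refine continuousAt_of_locally_lipschitz (half_pos hu) (1 / minusInv φ a (u / 2)) fun v hv => ?_
  rw [Real.dist_eq, abs_lt] at hv
  rw [Real.dist_eq, Real.dist_eq]
  rcases le_total v u with h | h
  · exact hbd v u (by linarith) h
  · rw [abs_sub_comm, abs_sub_comm v]
    exact hbd u v (by linarith) h

theorem log_le_ratePhi_sub (hφ : IsGauge φ a) (hδ : 0 < δ) {C u v : ℝ} (hu : 0 < u) (huv : u ≤ v)
    (h : ∀ t ∈ Icc u v, minusInv φ a t ≤ C * t) :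
    C⁻¹ * Real.log (v / u) ≤ ratePhi φ a δ u - ratePhi φ a δ v := by
  have hv := hu.trans_le huv
  have h0 : (0 : ℝ) ∉ uIcc u v := fun h => lt_irrefl (0 : ℝ) (uIcc_subset_Ioi hu hv h)
  rw [hφ.ratePhi_sub hδ hu hv, ← integral_inv_of_pos hu hv,
    ← intervalIntegral.integral_const_mul]
  refine intervalIntegral.integral_mono_on huv
    ((intervalIntegral.intervalIntegrable_inv (fun x hx h' => h0 (h' ▸ hx))
      continuousOn_id).const_mul _)
    (hφ.intervalIntegrable hu hv) fun t ht => ?_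
  have ht0 : 0 < t := hu.trans_le ht.1
  rw [← mul_inv, ← one_div]
  exact one_div_le_one_div_of_le (hφ.minusInv_pos ht0) (h t ht)

theorem ratePhi_sub_le_log (hφ : IsGauge φ a) (hδ : 0 < δ) {C u v : ℝ} (hu : 0 < u) (huv : u ≤ v)
    (h : ∀ t ∈ Icc u v, C * t ≤ minusInv φ a t) (hC : 0 < C) :
    ratePhi φ a δ u - ratePhi φ a δ v ≤ C⁻¹ * Real.log (v / u) := by
  have hv := hu.trans_le huv
  have h0 : (0 : ℝ) ∉ uIcc u v := fun h => lt_irrefl (0 : ℝ) (uIcc_subset_Ioi hu hv h)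
  rw [hφ.ratePhi_sub hδ hu hv, ← integral_inv_of_pos hu hv,
    ← intervalIntegral.integral_const_mul]
  refine intervalIntegral.integral_mono_on huv (hφ.intervalIntegrable hu hv)
    ((intervalIntegral.intervalIntegrable_inv (fun x hx h' => h0 (h' ▸ hx))
      continuousOn_id).const_mul _) fun t ht => ?_
  have ht0 : 0 < t := hu.trans_le ht.1
  rw [← mul_inv, ← one_div]
  exact one_div_le_one_div_of_le (mul_pos hC ht0) (h t ht)

/-- The integrand is at least 1/(Ct) near 0, so the integral diverges like a logarithm. -/
theorem tendsto_ratePhi_of_minusInv_le (hφ : IsGauge φ a) (hδ : 0 < δ)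
    (h : ∃ C > 0, ∀ᶠ t in 𝓝[>] 0, minusInv φ a t ≤ C * t) :
    Tendsto (ratePhi φ a δ) (𝓝[>] 0) atTop := by
  obtain ⟨C, hC, h⟩ := h
  obtain ⟨v, hv, h₀⟩ := exists_pos_forall_of_eventually h
  have hlog : Tendsto (fun u => ratePhi φ a δ v + C⁻¹ * (Real.log v + -Real.log u)) (𝓝[>] 0)
      atTop :=
    tendsto_atTop_add_const_left _ _ ((tendsto_atTop_add_const_left _ _
      (tendsto_neg_atBot_atTop.comp Real.tendsto_log_nhdsGT_zero)).const_mul_atTop (inv_pos.2 hC))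
  refine tendsto_atTop_mono' _ ?_ hlog
  filter_upwards [Ioc_mem_nhdsGT hv] with u hu
  have := hφ.log_le_ratePhi_sub hδ hu.1 hu.2 (fun t ht => h₀ t (hu.1.trans_le ht.1) ht.2)
  rw [Real.log_div hv.ne' hu.1.ne'] at this
  linarith

theorem ratePhiInv_mem {y : ℝ} (hy : y ∈ ratePhi φ a δ '' Ioi 0) :
    0 < ratePhiInv φ a δ y ∧ ratePhi φ a δ (ratePhiInv φ a δ y) = y :=
  ⟨Function.invFunOn_mem hy, Function.invFunOn_eq hy⟩

theorem ratePhiInv_le_iff (hφ : IsGauge φ a) (hδ : 0 < δ) {y u : ℝ}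
    (hy : y ∈ ratePhi φ a δ '' Ioi 0) (hu : 0 < u) :
    ratePhiInv φ a δ y ≤ u ↔ ratePhi φ a δ u ≤ y := by
  obtain ⟨h1, h2⟩ := ratePhiInv_mem hy
  conv_rhs => rw [← h2]
  exact ((hφ.strictAntiOn_ratePhi hδ).le_iff_ge hu h1).symm

theorem le_ratePhiInv_iff (hφ : IsGauge φ a) (hδ : 0 < δ) {y u : ℝ}
    (hy : y ∈ ratePhi φ a δ '' Ioi 0) (hu : 0 < u) :
    u ≤ ratePhiInv φ a δ y ↔ y ≤ ratePhi φ a δ u := by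
  obtain ⟨h1, h2⟩ := ratePhiInv_mem hy
  conv_rhs => rw [← h2]
  exact ((hφ.strictAntiOn_ratePhi hδ).le_iff_ge h1 hu).symm

theorem mem_image_of_mem_Icc (hφ : IsGauge φ a) (hδ : 0 < δ) {u v y : ℝ} (hu : 0 < u) (hv : 0 < v)
    (h1 : ratePhi φ a δ v ≤ y) (h2 : y ≤ ratePhi φ a δ u) : y ∈ ratePhi φ a δ '' Ioi 0 :=
  isPreconnected_Ioi.intermediate_value hv hu (hφ.continuousOn_ratePhi hδ) ⟨h1, h2⟩

end IsGauge

theorem isLittleO_rpow_of_lt {r r' : ℝ} (h : r < r') :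
    (fun y : ℝ => y ^ r) =o[atTop] fun y : ℝ => y ^ r' := by
  refine (isLittleO_iff_tendsto' ?_).2 ?_
  · filter_upwards [eventually_gt_atTop 0] with y hy h0
    exact absurd h0 (Real.rpow_pos_of_pos hy r').ne'
  · refine (tendsto_rpow_neg_atTop (sub_pos.2 h)).congr' ?_
    filter_upwards [eventually_gt_atTop 0] with y hy
    rw [← Real.rpow_sub hy, neg_sub]

namespace IsGauge

variable {φ : ℝ → ℝ} {a δ : ℝ}

/-! ### Scaling of the rate function -/

theorem ratePhi_mul_sub_le (hφ : IsGauge φ a) (hδ : 0 < δ) {c M u v : ℝ} (hc : 0 < c)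
    (hu : 0 < u) (huv : u ≤ v)
    (h : ∀ t ∈ Icc u v, 1 / minusInv φ a (c * t) ≤ M * (1 / minusInv φ a t)) :
    ratePhi φ a δ (c * u) - ratePhi φ a δ (c * v) ≤
      c * M * (ratePhi φ a δ u - ratePhi φ a δ v) := by
  have hv := hu.trans_le huv
  rw [hφ.ratePhi_sub hδ hu hv, hφ.ratePhi_sub hδ (mul_pos hc hu) (mul_pos hc hv),
    ← intervalIntegral.smul_integral_comp_mul_left, smul_eq_mul, mul_assoc,
    ← intervalIntegral.integral_const_mul M]
  refine mul_le_mul_of_nonneg_left (intervalIntegral.integral_mono_on huv ?_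
    ((hφ.intervalIntegrable hu hv).const_mul _) h) hc.le
  have := (hφ.intervalIntegrable (mul_pos hc hu) (mul_pos hc hv)).comp_mul_left (c := c)
  simpa [mul_div_cancel_left₀ _ hc.ne'] using this

theorem le_ratePhi_mul_sub (hφ : IsGauge φ a) (hδ : 0 < δ) {c M u v : ℝ} (hc : 0 < c)
    (hu : 0 < u) (huv : u ≤ v)
    (h : ∀ t ∈ Icc u v, M * (1 / minusInv φ a t) ≤ 1 / minusInv φ a (c * t)) :
    c * M * (ratePhi φ a δ u - ratePhi φ a δ v) ≤
      ratePhi φ a δ (c * u) - ratePhi φ a δ (c * v) := by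
  have hv := hu.trans_le huv
  rw [hφ.ratePhi_sub hδ hu hv, hφ.ratePhi_sub hδ (mul_pos hc hu) (mul_pos hc hv),
    ← intervalIntegral.smul_integral_comp_mul_left, smul_eq_mul, mul_assoc,
    ← intervalIntegral.integral_const_mul]
  refine mul_le_mul_of_nonneg_left (intervalIntegral.integral_mono_on huv
    ((hφ.intervalIntegrable hu hv).const_mul _) ?_ h) hc.le
  have := (hφ.intervalIntegrable (mul_pos hc hu) (mul_pos hc hv)).comp_mul_left (c := c)
  simpa [mul_div_cancel_left₀ _ hc.ne'] using this

/-- The substitution t ↦ ct in the integral from u to v leaves an additive constant depending on v;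
the strict gap cM < M' and Φ → ∞ absorb it. -/
theorem eventually_ratePhi_mul_le (hφ : IsGauge φ a) (hδ : 0 < δ)
    (hΦ : Tendsto (ratePhi φ a δ) (𝓝[>] 0) atTop) {c M M' : ℝ} (hc : 0 < c)
    (h : ∀ᶠ t in 𝓝[>] 0, 1 / minusInv φ a (c * t) ≤ M * (1 / minusInv φ a t)) (hM : c * M < M') :
    ∀ᶠ u in 𝓝[>] 0, ratePhi φ a δ (c * u) ≤ M' * ratePhi φ a δ u := by
  obtain ⟨v, hv, h₀⟩ := exists_pos_forall_of_eventually h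
  filter_upwards [Ioc_mem_nhdsGT hv, hΦ.eventually_ge_atTop
    ((ratePhi φ a δ (c * v) - c * M * ratePhi φ a δ v) / (M' - c * M))] with u hu hge
  have h1 := hφ.ratePhi_mul_sub_le hδ hc hu.1 hu.2 fun t ht => h₀ t (hu.1.trans_le ht.1) ht.2
  rw [div_le_iff₀ (sub_pos.2 hM)] at hge
  linarith

theorem eventually_le_ratePhi_mul (hφ : IsGauge φ a) (hδ : 0 < δ)
    (hΦ : Tendsto (ratePhi φ a δ) (𝓝[>] 0) atTop) {c M M' : ℝ} (hc : 0 < c)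
    (h : ∀ᶠ t in 𝓝[>] 0, M * (1 / minusInv φ a t) ≤ 1 / minusInv φ a (c * t)) (hM : M' < c * M) :
    ∀ᶠ u in 𝓝[>] 0, M' * ratePhi φ a δ u ≤ ratePhi φ a δ (c * u) := by
  obtain ⟨v, hv, h₀⟩ := exists_pos_forall_of_eventually h
  filter_upwards [Ioc_mem_nhdsGT hv, hΦ.eventually_ge_atTop
    ((c * M * ratePhi φ a δ v - ratePhi φ a δ (c * v)) / (c * M - M'))] with u hu hge
  have h1 := hφ.le_ratePhi_mul_sub hδ hc hu.1 hu.2 fun t ht => h₀ t (hu.1.trans_le ht.1) ht.2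
  rw [div_le_iff₀ (sub_pos.2 hM)] at hge
  linarith

/-- If `φ⁻` has index `σ` at `0`, then the rate function has index `1 - σ`. -/
theorem tendsto_ratePhi_div (hφ : IsGauge φ a) (hδ : 0 < δ)
    (hΦ : Tendsto (ratePhi φ a δ) (𝓝[>] 0) atTop) {σ c : ℝ} (hc : 0 < c)
    (h : Tendsto (fun t => minusInv φ a (c * t) / minusInv φ a t) (𝓝[>] 0) (𝓝 (c ^ σ))) :
    Tendsto (fun u => ratePhi φ a δ (c * u) / ratePhi φ a δ u) (𝓝[>] 0) (𝓝 (c ^ (1 - σ))) := by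
  have h' : Tendsto (fun t => 1 / minusInv φ a (c * t) / (1 / minusInv φ a t)) (𝓝[>] 0)
      (𝓝 (c ^ σ)⁻¹) := by
    refine (h.inv₀ (by positivity)).congr fun t => ?_
    rw [inv_div, div_div_div_cancel_left' _ _ one_ne_zero]
  have hpos : ∀ᶠ t in 𝓝[>] (0 : ℝ), 0 < 1 / minusInv φ a t := by
    filter_upwards [self_mem_nhdsWithin] with t ht using one_div_pos.2 (hφ.minusInv_pos ht)
  have e : c ^ (1 - σ) = c * (c ^ σ)⁻¹ := by
    rw [Real.rpow_sub hc, Real.rpow_one, div_eq_mul_inv]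
  rw [e]
  refine tendsto_div_of_eventually (hΦ.eventually_gt_atTop 0) (fun K hK => ?_) fun K hK => ?_
  · rw [mul_comm, ← div_lt_iff₀ hc] at hK
    obtain ⟨M, h1, h2⟩ := exists_between hK
    rw [div_lt_iff₀ hc, mul_comm] at h1
    exact hφ.eventually_le_ratePhi_mul hδ hΦ hc
      ((eventually_mul_lt_of_tendsto_div hpos h' h2).mono fun t ht => ht.le) h1
  · rw [gt_iff_lt, mul_comm, ← lt_div_iff₀ hc] at hK
    obtain ⟨M, h1, h2⟩ := exists_between hK
    rw [lt_div_iff₀ hc, mul_comm] at h2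
    exact hφ.eventually_ratePhi_mul_le hδ hΦ hc
      ((eventually_lt_mul_of_tendsto_div hpos h' h1).mono fun t ht => ht.le) h2

/-- If `φ⁻` varies rapidly at `0`, then so does the rate function. -/
theorem eventually_le_ratePhi_mul_of_rapid (hφ : IsGauge φ a) (hδ : 0 < δ)
    (hΦ : Tendsto (ratePhi φ a δ) (𝓝[>] 0) atTop) {c : ℝ} (hc : 0 < c)
    (h : ∀ K > 0, ∀ᶠ t in 𝓝[>] 0, minusInv φ a (c * t) ≤ K * minusInv φ a t) {M : ℝ} (hM : 0 < M) :
    ∀ᶠ u in 𝓝[>] 0, M * ratePhi φ a δ u ≤ ratePhi φ a δ (c * u) := by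
  refine hφ.eventually_le_ratePhi_mul (M := 2 * M / c) hδ hΦ hc ?_
    (by rw [mul_div_cancel₀ _ hc.ne']; linarith)
  filter_upwards [h (2 * M / c)⁻¹ (by positivity), self_mem_nhdsWithin] with t ht ht0
  have h1 := hφ.minusInv_pos ht0
  have h2 := hφ.minusInv_pos (mul_pos hc ht0)
  rw [mul_one_div, div_le_div_iff₀ h1 h2]
  rw [inv_mul_eq_div, le_div_iff₀ (by positivity)] at ht
  linarith

/-! ### The inverse of an unbounded rate function -/

theorem eventually_mem_image (hφ : IsGauge φ a) (hδ : 0 < δ)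
    (hΦ : Tendsto (ratePhi φ a δ) (𝓝[>] 0) atTop) :
    ∀ᶠ y in atTop, y ∈ ratePhi φ a δ '' Ioi 0 := by
  filter_upwards [eventually_ge_atTop (ratePhi φ a δ δ)] with y hy
  obtain ⟨u, hu1, hu2⟩ := ((hΦ.eventually_ge_atTop y).and self_mem_nhdsWithin).exists
  exact hφ.mem_image_of_mem_Icc hδ hu2 hδ hy hu1

theorem eventually_ratePhiInv_pos (hφ : IsGauge φ a) (hδ : 0 < δ)
    (hΦ : Tendsto (ratePhi φ a δ) (𝓝[>] 0) atTop) : ∀ᶠ y in atTop, 0 < ratePhiInv φ a δ y :=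
  (hφ.eventually_mem_image hδ hΦ).mono fun _ hy => (ratePhiInv_mem hy).1

theorem tendsto_ratePhiInv (hφ : IsGauge φ a) (hδ : 0 < δ)
    (hΦ : Tendsto (ratePhi φ a δ) (𝓝[>] 0) atTop) :
    Tendsto (ratePhiInv φ a δ) atTop (𝓝[>] 0) := by
  refine tendsto_nhdsWithin_iff.2 ⟨?_, hφ.eventually_ratePhiInv_pos hδ hΦ⟩
  rw [tendsto_order]
  refine ⟨fun b hb => (hφ.eventually_ratePhiInv_pos hδ hΦ).mono fun y hy => hb.trans hy,
    fun b hb => ?_⟩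
  filter_upwards [hφ.eventually_mem_image hδ hΦ, eventually_ge_atTop (ratePhi φ a δ (b / 2))]
    with y hy hge
  exact ((hφ.ratePhiInv_le_iff hδ hy (half_pos hb)).2 hge).trans_lt (half_lt_self hb)

theorem exists_antitoneOn_ratePhiInv (hφ : IsGauge φ a) (hδ : 0 < δ)
    (hΦ : Tendsto (ratePhi φ a δ) (𝓝[>] 0) atTop) :
    ∃ y₀ > 0, AntitoneOn (ratePhiInv φ a δ) (Ici y₀) ∧ ∀ y ∈ Ici y₀, 0 < ratePhiInv φ a δ y := by
  obtain ⟨y₁, h₁⟩ := eventually_atTop.1 (hφ.eventually_mem_image hδ hΦ)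
  have hmem : ∀ y ∈ Ici (max y₁ 1), y ∈ ratePhi φ a δ '' Ioi 0 := fun y hy =>
    h₁ y ((le_max_left _ _).trans hy)
  refine ⟨max y₁ 1, lt_max_of_lt_right one_pos, fun y hy z hz hyz => ?_,
    fun y hy => (ratePhiInv_mem (hmem y hy)).1⟩
  obtain ⟨h1, h2⟩ := ratePhiInv_mem (hmem y hy)
  exact (hφ.ratePhiInv_le_iff hδ (hmem z hz) h1).2 (h2.trans_le hyz)

theorem eventually_ratePhiInv_mul_le (hφ : IsGauge φ a) (hδ : 0 < δ)
    (hΦ : Tendsto (ratePhi φ a δ) (𝓝[>] 0) atTop) {c K : ℝ} (hc : 0 < c) (hK : 0 < K)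
    (h : ∀ᶠ u in 𝓝[>] 0, ratePhi φ a δ (K * u) ≤ c * ratePhi φ a δ u) :
    ∀ᶠ y in atTop, ratePhiInv φ a δ (c * y) ≤ K * ratePhiInv φ a δ y := by
  have hmem := hφ.eventually_mem_image hδ hΦ
  filter_upwards [hmem, (tendsto_id.const_mul_atTop hc).eventually hmem,
    (hφ.tendsto_ratePhiInv hδ hΦ).eventually h] with y hy hcy hle
  obtain ⟨h1, h2⟩ := ratePhiInv_mem hy
  rw [h2] at hle
  exact (hφ.ratePhiInv_le_iff hδ hcy (mul_pos hK h1)).2 hle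

theorem eventually_le_ratePhiInv_mul (hφ : IsGauge φ a) (hδ : 0 < δ)
    (hΦ : Tendsto (ratePhi φ a δ) (𝓝[>] 0) atTop) {c K : ℝ} (hc : 0 < c) (hK : 0 < K)
    (h : ∀ᶠ u in 𝓝[>] 0, c * ratePhi φ a δ u ≤ ratePhi φ a δ (K * u)) :
    ∀ᶠ y in atTop, K * ratePhiInv φ a δ y ≤ ratePhiInv φ a δ (c * y) := by
  have hmem := hφ.eventually_mem_image hδ hΦ
  filter_upwards [hmem, (tendsto_id.const_mul_atTop hc).eventually hmem,
    (hφ.tendsto_ratePhiInv hδ hΦ).eventually h] with y hy hcy hle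
  obtain ⟨h1, h2⟩ := ratePhiInv_mem hy
  rw [h2] at hle
  exact (hφ.le_ratePhiInv_iff hδ hcy (mul_pos hK h1)).2 hle

/-- The hypotheses are inequalities rather than limits of ratios, so that σ = 0, where Φ varies
rapidly, is covered too. -/
theorem regVaryTop_ratePhiInv (hφ : IsGauge φ a) (hδ : 0 < δ)
    (hΦ : Tendsto (ratePhi φ a δ) (𝓝[>] 0) atTop) {σ : ℝ}
    (hlow : ∀ c > 0, ∀ K > 0, K < c ^ σ →
      ∀ᶠ u in 𝓝[>] 0, c * ratePhi φ a δ u ≤ ratePhi φ a δ (K * u))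
    (hup : ∀ c > 0, ∀ K > c ^ σ,
      ∀ᶠ u in 𝓝[>] 0, ratePhi φ a δ (K * u) ≤ c * ratePhi φ a δ u) :
    RegVaryTop σ (ratePhiInv φ a δ) := by
  obtain ⟨y₀, hy₀, hanti, hpos⟩ := hφ.exists_antitoneOn_ratePhiInv hδ hΦ
  refine ⟨⟨y₀, hy₀, aemeasurable_restrict_of_antitoneOn measurableSet_Ici hanti, hpos⟩,
    fun c hc => ?_⟩
  have hcs : 0 < c ^ σ := by positivity
  have hev := hφ.eventually_ratePhiInv_pos hδ hΦ
  refine tendsto_div_of_eventually hev (fun K hK => ?_) fun K hK =>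
    hφ.eventually_ratePhiInv_mul_le hδ hΦ hc (hcs.trans hK) (hup c hc K hK)
  obtain ⟨K', h1, h2⟩ := exists_between (max_lt hK hcs)
  have hK' : 0 < K' := (le_max_right _ _).trans_lt h1
  filter_upwards [hev, hφ.eventually_le_ratePhiInv_mul hδ hΦ hc hK' (hlow c hc K' hK' h2)]
    with y hy hle
  exact le_trans (by gcongr; exact (le_max_left _ _).trans h1.le) hle

theorem ratePhiInv_isLittleO (hφ : IsGauge φ a) (hδ : 0 < δ)
    (hΦ : Tendsto (ratePhi φ a δ) (𝓝[>] 0) atTop) {r r' : ℝ} (hr : r < r')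
    (h : ∀ᶠ y in atTop, ratePhiInv φ a δ (2 * y) ≤ 2 ^ (-r') * ratePhiInv φ a δ y) :
    ratePhiInv φ a δ =o[atTop] fun y : ℝ => y ^ (-r) := by
  obtain ⟨y₀, hy₀, hanti, hpos⟩ := hφ.exists_antitoneOn_ratePhiInv hδ hΦ
  obtain ⟨y₁, h₁⟩ := eventually_atTop.1 h
  have hm : y₀ ≤ max y₀ y₁ := le_max_left _ _
  obtain ⟨C, hC⟩ := exists_le_mul_rpow_of_dyadic (hy₀.trans_le hm) (hpos _ hm).le
    (fun y hy => h₁ y ((le_max_right _ _).trans hy))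
    fun y hy => hanti hm (hm.trans hy.1) hy.1
  refine IsBigO.trans_isLittleO ?_ (isLittleO_rpow_of_lt (neg_lt_neg hr))
  refine IsBigO.of_bound C ?_
  filter_upwards [eventually_ge_atTop (max y₀ y₁)] with y hy
  rw [Real.norm_of_nonneg (hpos y (hm.trans hy)).le,
    Real.norm_of_nonneg (Real.rpow_nonneg (hy₀.le.trans (hm.trans hy)) _)]
  exact hC y hy

theorem isLittleO_ratePhiInv (hφ : IsGauge φ a) (hδ : 0 < δ)
    (hΦ : Tendsto (ratePhi φ a δ) (𝓝[>] 0) atTop) {r r' : ℝ} (hr : r' < r)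
    (h : ∀ᶠ y in atTop, 2 ^ (-r') * ratePhiInv φ a δ y ≤ ratePhiInv φ a δ (2 * y)) :
    (fun y : ℝ => y ^ (-r)) =o[atTop] ratePhiInv φ a δ := by
  obtain ⟨y₀, hy₀, hanti, hpos⟩ := hφ.exists_antitoneOn_ratePhiInv hδ hΦ
  obtain ⟨y₁, h₁⟩ := eventually_atTop.1 h
  have hm : y₀ ≤ max y₀ y₁ := le_max_left _ _
  have hm0 : 0 < max y₀ y₁ := hy₀.trans_le hm
  obtain ⟨C, hC⟩ := exists_le_mul_rpow_of_dyadic (F := fun y => 1 / ratePhiInv φ a δ y) (s := r')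
    hm0 (one_div_pos.2 (hpos (2 * max y₀ y₁) (by simp only [mem_Ici]; linarith))).le
    (fun y hy => by
      have h2 := h₁ y ((le_max_right _ _).trans hy)
      have p1 := hpos y (hm.trans hy)
      have p2 := hpos (2 * y) (by simp only [mem_Ici]; linarith)
      rw [Real.rpow_neg (by norm_num)] at h2
      rw [mul_one_div, div_le_div_iff₀ p2 p1, one_mul]
      rwa [inv_mul_le_iff₀ (by positivity)] at h2)
    fun y hy => one_div_le_one_div_of_le (hpos _ (by simp only [mem_Ici]; linarith))
      (hanti (hm.trans hy.1) (by simp only [mem_Ici]; linarith) hy.2)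
  refine IsLittleO.trans_isBigO (isLittleO_rpow_of_lt (neg_lt_neg hr)) ?_
  refine IsBigO.of_bound C ?_
  filter_upwards [eventually_ge_atTop (max y₀ y₁)] with y hy
  have hy0 : 0 < y := hm0.trans_le hy
  have h3 := hC y hy
  have p1 := hpos y (hm.trans hy)
  rw [Real.norm_of_nonneg p1.le, Real.norm_of_nonneg (Real.rpow_nonneg hy0.le _),
    Real.rpow_neg hy0.le, inv_le_iff_one_le_mul₀ (by positivity)]
  rw [div_le_iff₀ p1] at h3
  linarith

/-! ### Comparison with arrow inverses -/

/-- The point z = c/Φ⁻¹(y) satisfies γ(z) > Φ(c/z) = y, so it competes in the infimum. -/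
theorem eventually_arrowInv_le (hφ : IsGauge φ a) (hδ : 0 < δ)
    (hΦ : Tendsto (ratePhi φ a δ) (𝓝[>] 0) atTop) {γ : ℝ → ℝ} {c : ℝ} (hc : 0 < c)
    (h : ∀ᶠ z in atTop, ratePhi φ a δ (c / z) < γ z) :
    ∀ᶠ y in atTop, arrowInv γ (1 / δ) y ≤ c / ratePhiInv φ a δ y := by
  have hlim : Tendsto (fun y => c / ratePhiInv φ a δ y) atTop atTop := by
    simpa only [div_eq_mul_inv, Function.comp_apply] using
      (tendsto_inv_nhdsGT_zero.comp (hφ.tendsto_ratePhiInv hδ hΦ)).const_mul_atTop hc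
  filter_upwards [hlim.eventually h, hlim.eventually_ge_atTop (1 / δ),
    hφ.eventually_mem_image hδ hΦ] with y h1 h2 h3
  rw [div_div_cancel₀ hc.ne', (ratePhiInv_mem h3).2] at h1
  exact csInf_le ⟨1 / δ, fun _ hx => hx.1⟩ ⟨h2, h1⟩

theorem eventually_le_arrowInv (hφ : IsGauge φ a) (hδ : 0 < δ)
    (hΦ : Tendsto (ratePhi φ a δ) (𝓝[>] 0) atTop) {γ : ℝ → ℝ} {c : ℝ} (hc : 0 < c)
    (hb : ∀ Z, ∃ M, ∀ z ∈ Icc (1 / δ) Z, γ z ≤ M) (hne : ∀ y, ∃ z ∈ Ici (1 / δ), y < γ z)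
    (h : ∀ᶠ z in atTop, γ z ≤ ratePhi φ a δ (c / z)) :
    ∀ᶠ y in atTop, c / ratePhiInv φ a δ y ≤ arrowInv γ (1 / δ) y := by
  obtain ⟨Z, hZ⟩ := eventually_atTop.1 h
  obtain ⟨M, hM⟩ := hb Z
  filter_upwards [eventually_ge_atTop M, hφ.eventually_mem_image hδ hΦ] with y hy hmem
  obtain ⟨h1, h2⟩ := ratePhiInv_mem hmem
  -- Nonemptiness matters, since `sInf ∅ = 0`. Competitors z ≤ Z are excluded because y ≥ M bounds γ
  -- there; for the others y < γ(z) ≤ Φ(c/z), and Φ⁻¹ decreases.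
  refine le_csInf (hne y) fun z hz => ?_
  have hz0 : 0 < z := (one_div_pos.2 hδ).trans_le hz.1
  rcases le_total z Z with hzZ | hzZ
  · have := hM z ⟨hz.1, hzZ⟩
    have := hz.2
    linarith
  · have h3 : y ≤ ratePhi φ a δ (c / z) := hz.2.le.trans (hZ z hzZ)
    have h4 := (hφ.le_ratePhiInv_iff hδ hmem (div_pos hc hz0)).2 h3
    rw [div_le_iff₀ hz0] at h4
    rw [div_le_iff₀ h1]
    linarith

theorem exists_lt_of_ratePhi_lt (hΦ : Tendsto (ratePhi φ a δ) (𝓝[>] 0) atTop) {γ : ℝ → ℝ}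
    {c : ℝ} (hc : 0 < c) (h : ∀ᶠ z in atTop, ratePhi φ a δ (c / z) < γ z) (y : ℝ) :
    ∃ z ∈ Ici (1 / δ), y < γ z := by
  have hlim : Tendsto (fun z : ℝ => c / z) atTop (𝓝[>] 0) := by
    simpa [div_eq_mul_inv, Function.comp_def] using
      (tendsto_const_mul_nhdsGT_zero hc).comp tendsto_inv_atTop_nhdsGT_zero
  obtain ⟨z, h1, h2, h3⟩ := (h.and ((hlim.eventually (hΦ.eventually_ge_atTop y)).and
    (eventually_ge_atTop (1 / δ)))).exists
  exact ⟨z, h3, h2.trans_lt h1⟩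

theorem ratePhiInv_isEquivalent (hφ : IsGauge φ a) (hδ : 0 < δ)
    (hΦ : Tendsto (ratePhi φ a δ) (𝓝[>] 0) atTop) {γ : ℝ → ℝ}
    (hb : ∀ Z, ∃ M, ∀ z ∈ Icc (1 / δ) Z, γ z ≤ M)
    (hlow : ∀ c > 1, ∀ᶠ z in atTop, ratePhi φ a δ (c / z) < γ z)
    (hup : ∀ c ∈ Ioo (0 : ℝ) 1, ∀ᶠ z in atTop, γ z ≤ ratePhi φ a δ (c / z)) :
    ratePhiInv φ a δ ~[atTop] fun y => 1 / arrowInv γ (1 / δ) y := by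
  have hne := exists_lt_of_ratePhi_lt hΦ two_pos (hlow 2 one_lt_two)
  have hev := hφ.eventually_ratePhiInv_pos hδ hΦ
  have hlow' : ∀ c ∈ Ioo (0 : ℝ) 1, ∀ᶠ y in atTop,
      c * (1 / ratePhiInv φ a δ y) ≤ arrowInv γ (1 / δ) y := fun c hc => by
    simpa only [mul_one_div] using hφ.eventually_le_arrowInv hδ hΦ hc.1 hb hne (hup c hc)
  have hlim : Tendsto (fun y => arrowInv γ (1 / δ) y / (1 / ratePhiInv φ a δ y)) atTop (𝓝 1) := by
    refine tendsto_div_of_eventually (hev.mono fun y hy => one_div_pos.2 hy) (fun K hK => ?_)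
      fun K hK => ?_
    · obtain ⟨K', h1, h2⟩ := exists_between (max_lt hK one_pos)
      filter_upwards [hev, hlow' K' ⟨(le_max_right _ _).trans_lt h1, h2⟩] with y hy hle
      exact le_trans (mul_le_mul_of_nonneg_right ((le_max_left _ _).trans h1.le)
        (one_div_pos.2 hy).le) hle
    · simpa only [mul_one_div] using
        hφ.eventually_arrowInv_le hδ hΦ (one_pos.trans hK) (hlow K hK)
  refine isEquivalent_of_tendsto_one (hlim.congr fun y => ?_)
  simp only [Pi.div_apply, div_eq_mul_inv, one_mul, inv_inv]
  ring

theorem exists_rpow_mul_le (hφ : IsGauge φ a) (hδ : 0 < δ) (β Z : ℝ) :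
    ∃ M, ∀ z ∈ Icc (1 / δ) Z, z ^ β * (1 / (z * minusInv φ a (1 / z))) ≤ M := by
  have hδ' := one_div_pos.2 hδ
  refine ⟨((1 / δ) ^ β + |Z| ^ β) * (1 / (1 / δ * minusInv φ a (1 / Z))), fun z hz => ?_⟩
  have hz0 : 0 < z := hδ'.trans_le hz.1
  have hZ : 0 < Z := hz0.trans_le hz.2
  have h1 := hφ.minusInv_pos (one_div_pos.2 hZ)
  have h2 : minusInv φ a (1 / Z) ≤ minusInv φ a (1 / z) :=
    hφ.minusInv_mono (one_div_pos.2 hZ) (one_div_pos.2 hz0) (one_div_le_one_div_of_le hz0 hz.2)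
  have h3 : z ^ β ≤ (1 / δ) ^ β + |Z| ^ β := by
    have p1 : 0 < (1 / δ) ^ β := by positivity
    have p2 : 0 < Z ^ β := by positivity
    rw [abs_of_pos hZ]
    rcases le_total 0 β with h | h
    · linarith [Real.rpow_le_rpow hz0.le hz.2 h]
    · linarith [Real.rpow_le_rpow_of_nonpos hδ' hz.1 h]
  have h4 : 1 / δ * minusInv φ a (1 / Z) ≤ z * minusInv φ a (1 / z) := by
    have := hz.1
    gcongr
  have h5 : 0 < 1 / (z * minusInv φ a (1 / z)) := 
    one_div_pos.2 (mul_pos hz0 (h1.trans_le h2))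
  exact mul_le_mul h3 (one_div_le_one_div_of_le (by positivity) h4) h5.le
    (by positivity)

end IsGauge

theorem tendsto_const_div_nhdsGT_zero {c : ℝ} (hc : 0 < c) :
    Tendsto (fun z : ℝ => c / z) atTop (𝓝[>] 0) := by
  simpa [div_eq_mul_inv, Function.comp_def] using
    (tendsto_const_mul_nhdsGT_zero hc).comp tendsto_inv_atTop_nhdsGT_zero

/-- The derivative of c ↦ c^(-p) at 1 is -p. This selects the dilation used in Karamata's relation.
-/
theorem exists_rpow_neg_lt_of_lt {p K : ℝ} (hK : p < K) :
    ∃ c ∈ Ioo (0 : ℝ) 1, c ^ (-p) < 1 + K * (1 - c) := by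
  have hd : HasDerivAt (fun x : ℝ => x ^ (-p)) (-p) 1 := by
    simpa using Real.hasDerivAt_rpow_const (x := 1) (p := -p) (Or.inl one_ne_zero)
  have h1 := (hasDerivAt_iff_tendsto_slope.1 hd).mono_left
    (nhdsWithin_mono _ fun x (hx : x ∈ Iio (1 : ℝ)) => (ne_of_lt hx))
  obtain ⟨c, hc1, hc2⟩ := ((h1.eventually (lt_mem_nhds (neg_lt_neg hK))).and
    (Ioo_mem_nhdsLT zero_lt_one)).exists
  refine ⟨c, hc2, ?_⟩
  rw [slope_def_field, Real.one_rpow, lt_div_iff_of_neg (by linarith [hc2.2])] at hc1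
  linarith

theorem exists_rpow_neg_lt_of_gt {p K : ℝ} (hK : K < p) :
    ∃ c > 1, c ^ (-p) < 1 - K * (c - 1) := by
  have hd : HasDerivAt (fun x : ℝ => x ^ (-p)) (-p) 1 := by
    simpa using Real.hasDerivAt_rpow_const (x := 1) (p := -p) (Or.inl one_ne_zero)
  have h1 := (hasDerivAt_iff_tendsto_slope.1 hd).mono_left
    (nhdsWithin_mono _ fun x (hx : x ∈ Ioi (1 : ℝ)) => (ne_of_gt hx))
  obtain ⟨c, hc1, hc2⟩ := ((h1.eventually (gt_mem_nhds (neg_lt_neg hK))).and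
    self_mem_nhdsWithin).exists
  have hc2 : 1 < c := hc2
  refine ⟨c, hc2, ?_⟩
  rw [slope_def_field, Real.one_rpow, div_lt_iff₀ (by linarith)] at hc1
  linarith

theorem arrowInv_mul {f : ℝ → ℝ} {p : ℝ} (hp : 0 < p) (a y : ℝ) :
    arrowInv f a (p * y) = arrowInv (fun z => f z / p) a y := by
  simp only [arrowInv, lt_div_iff₀ hp, mul_comm p]

namespace IsGauge

variable {φ : ℝ → ℝ} {a δ ρ : ℝ}

theorem exists_ratePhi_pos (hΦ : Tendsto (ratePhi φ a δ) (𝓝[>] 0) atTop) :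
    ∃ t₀ > 0, ∀ t ∈ Ioc 0 t₀, 0 < ratePhi φ a δ t := by
  obtain ⟨t₀, h0, h⟩ := exists_pos_forall_of_eventually (hΦ.eventually_gt_atTop 0)
  exact ⟨t₀, h0, fun t ht => h t ht.1 ht.2⟩

theorem aemeasurable_ratePhi (hφ : IsGauge φ a) (hδ : 0 < δ) (t₀ : ℝ) :
    AEMeasurable (ratePhi φ a δ) (volume.restrict (Ioc 0 t₀)) :=
  aemeasurable_restrict_of_antitoneOn measurableSet_Ioc
    ((hφ.strictAntiOn_ratePhi hδ).antitoneOn.mono Ioc_subset_Ioi_self)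

theorem regVaryZero_ratePhi (hφ : IsGauge φ a) (hδ : 0 < δ)
    (hΦ : Tendsto (ratePhi φ a δ) (𝓝[>] 0) atTop) {σ : ℝ} (h : ∀ c > 0,
      Tendsto (fun u => ratePhi φ a δ (c * u) / ratePhi φ a δ u) (𝓝[>] 0) (𝓝 (c ^ σ))) :
    RegVaryZero σ (ratePhi φ a δ) := by
  obtain ⟨t₀, ht₀, hpos⟩ := exists_ratePhi_pos hΦ
  exact ⟨⟨t₀, ht₀, hφ.aemeasurable_ratePhi hδ t₀, hpos⟩, h⟩

/-! ### Karamata's theorem for the rate function -/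

/-- (1 - c)u/φ⁻(u) ≤ Φ(cu) - Φ(u), which is asymptotically (c^(-p) - 1)Φ(u), and (c^(-p) - 1)/(1 -
c) → p as c → 1. The case p = 0 is needed for index 1. -/
theorem eventually_mul_inv_minusInv_le (hφ : IsGauge φ a) (hδ : 0 < δ)
    (hΦ : Tendsto (ratePhi φ a δ) (𝓝[>] 0) atTop) {p : ℝ} (h : ∀ c > 0,
      Tendsto (fun u => ratePhi φ a δ (c * u) / ratePhi φ a δ u) (𝓝[>] 0) (𝓝 (c ^ (-p))))
    {K : ℝ} (hK : p < K) :
    ∀ᶠ u in 𝓝[>] 0, u * (1 / minusInv φ a u) ≤ K * ratePhi φ a δ u := by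
  obtain ⟨c, hc, hcK⟩ := exists_rpow_neg_lt_of_lt hK
  filter_upwards [eventually_lt_mul_of_tendsto_div (hΦ.eventually_gt_atTop 0) (h c hc.1) hcK,
    self_mem_nhdsWithin] with u hu hu0
  have hu0 : 0 < u := hu0
  have h1 := hφ.mul_le_ratePhi_sub hδ (mul_pos hc.1 hu0) (v := u) (by nlinarith [hc.2])
  refine le_of_mul_le_mul_left ?_ (sub_pos.2 hc.2)
  linarith

theorem eventually_le_mul_inv_minusInv (hφ : IsGauge φ a) (hδ : 0 < δ)
    (hΦ : Tendsto (ratePhi φ a δ) (𝓝[>] 0) atTop) {p : ℝ} (h : ∀ c > 0,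
      Tendsto (fun u => ratePhi φ a δ (c * u) / ratePhi φ a δ u) (𝓝[>] 0) (𝓝 (c ^ (-p))))
    {K : ℝ} (hK : K < p) :
    ∀ᶠ u in 𝓝[>] 0, K * ratePhi φ a δ u ≤ u * (1 / minusInv φ a u) := by
  obtain ⟨c, hc, hcK⟩ := exists_rpow_neg_lt_of_gt hK
  filter_upwards [eventually_lt_mul_of_tendsto_div (hΦ.eventually_gt_atTop 0)
    (h c (one_pos.trans hc)) hcK, self_mem_nhdsWithin] with u hu hu0
  have hu0 : 0 < u := hu0
  have h1 := hφ.ratePhi_sub_le_mul hδ hu0 (v := c * u) (by nlinarith)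
  refine le_of_mul_le_mul_left ?_ (sub_pos.2 hc)
  linarith

/-! ### Index in `(0, 1)` -/

section Intermediate

variable (hφ : IsGauge φ a) (hδ : 0 < δ) (hρ : ρ ∈ Ioo (0 : ℝ) 1)
  (h : ∀ c > 0, Tendsto (fun t => φ (c * t) / φ t) (𝓝[>] 0) (𝓝 (c ^ ρ)))
include hφ hδ hρ h

theorem tendsto_ratePhi_of_mem_Ioo : Tendsto (ratePhi φ a δ) (𝓝[>] 0) atTop := by
  refine hφ.tendsto_ratePhi_of_minusInv_le hδ (hφ.exists_minusInv_le_mul_of_half ?_)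
  have hpos : ∀ᶠ t in 𝓝[>] (0 : ℝ), 0 < minusInv φ a t := by
    filter_upwards [self_mem_nhdsWithin] with t ht using hφ.minusInv_pos ht
  refine (eventually_lt_mul_of_tendsto_div hpos
    (hφ.tendsto_minusInv_div hρ.1 h (c := 1 / 2) (by norm_num)) ?_).mono fun t ht => ht.le
  conv_rhs => rw [← Real.rpow_one (1 / 2)]
  exact Real.rpow_lt_rpow_of_exponent_gt (by norm_num) (by norm_num) ((one_lt_div hρ.1).2 hρ.2)

theorem tendsto_ratePhi_div_of_mem_Ioo (c : ℝ) (hc : c > 0) :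
    Tendsto (fun u => ratePhi φ a δ (c * u) / ratePhi φ a δ u) (𝓝[>] 0)
      (𝓝 (c ^ (1 - 1 / ρ))) :=
  hφ.tendsto_ratePhi_div hδ (hφ.tendsto_ratePhi_of_mem_Ioo hδ hρ h) hc
    (hφ.tendsto_minusInv_div hρ.1 h hc)

theorem regVaryTop_ratePhiInv_of_mem_Ioo : RegVaryTop (ρ / (ρ - 1)) (ratePhiInv φ a δ) := by
  have hρ0 := hρ.1
  have hρ1 : ρ - 1 < 0 := by linarith [hρ.2]
  have hΦ := hφ.tendsto_ratePhi_of_mem_Ioo hδ hρ h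
  have hp : 1 - 1 / ρ < 0 := by linarith [(one_lt_div hρ.1).2 hρ.2]
  have hcc : ∀ c : ℝ, c > 0 → (c ^ (ρ / (ρ - 1))) ^ (1 - 1 / ρ) = c := fun c hc => by
    rw [← Real.rpow_mul (le_of_lt hc)]
    have : ρ / (ρ - 1) * (1 - 1 / ρ) = 1 := by
      have := hρ0.ne'
      have := hρ1.ne
      field_simp
    rw [this, Real.rpow_one]
  have hpos := hΦ.eventually_gt_atTop 0
  refine hφ.regVaryTop_ratePhiInv hδ hΦ (fun c hc K hK0 hK => ?_) fun c hc K hK => ?_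
  · refine (eventually_mul_lt_of_tendsto_div hpos
      (hφ.tendsto_ratePhi_div_of_mem_Ioo hδ hρ h K hK0) ?_).mono fun t ht => ht.le
    conv_lhs => rw [← hcc c hc]
    exact Real.rpow_lt_rpow_of_neg hK0 hK hp
  · have hc' : 0 < c ^ (ρ / (ρ - 1)) := Real.rpow_pos_of_pos hc _
    refine (eventually_lt_mul_of_tendsto_div hpos
      (hφ.tendsto_ratePhi_div_of_mem_Ioo hδ hρ h K (hc'.trans hK)) ?_).mono fun t ht => ht.le
    conv_rhs => rw [← hcc c hc]
    exact Real.rpow_lt_rpow_of_neg hc' hK hp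

theorem ratePhiInv_isLittleO_of_mem_Ioo {r : ℝ} (hr : r < -(ρ / (ρ - 1))) :
    ratePhiInv φ a δ =o[atTop] fun y : ℝ => y ^ (-r) := by
  have hΦ := hφ.tendsto_ratePhi_of_mem_Ioo hδ hρ h
  obtain ⟨r', h1, h2⟩ := exists_between hr
  refine hφ.ratePhiInv_isLittleO hδ hΦ h1 ?_
  exact (eventually_lt_mul_of_tendsto_div (hφ.eventually_ratePhiInv_pos hδ hΦ)
    ((hφ.regVaryTop_ratePhiInv_of_mem_Ioo hδ hρ h).2 2 two_pos)
    (Real.rpow_lt_rpow_of_exponent_lt one_lt_two (by linarith))).mono fun t ht => ht.le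

/-- Karamata's relation at u = 1/z gives g(z) ~ p Φ(1/z), while Φ(c/z) ~ c^(-p) Φ(1/z) separates g/p
from Φ(c/z) for every c ≠ 1. -/
theorem ratePhiInv_isEquivalent_of_mem_Ioo :
    ratePhiInv φ a δ ~[atTop] fun y =>
      1 / arrowInv (fun y => 1 / (y * minusInv φ a (1 / y))) (1 / δ) ((1 / ρ - 1) * y) := by
  have hΦ := hφ.tendsto_ratePhi_of_mem_Ioo hδ hρ h
  have hp : 0 < 1 / ρ - 1 := by linarith [(one_lt_div hρ.1).2 hρ.2]
  set p := 1 / ρ - 1 with hpdef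
  have hrat : ∀ c > 0, Tendsto (fun u => ratePhi φ a δ (c * u) / ratePhi φ a δ u) (𝓝[>] 0)
      (𝓝 (c ^ (-p))) := fun c hc => by
    rw [hpdef, neg_sub]
    exact hφ.tendsto_ratePhi_div_of_mem_Ioo hδ hρ h c hc
  have hpos := hΦ.eventually_gt_atTop 0
  have hz := tendsto_const_div_nhdsGT_zero one_pos
  simp only [arrowInv_mul hp]
  refine hφ.ratePhiInv_isEquivalent hδ hΦ (fun Z => ?_) (fun c hc => ?_) fun c hc => ?_
  · obtain ⟨M, hM⟩ := hφ.exists_rpow_mul_le hδ 0 Z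
    refine ⟨M / p, fun z hz => ?_⟩
    have := hM z hz
    rw [Real.rpow_zero, one_mul] at this
    gcongr
  · have hlt : c ^ (-p) < 1 := Real.rpow_lt_one_of_one_lt_of_neg hc (neg_lt_zero.2 hp)
    obtain ⟨K, h1, h2⟩ := exists_between hlt
    filter_upwards [hz.eventually (eventually_lt_mul_of_tendsto_div hpos
      (hrat c (one_pos.trans hc)) h1), hz.eventually (hφ.eventually_le_mul_inv_minusInv hδ hΦ hrat
      (K := K * p) (by nlinarith)), eventually_gt_atTop 0] with z hz1 hz2 hz0
    rw [lt_div_iff₀ hp]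
    rw [mul_one_div] at hz1
    rw [one_div_mul_one_div] at hz2
    nlinarith
  · have hlt : 1 < c ^ (-p) := Real.one_lt_rpow_of_pos_of_lt_one_of_neg hc.1 hc.2 (neg_lt_zero.2 hp)
    obtain ⟨K, h1, h2⟩ := exists_between hlt
    filter_upwards [hz.eventually (eventually_mul_lt_of_tendsto_div hpos
      (hrat c hc.1) h2), hz.eventually (hφ.eventually_mul_inv_minusInv_le hδ hΦ hrat
      (K := K * p) (by nlinarith)), eventually_gt_atTop 0] with z hz1 hz2 hz0
    rw [div_le_iff₀ hp]
    rw [mul_one_div] at hz1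
    rw [one_div_mul_one_div] at hz2
    nlinarith

end Intermediate

/-! ### Index `1` -/

theorem tendsto_ratePhi_of_mul_le (hφ : IsGauge φ a) (hδ : 0 < δ) {c : ℝ} (hc : 0 < c)
    (hlow : ∀ᶠ t in 𝓝[>] 0, c * t ≤ φ t) : Tendsto (ratePhi φ a δ) (𝓝[>] 0) atTop :=
  hφ.tendsto_ratePhi_of_minusInv_le hδ
    ⟨c⁻¹, inv_pos.2 hc, hφ.eventually_minusInv_le_inv_mul hc hlow⟩

theorem tendsto_ratePhi_div_of_index_one (hφ : IsGauge φ a) (hδ : 0 < δ)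
    (hΦ : Tendsto (ratePhi φ a δ) (𝓝[>] 0) atTop)
    (h : ∀ c > 0, Tendsto (fun t => φ (c * t) / φ t) (𝓝[>] 0) (𝓝 (c ^ (1 : ℝ)))) (c : ℝ)
    (hc : c > 0) : Tendsto (fun u => ratePhi φ a δ (c * u) / ratePhi φ a δ u) (𝓝[>] 0)
      (𝓝 (c ^ (0 : ℝ))) := by
  have := hφ.tendsto_ratePhi_div hδ hΦ (σ := 1) hc (by
    simpa using hφ.tendsto_minusInv_div one_pos h hc)
  rwa [sub_self] at this

theorem eventually_ratePhiInv_mul_le_of_slow (hφ : IsGauge φ a) (hδ : 0 < δ)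
    (hΦ : Tendsto (ratePhi φ a δ) (𝓝[>] 0) atTop) (hrat : ∀ c > 0,
      Tendsto (fun u => ratePhi φ a δ (c * u) / ratePhi φ a δ u) (𝓝[>] 0) (𝓝 (c ^ (0 : ℝ))))
    {c K : ℝ} (hc : 1 < c) (hK : 0 < K) :
    ∀ᶠ y in atTop, ratePhiInv φ a δ (c * y) ≤ K * ratePhiInv φ a δ y :=
  hφ.eventually_ratePhiInv_mul_le hδ hΦ (one_pos.trans hc) hK
    ((eventually_lt_mul_of_tendsto_div (hΦ.eventually_gt_atTop 0) (hrat K hK)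
      (by rwa [Real.rpow_zero])).mono fun t ht => ht.le)

theorem eventually_le_ratePhiInv_mul_of_slow (hφ : IsGauge φ a) (hδ : 0 < δ)
    (hΦ : Tendsto (ratePhi φ a δ) (𝓝[>] 0) atTop) (hrat : ∀ c > 0,
      Tendsto (fun u => ratePhi φ a δ (c * u) / ratePhi φ a δ u) (𝓝[>] 0) (𝓝 (c ^ (0 : ℝ))))
    {c K : ℝ} (hc : c ∈ Ioo (0 : ℝ) 1) (hK : 0 < K) :
    ∀ᶠ y in atTop, K * ratePhiInv φ a δ y ≤ ratePhiInv φ a δ (c * y) :=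
  hφ.eventually_le_ratePhiInv_mul hδ hΦ hc.1 hK
    ((eventually_mul_lt_of_tendsto_div (hΦ.eventually_gt_atTop 0) (hrat K hK)
      (by rw [Real.rpow_zero]; exact hc.2)).mono fun t ht => ht.le)

theorem rapidVaryTopNeg_ratePhiInv (hφ : IsGauge φ a) (hδ : 0 < δ)
    (hΦ : Tendsto (ratePhi φ a δ) (𝓝[>] 0) atTop) (hrat : ∀ c > 0,
      Tendsto (fun u => ratePhi φ a δ (c * u) / ratePhi φ a δ u) (𝓝[>] 0) (𝓝 (c ^ (0 : ℝ)))) :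
    RapidVaryTopNeg (ratePhiInv φ a δ) := by
  obtain ⟨y₀, hy₀, hanti, hpos⟩ := hφ.exists_antitoneOn_ratePhiInv hδ hΦ
  have hev := hφ.eventually_ratePhiInv_pos hδ hΦ
  refine ⟨⟨y₀, hy₀, ?_, fun y hy => one_div_pos.2 (hpos y hy)⟩, fun c hc => ?_, fun c hc => ?_⟩
  · exact aemeasurable_restrict_of_monotoneOn measurableSet_Ici fun y hy z hz hyz =>
      one_div_le_one_div_of_le (hpos z hz) (hanti hy hz hyz)
  · have hevc := (tendsto_id.const_mul_atTop hc.1).eventually hev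
    refine tendsto_div_of_eventually (hev.mono fun y hy => one_div_pos.2 hy) (fun K hK => ?_)
      fun K hK => ?_
    · filter_upwards [hev, hevc] with y h1 h2
      exact (mul_nonpos_of_nonpos_of_nonneg hK.le (one_div_pos.2 h1).le).trans (one_div_pos.2 h2).le
    · filter_upwards [hφ.eventually_le_ratePhiInv_mul_of_slow hδ hΦ hrat hc (inv_pos.2 hK), hev,
        hevc] with y h1 h2 h3
      have h3 : 0 < ratePhiInv φ a δ (c * y) := h3
      rw [mul_one_div, div_le_div_iff₀ h3 h2]
      rw [inv_mul_le_iff₀ hK] at h1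
      linarith
  · have hevc := (tendsto_id.const_mul_atTop (one_pos.trans hc)).eventually hev
    refine tendsto_atTop.2 fun K => ?_
    filter_upwards [hφ.eventually_ratePhiInv_mul_le_of_slow hδ hΦ hrat hc
      (inv_pos.2 (show 0 < |K| + 1 by positivity)), hev, hevc] with y h1 h2 h3
    have h3 : 0 < ratePhiInv φ a δ (c * y) := h3
    rw [div_div_div_cancel_left' _ _ one_ne_zero, le_div_iff₀ h3]
    rw [inv_mul_eq_div, le_div_iff₀ (by positivity)] at h1
    nlinarith [le_abs_self K]

theorem ratePhiInv_isLittleO_of_slow (hφ : IsGauge φ a) (hδ : 0 < δ)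
    (hΦ : Tendsto (ratePhi φ a δ) (𝓝[>] 0) atTop) (hrat : ∀ c > 0,
      Tendsto (fun u => ratePhi φ a δ (c * u) / ratePhi φ a δ u) (𝓝[>] 0) (𝓝 (c ^ (0 : ℝ))))
    (r : ℝ) : ratePhiInv φ a δ =o[atTop] fun y : ℝ => y ^ (-r) :=
  hφ.ratePhiInv_isLittleO hδ hΦ (lt_add_one r)
    (hφ.eventually_ratePhiInv_mul_le_of_slow hδ hΦ hrat one_lt_two (by positivity))

theorem ratePhiInv_exponential (hφ : IsGauge φ a) (hδ : 0 < δ) {μ : ℝ} (hμ : 0 < μ)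
    (h : (fun t => φ t - μ * t) =o[𝓝[>] 0] fun t : ℝ => t) :
    ∃ τ₁ τ₂ c₁ c₂ : ℝ, 0 < τ₁ ∧ 0 < τ₂ ∧ 0 < c₁ ∧ c₁ < c₂ ∧ c₂ < 1 ∧
      ∀ᶠ y : ℝ in atTop, τ₁ * c₁ ^ y ≤ ratePhiInv φ a δ y ∧
        ratePhiInv φ a δ y ≤ τ₂ * c₂ ^ y := by
  have hbd : ∀ᶠ t in 𝓝[>] 0, |φ t - μ * t| ≤ μ / 2 * t := by
    filter_upwards [h.bound (half_pos hμ), self_mem_nhdsWithin] with t ht ht0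
    rwa [Real.norm_eq_abs, Real.norm_of_nonneg (le_of_lt ht0)] at ht
  have hlow : ∀ᶠ t in 𝓝[>] 0, μ / 2 * t ≤ φ t := hbd.mono fun t ht => by
    linarith [(abs_le.1 ht).1]
  have hup : ∀ᶠ t in 𝓝[>] 0, φ t < 2 * μ * t := by
    filter_upwards [hbd, self_mem_nhdsWithin] with t ht ht0
    have ht0 : 0 < t := ht0
    nlinarith [(abs_le.1 ht).2]
  have hΦ := hφ.tendsto_ratePhi_of_mul_le hδ (half_pos hμ) hlow
  obtain ⟨v, hv, h₀⟩ := exists_pos_forall_of_eventually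
    ((hφ.eventually_minusInv_le_inv_mul (half_pos hμ) hlow).and
      (hφ.eventually_mul_le_minusInv (by positivity) hup))
  set A := ratePhi φ a δ v with hA
  -- From (μ/2)t ≤ φ(t) < 2μt, the difference Φ(u) - Φ(v) lies between (μ/2) ln(v/u) and 2μ ln(v/u);
  -- solving for u gives these constants.
  refine ⟨v * Real.exp (A / (μ / 2)), v * Real.exp (A / (2 * μ)), Real.exp (-1 / (μ / 2)),
    Real.exp (-1 / (2 * μ)), by positivity, by positivity, Real.exp_pos _, ?_, ?_, ?_⟩
  · rw [Real.exp_lt_exp, div_lt_div_iff₀ (by positivity) (by positivity)]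
    linarith
  · rw [Real.exp_lt_one_iff]
    exact div_neg_of_neg_of_pos (by norm_num) (by positivity)
  · filter_upwards [(hφ.tendsto_ratePhiInv hδ hΦ).eventually (Ioc_mem_nhdsGT hv),
      hφ.eventually_mem_image hδ hΦ] with y hy hmem
    have hy2 := (ratePhiInv_mem hmem).2
    set u := ratePhiInv φ a δ y
    have hu : 0 < u := hy.1
    have h1 := hφ.log_le_ratePhi_sub hδ hu hy.2 fun t ht => (h₀ t (hu.trans_le ht.1) ht.2).1
    have h2 := hφ.ratePhi_sub_le_log hδ hu hy.2
      (fun t ht => (h₀ t (hu.trans_le ht.1) ht.2).2) (by positivity)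
    rw [inv_inv, hy2, ← hA, Real.log_div hv.ne' hu.ne'] at h1 h2
    have e : ∀ κ : ℝ, v * Real.exp (A / κ) * Real.exp (-1 / κ) ^ y =
        Real.exp (Real.log v + (A - y) / κ) := fun κ => by
      rw [← Real.exp_mul, Real.exp_add, Real.exp_log hv, mul_assoc, ← Real.exp_add]
      congr 2
      ring
    rw [e, e, ← Real.le_log_iff_exp_le hu, ← Real.log_le_iff_le_exp hu, ← le_sub_iff_add_le',
      ← sub_le_iff_le_add', div_le_iff₀ (by positivity), le_div_iff₀ (by positivity)]
    constructor <;> linarith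

theorem tendsto_inv_ratePhiInv_mul_arrowInv (hφ : IsGauge φ a) (hδ : 0 < δ)
    (h : ∀ c > 0, Tendsto (fun t => φ (c * t) / φ t) (𝓝[>] 0) (𝓝 (c ^ (1 : ℝ))))
    (ho : (fun t : ℝ => t) =o[𝓝[>] 0] φ) :
    Tendsto (ratePhi φ a δ) (𝓝[>] 0) atTop ∧
      Tendsto (fun y => 1 / (ratePhiInv φ a δ y *
        arrowInv (fun y => 1 / (y * minusInv φ a (1 / y))) (1 / δ) y)) atTop (𝓝 0) := by
  have hlow : ∀ c > 0, ∀ᶠ t in 𝓝[>] 0, c * t ≤ φ t := fun c hc => by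
    filter_upwards [ho.bound (inv_pos.2 hc), self_mem_nhdsWithin] with t ht ht0
    rw [Real.norm_of_nonneg (le_of_lt ht0), Real.norm_of_nonneg (hφ.pos t ht0).le,
      inv_mul_eq_div, le_div_iff₀ hc] at ht
    linarith
  have hΦ := hφ.tendsto_ratePhi_of_mul_le hδ one_pos (hlow 1 one_pos)
  refine ⟨hΦ, ?_⟩
  have hrat := hφ.tendsto_ratePhi_div_of_index_one hδ hΦ h
  have hpos := hΦ.eventually_gt_atTop 0
  have hev := hφ.eventually_ratePhiInv_pos hδ hΦ
  have hz := tendsto_const_div_nhdsGT_zero one_pos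
  -- Φ varies slowly, so Karamata's relation with p = 0 makes g(z) negligible against Φ(1/z), hence
  -- against Φ(M/z) for every M.
  have hM : ∀ M > 0, ∀ᶠ y in atTop, M / ratePhiInv φ a δ y ≤
      arrowInv (fun y => 1 / (y * minusInv φ a (1 / y))) (1 / δ) y := by
    intro M hM
    refine hφ.eventually_le_arrowInv hδ hΦ hM (fun Z => ?_) (fun y => ?_) ?_
    · simpa using hφ.exists_rpow_mul_le hδ 0 Z
    · have hy : 0 < |y| + 1 := by positivity
      obtain ⟨z, h1, h2, h3⟩ := ((hz.eventually
        (hφ.eventually_minusInv_le_inv_mul hy (hlow _ hy))).and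
        ((eventually_ge_atTop (1 / δ)).and (eventually_gt_atTop 0))).exists
      refine ⟨z, h2, ?_⟩
      have h4 := hφ.minusInv_pos (one_div_pos.2 h3)
      rw [lt_div_iff₀ (mul_pos h3 h4)]
      rw [inv_mul_eq_div, le_div_iff₀ hy, le_div_iff₀ h3] at h1
      have h5 := mul_pos h3 h4
      nlinarith [le_abs_self y]
    · filter_upwards [hz.eventually (eventually_mul_lt_of_tendsto_div hpos (hrat M hM)
        (show (1 / 2 : ℝ) < M ^ (0 : ℝ) by norm_num)), hz.eventually
        (hφ.eventually_mul_inv_minusInv_le hδ hΦ (p := 0) (by simpa using hrat)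
          (show (0 : ℝ) < 1 / 2 by norm_num))] with z h1 h2
      rw [mul_one_div] at h1
      rw [one_div_mul_one_div] at h2
      exact h2.trans h1.le
  rw [tendsto_order]
  refine ⟨fun b hb => ?_, fun b hb => ?_⟩
  · filter_upwards [hev, hM 1 one_pos] with y h1 h2
    have := (one_div_pos.2 h1).trans_le h2
    exact hb.trans (by positivity)
  · filter_upwards [hev, hM (2 / b) (by positivity)] with y h1 h2
    rw [div_le_iff₀ h1] at h2
    have h3 : 0 < 2 / b := by positivity
    rw [mul_comm, div_lt_iff₀ (h3.trans_le h2)]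
    rw [div_le_iff₀ hb] at h2
    linarith

end IsGauge

namespace IsGauge

variable {φ : ℝ → ℝ} {a δ ρ : ℝ}

/-! ### Index `0` -/

section Slow

variable (hφ : IsGauge φ a) (hδ : 0 < δ)
  (h : ∀ c > 0, Tendsto (fun t => φ (c * t) / φ t) (𝓝[>] 0) (𝓝 (c ^ (0 : ℝ))))
include hφ hδ h

theorem tendsto_ratePhi_of_slow : Tendsto (ratePhi φ a δ) (𝓝[>] 0) atTop :=
  hφ.tendsto_ratePhi_of_minusInv_le hδ (hφ.exists_minusInv_le_mul_of_half
    (hφ.eventually_minusInv_le_of_slow (by simpa using h) (by norm_num) (by norm_num)))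

theorem eventually_mul_ratePhi_le_of_slow {c M : ℝ} (hc : c ∈ Ioo (0 : ℝ) 1) (hM : 0 < M) :
    ∀ᶠ u in 𝓝[>] 0, M * ratePhi φ a δ u ≤ ratePhi φ a δ (c * u) :=
  hφ.eventually_le_ratePhi_mul_of_rapid hδ (hφ.tendsto_ratePhi_of_slow hδ h) hc.1
    (fun _ hK => hφ.eventually_minusInv_le_of_slow (by simpa using h) hc hK) hM

theorem eventually_mul_ratePhi_mul_le_of_slow {c M : ℝ} (hc : 1 < c) (hM : 0 < M) :
    ∀ᶠ u in 𝓝[>] 0, M * ratePhi φ a δ (c * u) ≤ ratePhi φ a δ u := by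
  have hc0 := one_pos.trans hc
  have := eventually_nhdsGT_zero_comp_mul (hφ.eventually_mul_ratePhi_le_of_slow hδ h
    (c := c⁻¹) ⟨inv_pos.2 hc0, inv_lt_one_of_one_lt₀ hc⟩ hM) hc0
  simpa only [inv_mul_cancel_left₀ hc0.ne'] using this

theorem rapidVaryZeroNeg_ratePhi : RapidVaryZeroNeg (ratePhi φ a δ) := by
  have hΦ := hφ.tendsto_ratePhi_of_slow hδ h
  obtain ⟨t₀, ht₀, hpos⟩ := exists_ratePhi_pos hΦ
  have hev := hΦ.eventually_gt_atTop 0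
  refine ⟨⟨t₀, ht₀, ?_, fun t ht => one_div_pos.2 (hpos t ht)⟩, fun c hc => ?_, fun c hc => ?_⟩
  · exact aemeasurable_restrict_of_monotoneOn measurableSet_Ioc fun y hy z hz hyz =>
      one_div_le_one_div_of_le (hpos z hz)
        ((hφ.strictAntiOn_ratePhi hδ).antitoneOn hy.1 hz.1 hyz)
  · have hevc := eventually_nhdsGT_zero_comp_mul hev hc.1
    refine tendsto_div_of_eventually (hev.mono fun y hy => one_div_pos.2 hy) (fun K hK => ?_)
      fun K hK => ?_
    · filter_upwards [hev, hevc] with y h1 h2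
      exact (mul_nonpos_of_nonpos_of_nonneg hK.le (one_div_pos.2 h1).le).trans (one_div_pos.2 h2).le
    · filter_upwards [hφ.eventually_mul_ratePhi_le_of_slow hδ h hc (inv_pos.2 hK), hev, hevc]
        with y h1 h2 h3
      rw [mul_one_div, div_le_div_iff₀ h3 h2]
      rw [inv_mul_le_iff₀ hK] at h1
      linarith
  · have hevc := eventually_nhdsGT_zero_comp_mul hev (one_pos.trans hc)
    refine tendsto_atTop.2 fun K => ?_
    filter_upwards [hφ.eventually_mul_ratePhi_mul_le_of_slow hδ h hc
      (show 0 < |K| + 1 by positivity), hev, hevc] with y h1 h2 h3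
    rw [div_div_div_cancel_left' _ _ one_ne_zero, le_div_iff₀ h3]
    nlinarith [le_abs_self K]

theorem regVaryTop_ratePhiInv_of_slow : RegVaryTop 0 (ratePhiInv φ a δ) := by
  refine hφ.regVaryTop_ratePhiInv hδ (hφ.tendsto_ratePhi_of_slow hδ h)
    (fun c hc K hK0 hK => ?_) fun c hc K hK => ?_
  · rw [Real.rpow_zero] at hK
    exact hφ.eventually_mul_ratePhi_le_of_slow hδ h ⟨hK0, hK⟩ hc
  · rw [Real.rpow_zero] at hK
    refine (hφ.eventually_mul_ratePhi_mul_le_of_slow hδ h hK (inv_pos.2 hc)).mono fun u hu => ?_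
    rwa [inv_mul_le_iff₀ hc] at hu

theorem isLittleO_ratePhiInv_of_slow {r : ℝ} (hr : 0 < r) :
    (fun y : ℝ => y ^ (-r)) =o[atTop] ratePhiInv φ a δ := by
  have hΦ := hφ.tendsto_ratePhi_of_slow hδ h
  refine hφ.isLittleO_ratePhiInv hδ hΦ (half_lt_self hr) ?_
  exact (eventually_mul_lt_of_tendsto_div (hφ.eventually_ratePhiInv_pos hδ hΦ)
    ((hφ.regVaryTop_ratePhiInv_of_slow hδ h).2 2 two_pos)
    (Real.rpow_lt_rpow_of_exponent_lt one_lt_two (by linarith))).mono fun t ht => ht.le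

end Slow

/-- If `ln g` varies regularly with positive index, then `ln (1 / φ⁻ (1 / z))` dominates `ln z`. -/
theorem eventually_mul_log_le (hφ : IsGauge φ a) {q : ℝ} (hq : 0 < q)
    (hg : RegVaryTop q fun y => Real.log (1 / (y * minusInv φ a (1 / y)))) (A : ℝ) :
    ∀ᶠ z in atTop, A * Real.log z ≤ -Real.log (minusInv φ a (1 / z)) := by
  obtain ⟨⟨b, hb, -, hpos⟩, hrat⟩ := hg
  set L := fun y => Real.log (1 / (y * minusInv φ a (1 / y))) with hL
  have hev : ∀ᶠ y in atTop, 0 < L y := by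
    filter_upwards [eventually_ge_atTop b] with y hy using hpos y hy
  have h2 := eventually_mul_lt_of_tendsto_div hev (hrat 2 two_pos)
    (Real.rpow_lt_rpow_of_exponent_lt one_lt_two (half_lt_self hq))
  obtain ⟨z₁, h₁⟩ := eventually_atTop.1 h2
  set z₀ := max (max b z₁) 1 with hz₀
  have hz₀1 : 1 ≤ z₀ := le_max_right _ _
  have hz₀b : b ≤ z₀ := (le_max_left _ _).trans (le_max_left _ _)
  have hz₀z : z₁ ≤ z₀ := (le_max_right _ _).trans (le_max_left _ _)
  have hz₀p : 0 < z₀ := one_pos.trans_le hz₀1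
  have hLk : ∀ z, 0 < z → L z = -Real.log (minusInv φ a (1 / z)) - Real.log z := fun z hz => by
    have := hφ.minusInv_pos (one_div_pos.2 hz)
    rw [hL]
    simp only
    rw [one_div, Real.log_inv, Real.log_mul hz.ne' this.ne']
    ring
  have hpow : ∀ n : ℕ, ((2 : ℝ) ^ n) ^ (q / 2) * L z₀ ≤ L (2 ^ n * z₀) := by
    intro n
    induction n with
    | zero => simp
    | succ n ih =>
      have h1 : (1 : ℝ) ≤ 2 ^ n := one_le_pow₀ (by norm_num)
      have h3 := h₁ (2 ^ n * z₀) (by nlinarith)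
      calc ((2 : ℝ) ^ (n + 1)) ^ (q / 2) * L z₀
          = 2 ^ (q / 2) * (((2 : ℝ) ^ n) ^ (q / 2) * L z₀) := by
            rw [pow_succ, Real.mul_rpow (by positivity) (by norm_num)]; ring
        _ ≤ 2 ^ (q / 2) * L (2 ^ n * z₀) := by gcongr
        _ ≤ L (2 * (2 ^ n * z₀)) := h3.le
        _ = L (2 ^ (n + 1) * z₀) := by ring_nf
  have hL0 : 0 < L z₀ := hpos z₀ hz₀b
  -- `L` need not be monotone, but -ln φ⁻(1/z) is, and it dominates `L` for z ≥ 1; this extends the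
  -- growth from dyadic points to all z.
  have hkey : ∀ z ≥ z₀, L z₀ / (2 * z₀) ^ (q / 2) * z ^ (q / 2) ≤
      -Real.log (minusInv φ a (1 / z)) := by
    intro z hz
    obtain ⟨n, hn1, hn2⟩ := exists_nat_pow_near ((one_le_div hz₀p).2 hz) (one_lt_two (α := ℝ))
    rw [le_div_iff₀ hz₀p] at hn1
    rw [div_lt_iff₀ hz₀p, pow_succ] at hn2
    have h2n : (1 : ℝ) ≤ 2 ^ n := one_le_pow₀ (by norm_num)
    have hzp : 0 < z := hz₀p.trans_le hz
    have hnp : 0 < 2 ^ n * z₀ := by positivity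
    calc L z₀ / (2 * z₀) ^ (q / 2) * z ^ (q / 2)
        ≤ L z₀ / (2 * z₀) ^ (q / 2) * (2 ^ n * (2 * z₀)) ^ (q / 2) := by
          gcongr
          linarith
      _ = ((2 : ℝ) ^ n) ^ (q / 2) * L z₀ := by
          rw [Real.mul_rpow (x := 2 ^ n) (by positivity) (by positivity), div_mul_eq_mul_div,
            div_eq_iff (by positivity)]
          ring
      _ ≤ L (2 ^ n * z₀) := hpow n
      _ = -Real.log (minusInv φ a (1 / (2 ^ n * z₀))) - Real.log (2 ^ n * z₀) := hLk _ hnp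
      _ ≤ -Real.log (minusInv φ a (1 / (2 ^ n * z₀))) := by
          linarith [Real.log_nonneg (show 1 ≤ 2 ^ n * z₀ by nlinarith)]
      _ ≤ -Real.log (minusInv φ a (1 / z)) := by
          have := Real.log_le_log (hφ.minusInv_pos (one_div_pos.2 hzp))
            (hφ.minusInv_mono (one_div_pos.2 hzp) (one_div_pos.2 hnp)
              (one_div_le_one_div_of_le hnp hn1))
          linarith
  have hC : 0 < L z₀ / (2 * z₀) ^ (q / 2) := by positivity
  have hlog := (isLittleO_log_rpow_atTop (half_pos hq)).bound
    (div_pos hC (show 0 < |A| + 1 by positivity))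
  filter_upwards [hlog, eventually_ge_atTop z₀] with z hz1 hz2
  have hlz : 0 ≤ Real.log z := Real.log_nonneg (hz₀1.trans hz2)
  rw [Real.norm_of_nonneg hlz, Real.norm_of_nonneg (Real.rpow_nonneg (hz₀p.le.trans hz2) _),
    div_mul_eq_mul_div, le_div_iff₀ (by positivity)] at hz1
  have := hkey z hz2
  nlinarith [le_abs_self A]

/-- Dilation by c multiplies ln g by more than some K > 1. The surplus (K - 1)(-ln φ⁻(1/z)) exceeds
any multiple of ln z. -/
theorem eventually_rpow_mul_le (hφ : IsGauge φ a) {q : ℝ} (hq : 0 < q)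
    (hg : RegVaryTop q fun y => Real.log (1 / (y * minusInv φ a (1 / y)))) {c : ℝ} (hc : 1 < c)
    (A : ℝ) : ∀ᶠ z in atTop,
      z ^ A * (1 / minusInv φ a (1 / z)) ≤ 1 / minusInv φ a (1 / (c * z)) := by
  have hc0 : 0 < c := one_pos.trans hc
  have hev : ∀ᶠ y in atTop, 0 < Real.log (1 / (y * minusInv φ a (1 / y))) := by
    obtain ⟨⟨b, hb, -, hpos⟩, -⟩ := hg
    filter_upwards [eventually_ge_atTop b] with y hy using hpos y hy
  obtain ⟨K, hK1, hK2⟩ := exists_between (Real.one_lt_rpow hc hq)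
  have hη : 0 < K - 1 := sub_pos.2 hK1
  filter_upwards [eventually_mul_lt_of_tendsto_div hev (hg.2 c hc0) hK2,
    hφ.eventually_mul_log_le hq hg (A / (K - 1) + 1), eventually_gt_atTop 0] with z h1 h2 hz
  have hcz := mul_pos hc0 hz
  have hN := hφ.minusInv_pos (one_div_pos.2 hz)
  have hN' := hφ.minusInv_pos (one_div_pos.2 hcz)
  rw [one_div, Real.log_inv, Real.log_mul hz.ne' hN.ne', one_div (_ * _), Real.log_inv,
    Real.log_mul hcz.ne' hN'.ne', Real.log_mul hc0.ne' hz.ne'] at h1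
  have hlogc := Real.log_pos hc
  have h3 : A * Real.log z + (K - 1) * Real.log z ≤
      (K - 1) * -Real.log (minusInv φ a (1 / z)) := by
    calc _ = (K - 1) * ((A / (K - 1) + 1) * Real.log z) := by field_simp
      _ ≤ _ := by gcongr
  rw [← Real.log_le_log_iff (by positivity) (by positivity), Real.log_mul (by positivity)
    (by positivity), Real.log_rpow hz, one_div (minusInv _ _ _), one_div (minusInv _ _ _),
    Real.log_inv, Real.log_inv]
  linarith

/-- Crude bounds on the integral locate Φ(c/z) up to a power of z and a dilation inside φ⁻, and the
dilation absorbs every power. -/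
theorem ratePhiInv_isEquivalent_of_slow (hφ : IsGauge φ a) (hδ : 0 < δ)
    (h : ∀ c > 0, Tendsto (fun t => φ (c * t) / φ t) (𝓝[>] 0) (𝓝 (c ^ (0 : ℝ))))
    {q : ℝ} (hq : 0 < q)
    (hg : RegVaryTop q fun y => Real.log (1 / (y * minusInv φ a (1 / y)))) (β : ℝ) :
    ratePhiInv φ a δ ~[atTop] fun y =>
      1 / arrowInv (fun z => z ^ β * (1 / (z * minusInv φ a (1 / z)))) (1 / δ) y := by
  have hΦδ : ratePhi φ a δ δ = 0 := by simp [ratePhi]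
  refine hφ.ratePhiInv_isEquivalent hδ (hφ.tendsto_ratePhi_of_slow hδ h)
    (hφ.exists_rpow_mul_le hδ β) (fun c hc => ?_) fun c hc => ?_
  · have hc0 : 0 < c := one_pos.trans hc
    have hzc : Tendsto (fun z : ℝ => z / c) atTop atTop := tendsto_id.atTop_div_const hc0
    filter_upwards [hzc.eventually (hφ.eventually_rpow_mul_le hq hg hc (2 - β)),
      (tendsto_const_div_nhdsGT_zero hc0).eventually (Ioc_mem_nhdsGT hδ), eventually_gt_atTop 0,
      eventually_gt_atTop (δ / c ^ (β - 2))] with z h1 h2 hz h3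
    have hN := hφ.minusInv_pos h2.1
    have hN' := hφ.minusInv_pos (one_div_pos.2 hz)
    have h4 := hφ.ratePhi_sub_le_mul hδ h2.1 h2.2
    rw [hΦδ, sub_zero] at h4
    rw [one_div_div, mul_div_cancel₀ _ hc0.ne'] at h1
    rw [div_lt_iff₀ (by positivity)] at h3
    calc ratePhi φ a δ (c / z) ≤ (δ - c / z) * (1 / minusInv φ a (c / z)) := h4
      _ < z * c ^ (β - 2) * (1 / minusInv φ a (c / z)) := by
        refine mul_lt_mul_of_pos_right ?_ (one_div_pos.2 hN)
        linarith [h2.1]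
      _ = z ^ (β - 1) * ((z / c) ^ (2 - β) * (1 / minusInv φ a (c / z))) := by
        rw [Real.div_rpow hz.le hc0.le, ← neg_sub 2 β, Real.rpow_neg hc0.le]
        have e : z = z ^ (β - 1) * z ^ (2 - β) := by
          rw [← Real.rpow_add hz]
          ring_nf
          rw [Real.rpow_one]
        nth_rewrite 1 [e]
        rw [div_eq_mul_inv]
        ring
      _ ≤ z ^ (β - 1) * (1 / minusInv φ a (1 / z)) := by gcongr
      _ = z ^ β * (1 / (z * minusInv φ a (1 / z))) := by
        rw [Real.rpow_sub_one hz.ne']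
        field_simp
  -- Only the piece of the integral over [c/z, c'/z] is kept; the remaining dilation from c' to 1
  -- absorbs the factor z^(β+1).
  · obtain ⟨c', hcc', hc'⟩ := exists_between hc.2
    have hc0 := hc.1
    have hc'0 : 0 < c' := hc0.trans hcc'
    filter_upwards [hφ.eventually_rpow_mul_le hq hg ((one_lt_inv₀ hc'0).2 hc') (β + 1),
      (tendsto_const_div_nhdsGT_zero hc'0).eventually (Ioc_mem_nhdsGT hδ), eventually_gt_atTop 0,
      eventually_ge_atTop (1 / (c' - c))] with z h1 h2 hz h3
    have hN := hφ.minusInv_pos h2.1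
    have hN' := hφ.minusInv_pos (one_div_pos.2 hz)
    rw [show 1 / (c'⁻¹ * z) = c' / z by field_simp] at h1
    have h4 := hφ.mul_le_ratePhi_sub hδ (div_pos hc0 hz) (v := c' / z) (by gcongr)
    have h5 := hφ.mul_le_ratePhi_sub hδ h2.1 h2.2
    rw [hΦδ, sub_zero] at h5
    have h6 : 0 ≤ ratePhi φ a δ (c' / z) :=
      (mul_nonneg (sub_nonneg.2 h2.2) (one_div_pos.2 (hφ.minusInv_pos hδ)).le).trans h5
    rw [div_le_iff₀ (sub_pos.2 hcc')] at h3
    have hcc : 0 < c' - c := sub_pos.2 hcc'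
    calc z ^ β * (1 / (z * minusInv φ a (1 / z)))
        = 1 * (z ^ β * (1 / minusInv φ a (1 / z))) / z := by field_simp
      _ ≤ (z * (c' - c)) * (z ^ β * (1 / minusInv φ a (1 / z))) / z := by gcongr
      _ = (c' / z - c / z) * (z ^ (β + 1) * (1 / minusInv φ a (1 / z))) := by
        rw [Real.rpow_add_one hz.ne']
        field_simp
      _ ≤ (c' / z - c / z) * (1 / minusInv φ a (c' / z)) := by
        rw [← sub_div]
        gcongr
      _ ≤ ratePhi φ a δ (c / z) := by linarith

end IsGauge

/-! ### The rate function of a regularity function -/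

section PhiHat

variable {E : Type*} [NormedAddCommGroup E] {m : ℕ} {T : Fin m → E → E}
  {B : Set E} {ρ : ℝ} {ψ : ℝ → ℝ} {α ν s a : ℝ}

theorem IsRegularityFunction.pos (hψ : IsRegularityFunction T B ρ ψ) {t : ℝ} (ht : 0 < t) :
    0 < ψ t := by
  obtain ⟨⟨c, hc, -, hpos⟩, -⟩ := hψ.regVary
  exact (hpos (min t c) ⟨lt_min ht hc, min_le_right _ _⟩).trans_le
    (hψ.mono (le_min ht.le (le_of_lt hc)) ht.le (min_le_left _ _))

theorem tendsto_sqrt_mul_nhdsGT_zero {κ : ℝ} (hκ : 0 < κ) :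
    Tendsto (fun u => √(κ * u)) (𝓝[>] 0) (𝓝[>] 0) := by
  refine tendsto_nhdsWithin_iff.2 ⟨?_, ?_⟩
  · have : Tendsto (fun u => √(κ * u)) (𝓝 0) (𝓝 √(κ * 0)) :=
      (Real.continuous_sqrt.comp (continuous_const_mul κ)).tendsto 0
    rw [mul_zero, Real.sqrt_zero] at this
    exact this.mono_left nhdsWithin_le_nhds
  · filter_upwards [self_mem_nhdsWithin] with u hu
    exact Real.sqrt_pos.2 (mul_pos hκ hu)

theorem IsRegularityFunction.isGauge_phiHat (hψ : IsRegularityFunction T B ρ ψ)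
    (hκ : 0 < 2 * α * (1 + 4 * ν * s) / (ν * (1 - α))) (ha : 0 < a) :
    IsGauge (phiHat α ν s ψ) a := by
  refine ⟨ha, fun u hu v hv huv => ?_, fun t ht => ?_, ?_⟩
  · refine pow_le_pow_left₀ (hψ.nonneg _ (Real.sqrt_nonneg _)) ?_ 2
    refine hψ.mono (Real.sqrt_nonneg _) (Real.sqrt_nonneg _) (Real.sqrt_le_sqrt ?_)
    gcongr
  · exact pow_pos (hψ.pos (Real.sqrt_pos.2 (mul_pos hκ ht))) 2
  · have := (hψ.tendsto_zero.comp (tendsto_sqrt_mul_nhdsGT_zero hκ)).pow 2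
    rwa [zero_pow two_ne_zero] at this

/-- The square root halves the index and the square doubles it, so φ inherits the index of ψ. -/
theorem IsRegularityFunction.tendsto_phiHat_div (hψ : IsRegularityFunction T B ρ ψ)
    (hκ : 0 < 2 * α * (1 + 4 * ν * s) / (ν * (1 - α))) (c : ℝ) (hc : c > 0) :
    Tendsto (fun t => phiHat α ν s ψ (c * t) / phiHat α ν s ψ t) (𝓝[>] 0) (𝓝 (c ^ ρ)) := by
  have h1 := ((hψ.regVary.2 (√c) (Real.sqrt_pos.2 hc)).comp (tendsto_sqrt_mul_nhdsGT_zero hκ)).pow 2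
  have e : (√c ^ ρ) ^ 2 = c ^ ρ := by
    rw [← Real.rpow_natCast, ← Real.rpow_mul (Real.sqrt_nonneg c), mul_comm,
      Real.rpow_mul (Real.sqrt_nonneg c), Real.rpow_natCast, Real.sq_sqrt (le_of_lt hc)]
  rw [e] at h1
  refine h1.congr fun t => ?_
  simp only [Function.comp_apply, phiHat, div_pow, ← Real.sqrt_mul (le_of_lt hc)]
  rw [mul_left_comm]

/-- A regularity function over a connected set is bounded below by a linear function, unless the
set is contained in the set of common fixed points. -/
theorem IsRegularityFunction.exists_mul_le_phiHat (hψ : IsRegularityFunction T B ρ ψ)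
    (hκ : 0 < 2 * α * (1 + 4 * ν * s) / (ν * (1 - α))) (hT : ∀ i, LipschitzWith 1 (T i))
    (hB : IsConnected B) {y z : E} (hz : z ∈ commonFix T) (hzB : z ∈ B) (hyB : y ∈ B)
    (hy : 0 < Metric.infDist y (commonFix T)) :
    ∃ c : ℝ, 0 < c ∧ ∀ᶠ t in 𝓝[>] 0, c * t ≤ phiHat α ν s ψ t := by
  refine ⟨2 * α * (1 + 4 * ν * s) / (ν * (1 - α)) / 4, by positivity, ?_⟩
  have hψlow : ∀ᶠ t in 𝓝[>] 0, t / 2 ≤ ψ t := by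
    filter_upwards [Ioo_mem_nhdsGT hy] with t ht
    obtain ⟨x, hx, hxt⟩ := hB.isPreconnected.intermediate_value hzB hyB
      (Metric.continuous_infDist_pt (commonFix T)).continuousOn
      (show t / 2 ∈ Icc (Metric.infDist z (commonFix T)) (Metric.infDist y (commonFix T)) from
        ⟨by rw [Metric.infDist_zero_of_mem hz]; linarith [ht.1], by linarith [ht.1, ht.2]⟩)
    simp only at hxt
    rw [← hxt]
    refine (hψ.error_bound x hx).trans (hψ.mono (Real.iSup_nonneg fun i => norm_nonneg _)
      (show (0 : ℝ) ≤ t from ht.1.le) (Real.iSup_le (fun i => ?_) ht.1.le))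
    have := norm_sub_le_two_mul_infDist hT ⟨z, hz⟩ x i
    linarith
  filter_upwards [(tendsto_sqrt_mul_nhdsGT_zero hκ).eventually hψlow, self_mem_nhdsWithin]
    with t ht ht0
  have ht0 : 0 < t := ht0
  have h1 := pow_le_pow_left₀ (by positivity) ht 2
  rw [div_pow, Real.sq_sqrt (by positivity)] at h1
  rw [phiHat]
  linarith

end PhiHat

/-- The recursive inequality `d k ≤ φ (d k - d (k + s))` yields the rate `Φ⁻¹ (Φ (d 0) + ⌊k / s⌋)`. -/
theorem IsGauge.le_ratePhiInv {φ : ℝ → ℝ} {a δ : ℝ} (hφ : IsGauge φ a) (hδ : 0 < δ) {D : ℕ → ℝ}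
    (hD : ∀ k, 0 < D k) (hanti : Antitone D) {s : ℕ} (hφ0 : ∀ u ≤ 0, φ u = 0)
    (h : ∀ k, D k ≤ φ (D k - D (k + s))) (k : ℕ) :
    ratePhi φ a δ (D 0) + ((k / s : ℕ) : ℝ) ∈ ratePhi φ a δ '' Ioi 0 ∧
      D k ≤ ratePhiInv φ a δ (ratePhi φ a δ (D 0) + ((k / s : ℕ) : ℝ)) := by
  have hstep : ∀ k, ratePhi φ a δ (D k) + 1 ≤ ratePhi φ a δ (D (k + s)) := fun k => by
    -- Without strict decrease over a sweep, the recursion would give D k ≤ φ(0) = 0.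
    have hdiff : 0 < D k - D (k + s) := by
      by_contra! hle
      have := h k
      rw [hφ0 _ hle] at this
      linarith [hD k]
    have h1 := hφ.minusInv_le hdiff (h k)
    have h2 := hφ.mul_le_ratePhi_sub hδ (hD (k + s)) (hanti (Nat.le_add_right k s))
    have h3 : 1 ≤ (D k - D (k + s)) * (1 / minusInv φ a (D k)) := by
      rw [mul_one_div]
      exact (one_le_div (hφ.minusInv_pos (hD k))).2 h1
    linarith
  have hmul : ∀ n : ℕ, ratePhi φ a δ (D 0) + n ≤ ratePhi φ a δ (D (n * s)) := by
    intro n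
    induction n with
    | zero => simp
    | succ n ih =>
      have := hstep (n * s)
      rw [← Nat.succ_mul] at this
      push_cast
      linarith
  have hmem := hφ.mem_image_of_mem_Icc hδ (hD (k / s * s)) (hD 0)
    (le_add_of_nonneg_right (Nat.cast_nonneg (k / s))) (hmul (k / s))
  refine ⟨hmem, (hanti (Nat.div_mul_le_self k s)).trans ?_⟩
  exact (hφ.le_ratePhiInv_iff hδ hmem (hD _)).2 (hmul (k / s))

/-! ### The main theorem -/

theorem corollary5p7 {E : Type*} [NormedAddCommGroup E] [InnerProductSpace ℝ E]
    {d m : ℕ} (hm : 0 < m) (b : Module.Basis (Fin d) ℝ E)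
    (α : ℝ) (hα : α ∈ Ioo (0 : ℝ) 1)
    (T : Fin m → E → E) (hT : ∀ i, IsAveraged α (T i)) (hF : (commonFix T).Nonempty)
    (O : OMinimalStructure) (hdef : ∀ i, O.DefinableOperator b (T i)) :
    -- joint Karamata regularity over every bounded set
    (∀ B : Set E, Bornology.IsBounded B → JointlyKaramataRegular T B) ∧
    -- rates of convergence of quasi-cyclic algorithms
    ∀ (w : ℕ → Fin m → ℝ) (x : ℕ → E), IsQuasiCyclic T w x →
      Bornology.IsBounded (range x) ∧
      ∀ s : ℕ, 0 < s → (∀ k i, ∃ j < s, 0 < w (k + j) i) →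
        ∃ xlim ∈ commonFix T, Tendsto x atTop (𝓝 xlim) ∧
        ∀ B : Set E, Bornology.IsBounded B → range x ⊆ B →
        ∀ (ρ : ℝ) (ψ : ℝ → ℝ), IsRegularityFunction T B ρ ψ →
        ∀ a δ : ℝ, Metric.infDist (x 0) (commonFix T) ^ 2 < a → 0 < δ →
        ∀ φ Φ Φinv g : ℝ → ℝ,
        φ = phiHat α (minWeight w) s ψ →
        Φ = ratePhi φ a δ →
        Φinv = ratePhiInv φ a δ →
        g = (fun y => 1 / (y * minusInv φ a (1 / y))) →
        -- the general rate
        (ContinuousOn Φ (Ioi 0) ∧ StrictAntiOn Φ (Ioi 0) ∧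
          ((∃ K, ∀ k ≥ K, x k = xlim) ∨
            ∀ k : ℕ,
              Φ (Metric.infDist (x 0) (commonFix T) ^ 2) + ((k / s : ℕ) : ℝ) ∈ Φ '' Ioi 0 ∧
              Metric.infDist (x k) (commonFix T) ≤
                √(Φinv (Φ (Metric.infDist (x 0) (commonFix T) ^ 2) + ((k / s : ℕ) : ℝ))))) ∧
        -- the asymptotic behaviour of the rate in terms of the index
        (ρ = 0 → Tendsto Φ (𝓝[>] 0) atTop ∧ RapidVaryZeroNeg Φ ∧ RegVaryTop 0 Φinv ∧
          ∀ r : ℝ, 0 < r → (fun y : ℝ => y ^ (-r)) =o[atTop] Φinv) ∧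
        (ρ ∈ Ioo (0 : ℝ) 1 → Tendsto Φ (𝓝[>] 0) atTop ∧ RegVaryZero (1 - 1 / ρ) Φ ∧
          RegVaryTop (ρ / (ρ - 1)) Φinv ∧
          ∀ r : ℝ, 0 < r → r < -(ρ / (ρ - 1)) → Φinv =o[atTop] (fun y : ℝ => y ^ (-r))) ∧
        (ρ = 1 →
          ((¬ ∃ K, ∀ k ≥ K, x k = xlim) ∧ IsClosed B ∧ IsConnected B) ∨
            (∃ c : ℝ, 0 < c ∧ ∀ᶠ t in 𝓝[>] 0, c * t ≤ φ t) →
          Tendsto Φ (𝓝[>] 0) atTop ∧ RegVaryZero 0 Φ ∧ RapidVaryTopNeg Φinv ∧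
          ∀ r : ℝ, 0 < r → Φinv =o[atTop] (fun y : ℝ => y ^ (-r))) ∧
        -- the tighter rates
        (ρ = 0 → ∀ q : ℝ, 0 < q → RegVaryTop q (fun y => Real.log (g y)) →
          ∀ β : ℝ, Φinv ~[atTop] (fun y => 1 / arrowInv (fun z => z ^ β * g z) (1 / δ) y)) ∧
        (ρ ∈ Ioo (0 : ℝ) 1 →
          Φinv ~[atTop] (fun y => 1 / arrowInv g (1 / δ) ((1 / ρ - 1) * y))) ∧
        (ρ = 1 → (∃ μ : ℝ, 0 < μ ∧ (fun t => φ t - μ * t) =o[𝓝[>] 0] (fun t : ℝ => t)) →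
          ∃ τ₁ τ₂ c₁ c₂ : ℝ, 0 < τ₁ ∧ 0 < τ₂ ∧ 0 < c₁ ∧ c₁ < c₂ ∧ c₂ < 1 ∧
            ∀ᶠ y : ℝ in atTop, τ₁ * c₁ ^ y ≤ Φinv y ∧ Φinv y ≤ τ₂ * c₂ ^ y) ∧
        (ρ = 1 → (fun t : ℝ => t) =o[𝓝[>] 0] φ →
          Tendsto Φ (𝓝[>] 0) atTop ∧
          Tendsto (fun y => 1 / (Φinv y * arrowInv g (1 / δ) y)) atTop (𝓝 0)) := by
  have hL : ∀ i, LipschitzWith 1 (T i) := fun i => (hT i).lipschitzWith hα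
  have : FiniteDimensional ℝ E := Module.Basis.finiteDimensional_of_finite b
  have : ProperSpace E := FiniteDimensional.proper_real E
  refine ⟨fun B hB => jointlyKaramataRegular_of_definable b hdef hL hF hB, fun w x hx => ?_⟩
  obtain ⟨z, hz⟩ := hF
  refine ⟨hx.isBounded_range hα hT hz, fun s _ hcyc => ?_⟩
  obtain ⟨xlim, hxlim, hlim⟩ := hx.exists_tendsto hα hT ⟨z, hz⟩ hcyc
  refine ⟨xlim, hxlim, hlim, fun B _ hxB ρ ψ hψ a δ ha hδ φ Φ Φinv g hφeq hΦeq hΦinveq hgeq => ?_⟩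
  have hκ : 0 < 2 * α * (1 + 4 * minWeight w * (s : ℝ)) / (minWeight w * (1 - α)) := by
    have h1 := hα.1
    have h2 : 0 < 1 - α := by linarith [hα.2]
    have h3 := hx.minWeight_pos
    positivity
  have hφ : IsGauge φ a := hφeq ▸ hψ.isGauge_phiHat hκ ((sq_nonneg _).trans_lt ha)
  have hrat : ∀ c > 0, Tendsto (fun t => φ (c * t) / φ t) (𝓝[>] 0) (𝓝 (c ^ ρ)) := by
    rw [hφeq]
    exact hψ.tendsto_phiHat_div hκ
  rw [hΦeq, hΦinveq, hgeq]
  refine ⟨⟨hφ.continuousOn_ratePhi hδ, hφ.strictAntiOn_ratePhi hδ, ?_⟩, ?_, ?_, ?_, ?_, ?_, ?_, ?_⟩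
  · refine or_iff_not_imp_left.2 fun hne k => ?_
    have hpos := hx.infDist_pos_of_not_eventually_eq hα hT hxlim hlim hne
    -- The real square root is 0 on nonpositive arguments, and ψ(0) = 0.
    have hφ0 : ∀ u ≤ 0, φ u = 0 := fun u hu => by
      rw [hφeq, phiHat, Real.sqrt_eq_zero_of_nonpos (mul_nonpos_of_nonneg_of_nonpos hκ.le hu),
        hψ.map_zero, zero_pow two_ne_zero]
    obtain ⟨h1, h2⟩ := hφ.le_ratePhiInv hδ (D := fun k => Metric.infDist (x k) (commonFix T) ^ 2)
      (fun k => pow_pos (hpos k) 2) (fun j k hjk => pow_le_pow_left₀ Metric.infDist_nonneg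
        (hx.infDist_antitone hα hT ⟨z, hz⟩ hjk) 2) hφ0
      (fun k => by rw [hφeq]; exact hx.infDist_sq_le_phiHat hα hT ⟨z, hz⟩ hcyc hxB hψ k) k
    exact ⟨h1, Real.le_sqrt_of_sq_le h2⟩
  · rintro rfl
    exact ⟨hφ.tendsto_ratePhi_of_slow hδ hrat, hφ.rapidVaryZeroNeg_ratePhi hδ hrat,
      hφ.regVaryTop_ratePhiInv_of_slow hδ hrat,
      fun r hr => hφ.isLittleO_ratePhiInv_of_slow hδ hrat hr⟩
  · intro hρ
    have hΦ := hφ.tendsto_ratePhi_of_mem_Ioo hδ hρ hrat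
    exact ⟨hΦ, hφ.regVaryZero_ratePhi hδ hΦ (hφ.tendsto_ratePhi_div_of_mem_Ioo hδ hρ hrat),
      hφ.regVaryTop_ratePhiInv_of_mem_Ioo hδ hρ hrat,
      fun r _ hr => hφ.ratePhiInv_isLittleO_of_mem_Ioo hδ hρ hrat hr⟩
  · rintro rfl hor
    obtain ⟨c, hc, hlow⟩ : ∃ c : ℝ, 0 < c ∧ ∀ᶠ t in 𝓝[>] 0, c * t ≤ φ t := by
      rcases hor with ⟨hne, hBcl, hBconn⟩ | h
      · rw [hφeq]
        -- The closed connected set B contains the limit, which is in F, and x⁰, which is not, so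
        -- the distance takes all small values on B.
        exact hψ.exists_mul_le_phiHat hκ hL hBconn hxlim
          (hBcl.mem_of_tendsto hlim (Eventually.of_forall fun k => hxB (mem_range_self k)))
          (hxB (mem_range_self 0)) (hx.infDist_pos_of_not_eventually_eq hα hT hxlim hlim hne 0)
      · exact h
    have hΦ := hφ.tendsto_ratePhi_of_mul_le hδ hc hlow
    have hΦrat := hφ.tendsto_ratePhi_div_of_index_one hδ hΦ hrat
    exact ⟨hΦ, hφ.regVaryZero_ratePhi hδ hΦ hΦrat, hφ.rapidVaryTopNeg_ratePhiInv hδ hΦ hΦrat,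
      fun r _ => hφ.ratePhiInv_isLittleO_of_slow hδ hΦ hΦrat r⟩
  · rintro rfl q hq hg β
    exact hφ.ratePhiInv_isEquivalent_of_slow hδ hrat hq hg β
  · intro hρ
    exact hφ.ratePhiInv_isEquivalent_of_mem_Ioo hδ hρ hrat
  · rintro rfl ⟨μ, hμ, hμo⟩
    exact hφ.ratePhiInv_exponential hδ hμ hμo
  · rintro rfl ho
    exact hφ.tendsto_inv_ratePhiInv_mul_arrowInv hδ hrat ho
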